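/- For a positive integer $N$ and positive integers $s_1,\ldots,s_k$, let $$H_N(s_1,\ldots,s_k)=\sum_{N\ge n_1>\cdots>n_k\ge 1}\frac{1}{n_1^{s_1}\cdots n_k^{s_k}}\in\mathbb{Q}.$$ For positive integers $r,k$ and a prime $p$, let $$C_{r,k,p}=\sum_{\substack{n_1,\ldots,n_k\ge 1\\ n_1+\cdots+n_k=p^r\\ p\nmid n_1\cdots n_k}}\frac{1}{n_1\cdots n_k}\in\mathbb{Q}.$$ For rational numbers $x,y$ and a positive integer $m$, write $x\equiv y \bmod m$ if the numerator (in lowest terms) of $x-y$ is divisible by $m$. Then each of the following four congruences holds for all but finitely many primes $p$: $$C_{2,3,p}\equiv -2p\,H_{p-1}(2,1)+\left(2p^3-\tfrac{11}{5}p^5\right)H_{p-1}(4,1)-\tfrac{69}{35}p^5H_{p-1}(6,1) \mod p^6,$$ $$C_{2,4,p}\equiv -\tfrac{24}{5}p^2H_{p-1}(4,1)+\tfrac{28}{15}p^3H_{p-1}(4,1,1) \mod p^4,$$ $$C_{3,3,p}\equiv -2p^2H_{p-1}(2,1)+2p^4H_{p-1}(4,1) \mod p^6,$$ $$C_{3,4,p}\equiv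 -\tfrac{24}{5}p^3H_{p-1}(4,1)+\tfrac{28}{15}p^4H_{p-1}(4,1,1) \mod p^5.$$ -/

import Mathlib

/-- The multiple harmonic sum
`H_N(s₁, …, s_k) = ∑_{N ≥ n₁ > ⋯ > n_k ≥ 1} 1 / (n₁ ^ s₁ ⋯ n_k ^ s_k)`, a rational number. -/
def multipleHarmonicSum (N : ℕ) (s : List ℕ) : ℚ :=
  ∑ n ∈ (Fintype.piFinset fun _ : Fin s.length => Finset.Icc 1 N).filter
      (fun n => ∀ i j : Fin s.length, i < j → n j < n i),
    1 / ∏ i : Fin s.length, (n i : ℚ) ^ s.get i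

/-- The curious sum `C_{r,k,p} = ∑ 1 / (n₁ ⋯ n_k)` over all `k`-tuples of positive integers
with `n₁ + ⋯ + n_k = p ^ r` and `p ∤ n₁ ⋯ n_k`. (Each `n i` is then at most `p ^ r`.) -/
def curiousSum (r k p : ℕ) : ℚ :=
  ∑ n ∈ (Fintype.piFinset fun _ : Fin k => Finset.Icc 1 (p ^ r)).filter
      (fun n => ∑ i, n i = p ^ r ∧ ¬ p ∣ ∏ i, n i),
    1 / ∏ i, (n i : ℚ)

/-- `x ≡ y mod m` for rational numbers `x`, `y`: the numerator (in lowest terms) of `x - y` is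
divisible by `m`. -/
def RatModEq (m : ℕ) (x y : ℚ) : Prop :=
  (m : ℤ) ∣ (x - y).num

/-- The supercongruence `a_p ≡ b_p mod p ^ n` between prime-indexed families of rational numbers:
it holds for all but finitely many primes `p`. -/
def Supercongruence (n : ℕ) (a b : ℕ → ℚ) : Prop :=
  {p : ℕ | p.Prime ∧ ¬ RatModEq (p ^ n) (a p) (b p)}.Finite

section

open Finset

/-! ### Congruences -/

/-! Fix a prime p > 100 and work in the p-adic integers, with 1/n read as 0 when p divides n. Put L
= ∑_{p∤n} X^n/n, so that C_{r,k,p} is the coefficient of X^{p^r} in L^k (`cast_curiousSum`). Since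
X·L' has coefficients 0 and 1, m times the coefficient of X^m in L^{j+1} is j+1 times the sum of the
coefficients of L^j at those l < m with p ∤ m−l. Two such steps turn qC, with q = p^r = pM, into
nested harmonic sums whose indices satisfy incongruences modulo p, which inclusion–exclusion
removes.

For k = 3 this gives qC = 3(A² − ∑A_i²), where A is the sum of 1/n for n < q and A_i its part in the
residue class of i. Reflection n ↦ q−n shows q² ∣ A. Expanding 1/(pu+i) in powers of p brings in
power sums ∑_{u<M} u^s, each divisible by M, so M² leaves ∑A_i² and only the sums H(s) = H_{p−1}(s)
remain (`pow_dvd_coeff_unitLog_cube`).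

For k = 4 there are three contributions. The unrestricted triples, together with those lying in one
residue class, are polynomials in power sums by Newton's identity (`quartic_symmetric_part`). The
triples with exactly one imposed congruence between neighbours form two families exchanged by
reflection; they cancel to leading order, which gains a factor q (`pow_three_dvd_pairSum_reflect`).
The triples whose middle index is divisible by p are governed by the coefficients of L² at multiples
of p (`quartic_divisible_part`).

What remains is a set of linear congruences among multiple harmonic sums, proved by explicit
combinations of reflection, stuffle products, shuffle products (partial fractions compared with
reflection), and one relation modulo p obtained by differentiating an interpolation polynomial
(`prime_dvd_mhsTwo_add_mhsTwo`). The bound p > 100 keeps every weight below p−1 and makes 2, 3, 5, 7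
units. -/

theorem dvd_mul_sub_mul_of_dvd {R : Type*} [CommRing R] {m a b c d : R}
    (h₁ : m ∣ a - b) (h₂ : m ∣ c - d) : m ∣ a * c - b * d := by
  have : a * c - b * d = (a - b) * c + b * (c - d) := by ring
  rw [this]
  exact dvd_add (h₁.mul_right _) (h₂.mul_left _)

theorem dvd_sum_sub_sum {R ι : Type*} [CommRing R] {m : R} {s : Finset ι} {f g : ι → R}
    (h : ∀ i ∈ s, m ∣ f i - g i) : m ∣ ∑ i ∈ s, f i - ∑ i ∈ s, g i := by
  rw [← sum_sub_distrib]
  exact dvd_sum h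

theorem dvd_sub_trans {R : Type*} [CommRing R] {m a b c : R}
    (h₁ : m ∣ a - b) (h₂ : m ∣ b - c) : m ∣ a - c := by
  simpa using dvd_add h₁ h₂

/-! ### The binomial series, truncated -/

/-- The truncation `∑_{j < J} (a - 1 + j choose j) (-y) ^ j` of the series of `(1 + y) ^ (-a)`. -/
def truncInvPow {R : Type*} [CommRing R] (a J : ℕ) (y : R) : R :=
  ∑ j ∈ range J, ((a - 1 + j).choose j : R) * (-y) ^ j

/-- By Pascal's rule all coefficients below degree J cancel, leaving at most one monomial. -/
theorem pow_dvd_truncInvPow_succ_mul_sub {R : Type*} [CommRing R] (b J : ℕ) (y : R) :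
    y ^ J ∣ truncInvPow (b + 2) J y * (1 + y) - truncInvPow (b + 1) J y := by
  have key : ∀ J, truncInvPow (b + 2) (J + 1) y * (1 + y) - truncInvPow (b + 1) (J + 1) y
      = ((b + 1 + J).choose J : R) * (-y) ^ J * y := by
    intro J
    induction J with
    | zero => simp [truncInvPow]
    | succ J ih =>
      simp only [truncInvPow] at ih ⊢
      rw [sum_range_succ, sum_range_succ _ (J + 1)]
      have e1 : b + 2 - 1 + (J + 1) = (b + 1 + J) + 1 := by omega
      have e2 : b + 1 - 1 + (J + 1) = b + 1 + J := by omega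
      have e3 : b + 1 + (J + 1) = (b + 1 + J) + 1 := by omega
      rw [e1, e2, e3]
      have hc : (((b + 1 + J) + 1).choose (J + 1) : R)
          = ((b + 1 + J).choose J : R) + ((b + 1 + J).choose (J + 1) : R) := by
        rw [Nat.choose_succ_succ]; push_cast; ring
      rw [hc]
      linear_combination ih
  cases J with
  | zero => simp
  | succ J =>
    rw [key]
    refine ⟨((b + 1 + J).choose J : R) * (-1) ^ J, ?_⟩
    rw [neg_pow]; ring

theorem pow_dvd_pow_mul_truncInvPow_sub_one {R : Type*} [CommRing R] (a J : ℕ) (y : R) :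
    y ^ J ∣ (1 + y) ^ (a + 1) * truncInvPow (a + 1) J y - 1 := by
  induction a with
  | zero =>
    have : (1 + y) ^ (0 + 1) * truncInvPow (0 + 1) J y - 1 = -(-y) ^ J := by
      have := mul_neg_geom_sum (-y) J
      simp only [truncInvPow]
      simp
      linear_combination this
    rw [this, neg_pow]
    exact (Dvd.intro_left _ rfl).neg_right
  | succ a ih =>
    have h := (pow_dvd_truncInvPow_succ_mul_sub a J y).mul_left ((1 + y) ^ (a + 1))
    have h2 := dvd_add h ih
    have e : (1 + y) ^ (a + 1 + 1) * truncInvPow (a + 1 + 1) J y - 1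
        = (1 + y) ^ (a + 1) * (truncInvPow (a + 2) J y * (1 + y) - truncInvPow (a + 1) J y)
          + ((1 + y) ^ (a + 1) * truncInvPow (a + 1) J y - 1) := by ring
    rwa [e]

/-- If `t` inverts `n` and `s` inverts `n + z`, then `s ^ a` is the binomial series in `z`. -/
theorem pow_dvd_pow_sub_truncation {R : Type*} [CommRing R] {n t z s : R} (ht : n * t = 1)
    (hs : (n + z) * s = 1) {a : ℕ} (ha : 0 < a) (J : ℕ) :
    z ^ J ∣ s ^ a - ∑ j ∈ range J, ((a - 1 + j).choose j : R) * (-z) ^ j * t ^ (a + j) := by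
  obtain ⟨b, rfl⟩ : ∃ b, a = b + 1 := ⟨a - 1, by omega⟩
  -- Thus s = t/(1+zt), and s^a is t^a times the binomial series in zt.
  have h1 : s * (1 + z * t) = t := by linear_combination t * hs - s * ht
  have h2 : s ^ (b + 1) * (1 + z * t) ^ (b + 1) = t ^ (b + 1) := by rw [← mul_pow, h1]
  have h3 : ∑ j ∈ range J, ((b + 1 - 1 + j).choose j : R) * (-z) ^ j * t ^ (b + 1 + j)
      = t ^ (b + 1) * truncInvPow (b + 1) J (z * t) := by
    rw [truncInvPow, mul_sum]
    refine sum_congr rfl fun j _ => ?_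
    rw [neg_pow, neg_pow (z * t), mul_pow]; ring
  rw [h3, ← h2]
  have h4 := pow_dvd_pow_mul_truncInvPow_sub_one b J (z * t)
  have h5 : z ^ J ∣ (1 + z * t) ^ (b + 1) * truncInvPow (b + 1) J (z * t) - 1 :=
    (Dvd.intro _ (mul_pow z t J).symm).trans h4
  have : s ^ (b + 1) - s ^ (b + 1) * (1 + z * t) ^ (b + 1) * truncInvPow (b + 1) J (z * t)
    = -(s ^ (b + 1) * ((1 + z * t) ^ (b + 1) * truncInvPow (b + 1) J (z * t) - 1)) := by ring
  rw [this]
  exact (h5.mul_left _).neg_right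

/-! ### Inverses of integers in the `p`-adic integers -/

section

variable (p : ℕ) [Fact p.Prime]

/-- The inverse of `n` in `ℤ_[p]` if `p ∤ n`, and `0` if `p ∣ n`. -/
noncomputable def unitInv (n : ℕ) : ℤ_[p] := Ring.inverse (n : ℤ_[p])

variable {p}

theorem PadicInt.isUnit_natCast_of_not_dvd {n : ℕ} (h : ¬ p ∣ n) : IsUnit (n : ℤ_[p]) := by
  rw [PadicInt.isUnit_iff]
  by_contra hne
  have hlt : ‖((n : ℤ) : ℤ_[p])‖ < 1 := lt_of_le_of_ne (PadicInt.norm_le_one _) (by simpa using hne)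
  rw [PadicInt.norm_int_lt_one_iff_dvd] at hlt
  exact h (by exact_mod_cast hlt)

theorem mul_unitInv {n : ℕ} (h : ¬ p ∣ n) : (n : ℤ_[p]) * unitInv p n = 1 :=
  Ring.mul_inverse_cancel _ (PadicInt.isUnit_natCast_of_not_dvd h)

theorem unitInv_of_dvd {n : ℕ} (h : p ∣ n) : unitInv p n = 0 := by
  refine Ring.inverse_non_unit _ fun hu => ?_
  rw [PadicInt.isUnit_iff] at hu
  have : ‖((n : ℤ) : ℤ_[p])‖ < 1 := by
    rw [PadicInt.norm_int_lt_one_iff_dvd]; exact_mod_cast h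
  simp only [Int.cast_natCast] at this
  exact absurd hu this.ne

@[simp] theorem unitInv_zero : unitInv p 0 = 0 := unitInv_of_dvd (dvd_zero p)

theorem natCast_dvd_natCast_padicInt {a b : ℕ} (h : a ∣ b) : (a : ℤ_[p]) ∣ (b : ℤ_[p]) := by
  exact_mod_cast (Nat.cast_dvd_cast (α := ℤ_[p]) h)

/-- The binomial expansion of `1 / (z + n) ^ a` for `p ∣ z`. -/
theorem pow_dvd_unitInv_add_pow_sub {z : ℕ} (hz : p ∣ z) (n : ℕ) {a : ℕ} (ha : 0 < a) (J : ℕ) :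
    (z : ℤ_[p]) ^ J ∣ unitInv p (z + n) ^ a
      - ∑ j ∈ range J, ((a - 1 + j).choose j : ℤ_[p]) * (-(z : ℤ_[p])) ^ j * unitInv p n ^ (a + j) := by
  -- When p ∣ n both sides are 0: a > 0 makes every exponent a+j positive.
  by_cases hn : p ∣ n
  · rw [unitInv_of_dvd hn, unitInv_of_dvd (dvd_add hz hn), zero_pow ha.ne', sum_eq_zero, sub_zero]
    · exact dvd_zero _
    · intro j _
      rw [zero_pow (by omega), mul_zero]
  · have hzn : ¬ p ∣ z + n := fun h => hn ((Nat.dvd_add_right hz).1 h)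
    have h := mul_unitInv hzn
    push_cast at h
    exact pow_dvd_pow_sub_truncation (mul_unitInv hn) (by rw [add_comm]; exact h) ha J

/-- The binomial expansion of `1 / (z - n) ^ a` for `p ∣ z`. -/
theorem pow_dvd_unitInv_sub_pow_sub {z : ℕ} (hz : p ∣ z) {n : ℕ} (hnz : n ≤ z) {a : ℕ} (ha : 0 < a)
    (J : ℕ) :
    (z : ℤ_[p]) ^ J ∣ unitInv p (z - n) ^ a
      - (-1) ^ a * ∑ j ∈ range J,
        ((a - 1 + j).choose j : ℤ_[p]) * (z : ℤ_[p]) ^ j * unitInv p n ^ (a + j) := by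
  by_cases hn : p ∣ n
  · rw [unitInv_of_dvd hn, unitInv_of_dvd (Nat.dvd_sub hz hn), zero_pow ha.ne', sum_eq_zero]
    · simp
    · intro j _
      rw [zero_pow (by omega), mul_zero]
  · have hzn : ¬ p ∣ z - n := fun h => hn ((Nat.dvd_sub_iff_right hnz hz).1 h)
    have h := mul_unitInv hzn
    rw [Nat.cast_sub hnz] at h
    -- The inverse of n + (−z) is −1/(z−n), which accounts for the sign (−1)^a.
    have h2 := pow_dvd_pow_sub_truncation (z := -(z : ℤ_[p])) (s := -unitInv p (z - n))
      (mul_unitInv hn) (by linear_combination h) ha J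
    rw [neg_pow (z : ℤ_[p]) J, neg_pow (unitInv p (z - n)) a] at h2
    simp only [neg_neg] at h2
    have h3 := ((Dvd.intro_left _ rfl).trans h2).mul_left ((-1) ^ a)
    rw [mul_sub, ← mul_assoc, ← mul_pow] at h3
    simpa using h3

end

/-! ### Harmonic sums in the `p`-adic integers -/

/-- `∑_{1 ≤ n < p} 1 / n ^ a`. -/
noncomputable def mhsOne (p : ℕ) [Fact p.Prime] (a : ℕ) : ℤ_[p] :=
  ∑ n ∈ Ico 1 p, unitInv p n ^ a

/-- `∑_{p > n > m ≥ 1} 1 / (n ^ a m ^ b)`. -/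
noncomputable def mhsTwo (p : ℕ) [Fact p.Prime] (a b : ℕ) : ℤ_[p] :=
  ∑ n ∈ Ico 1 p, ∑ m ∈ Ico 1 n, unitInv p n ^ a * unitInv p m ^ b

/-- `∑_{p > n > m > l ≥ 1} 1 / (n ^ a m ^ b l ^ c)`. -/
noncomputable def mhsThree (p : ℕ) [Fact p.Prime] (a b c : ℕ) : ℤ_[p] :=
  ∑ n ∈ Ico 1 p, ∑ m ∈ Ico 1 n, unitInv p n ^ a * (unitInv p m ^ b * ∑ l ∈ Ico 1 m, unitInv p l ^ c)

/-! ### Rearrangements of finite sums -/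

theorem sum_Ico_one_sub {A : Type*} [AddCommMonoid A] (N : ℕ) (f : ℕ → A) :
    ∑ m ∈ Ico 1 N, f (N - m) = ∑ m ∈ Ico 1 N, f m := by
  refine sum_nbij' (fun m => N - m) (fun m => N - m) ?_ ?_ ?_ ?_ fun _ _ => rfl
  all_goals
    intro m hm
    simp only [mem_Ico] at hm ⊢
    omega

/-- With N = n + m, the substitution M = p − m turns the region n + m < p into n < M < p. -/
theorem sum_triangle_reflect {A : Type*} [AddCommMonoid A] (p : ℕ) (F : ℕ → ℕ → A) :
    ∑ N ∈ Ico 1 p, ∑ m ∈ Ico 1 N, F N m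
      = ∑ M ∈ Ico 1 p, ∑ n ∈ Ico 1 M, F (p - M + n) (p - M) := by
  rw [sum_sigma', sum_sigma']
  refine sum_nbij' (fun x => ⟨p - x.2, x.1 - x.2⟩) (fun x => ⟨p - x.1 + x.2, p - x.1⟩) ?_ ?_ ?_ ?_ ?_
  · rintro ⟨N, m⟩ h; simp only [mem_sigma, mem_Ico] at h ⊢; omega
  · rintro ⟨N, m⟩ h; simp only [mem_sigma, mem_Ico] at h ⊢; omega
  · rintro ⟨N, m⟩ h; simp only [mem_sigma, mem_Ico, Sigma.mk.injEq, heq_eq_eq] at h ⊢; omega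
  · rintro ⟨N, m⟩ h; simp only [mem_sigma, mem_Ico, Sigma.mk.injEq, heq_eq_eq] at h ⊢; omega
  · rintro ⟨N, m⟩ h
    simp only [mem_sigma, mem_Ico] at h ⊢
    congr 1 <;> omega

theorem sum_triangle_shift {A : Type*} [AddCommMonoid A] (N : ℕ) (F : ℕ → ℕ → A) :
    ∑ m ∈ Ico 1 N, ∑ l ∈ Ico 1 (N - m), F m l = ∑ D ∈ Ico 1 N, ∑ l ∈ Ico 1 D, F (D - l) l := by
  rw [sum_sigma', sum_sigma']
  refine sum_nbij' (fun x => ⟨x.1 + x.2, x.2⟩) (fun x => ⟨x.1 - x.2, x.2⟩) ?_ ?_ ?_ ?_ ?_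
  · rintro ⟨a, b⟩ h; simp only [mem_sigma, mem_Ico] at h ⊢; omega
  · rintro ⟨a, b⟩ h; simp only [mem_sigma, mem_Ico] at h ⊢; omega
  · rintro ⟨a, b⟩ h
    simp only [mem_sigma, mem_Ico, Sigma.mk.injEq, heq_eq_eq, and_true] at h ⊢
    omega
  · rintro ⟨a, b⟩ h
    simp only [mem_sigma, mem_Ico, Sigma.mk.injEq, heq_eq_eq, and_true] at h ⊢
    omega
  · rintro ⟨a, b⟩ h
    simp only [mem_sigma, mem_Ico] at h ⊢
    rw [Nat.add_sub_cancel]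

/-- The stuffle product: pairs of indices are split according to n > m, n < m, n = m. -/
theorem sum_mul_sum_Ico {R : Type*} [CommRing R] (p : ℕ) (f g : ℕ → R) :
    (∑ n ∈ Ico 1 p, f n) * ∑ n ∈ Ico 1 p, g n
      = ∑ n ∈ Ico 1 p, f n * ∑ m ∈ Ico 1 n, g m + ∑ n ∈ Ico 1 p, g n * ∑ m ∈ Ico 1 n, f m
        + ∑ n ∈ Ico 1 p, f n * g n := by
  induction p with
  | zero => simp
  | succ p ih =>
    rcases Nat.eq_zero_or_pos p with rfl | hp
    · simp
    · simp only [sum_Ico_succ_top hp]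
      linear_combination ih

section

variable (p : ℕ) [Fact p.Prime]

theorem not_dvd_of_mem_Ico {p n : ℕ} (h : n ∈ Ico 1 p) : ¬ p ∣ n := by
  rw [mem_Ico] at h
  exact Nat.not_dvd_of_pos_of_lt h.1 h.2

/-- Partial fractions, the source of all shuffle relations. -/
theorem unitInv_mul_unitInv {p : ℕ} [Fact p.Prime] {m n : ℕ} (hm : ¬ p ∣ m) (hn : ¬ p ∣ n)
    (hmn : ¬ p ∣ m + n) :
    unitInv p m * unitInv p n = unitInv p (m + n) * (unitInv p m + unitInv p n) := by
  have h1 := mul_unitInv hm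
  have h2 := mul_unitInv hn
  have h3 := mul_unitInv hmn
  push_cast at h3
  linear_combination (-unitInv p m * unitInv p n) * h3 + (unitInv p (m + n) * unitInv p n) * h1
    + (unitInv p (m + n) * unitInv p m) * h2

/-! ### Reflection and stuffle relations -/

/-- Pair n with q−n and expand 1/(q−n)^a in powers of q. A general multiple q of p is allowed
because both q = p and q = p^r are needed. -/
theorem sum_unitInv_pow_reflect {q : ℕ} (hq : p ∣ q) {a : ℕ} (ha : 0 < a) (J : ℕ) :
    (q : ℤ_[p]) ^ J ∣ ∑ n ∈ Ico 1 q, unitInv p n ^ a - (-1) ^ a * ∑ j ∈ range J,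
      ((a - 1 + j).choose j : ℤ_[p]) * (q : ℤ_[p]) ^ j * ∑ n ∈ Ico 1 q, unitInv p n ^ (a + j) := by
  have h : ∑ n ∈ Ico 1 q, unitInv p n ^ a = ∑ n ∈ Ico 1 q, unitInv p (q - n) ^ a :=
    (sum_Ico_one_sub q fun n => unitInv p n ^ a).symm
  have h2 : (-1) ^ a * ∑ j ∈ range J,
      ((a - 1 + j).choose j : ℤ_[p]) * (q : ℤ_[p]) ^ j * ∑ n ∈ Ico 1 q, unitInv p n ^ (a + j)
      = ∑ n ∈ Ico 1 q, (-1) ^ a * ∑ j ∈ range J,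
        ((a - 1 + j).choose j : ℤ_[p]) * (q : ℤ_[p]) ^ j * unitInv p n ^ (a + j) := by
    rw [← mul_sum, sum_comm]
    simp only [mul_sum]
  rw [h2, h]
  exact dvd_sum_sub_sum fun n hn => pow_dvd_unitInv_sub_pow_sub hq (mem_Ico.1 hn).2.le ha J

theorem mhsOne_reflect {a : ℕ} (ha : 0 < a) (J : ℕ) :
    (p : ℤ_[p]) ^ J ∣ mhsOne p a - (-1) ^ a *
      ∑ j ∈ range J, ((a - 1 + j).choose j : ℤ_[p]) * (p : ℤ_[p]) ^ j * mhsOne p (a + j) :=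
  sum_unitInv_pow_reflect p dvd_rfl ha J

theorem mhsOne_mul_mhsOne (a b : ℕ) :
    mhsOne p a * mhsOne p b = mhsTwo p a b + mhsTwo p b a + mhsOne p (a + b) := by
  simp only [mhsOne, mhsTwo]
  rw [sum_mul_sum_Ico]
  simp only [mul_sum, pow_add]

theorem mhsOne_mul_mhsTwo (a b c : ℕ) :
    mhsOne p a * mhsTwo p b c = mhsThree p a b c + mhsThree p b a c + mhsThree p b c a
      + mhsTwo p (a + b) c + mhsTwo p b (a + c) := by
  have h : mhsTwo p b c = ∑ n ∈ Ico 1 p, unitInv p n ^ b * ∑ m ∈ Ico 1 n, unitInv p m ^ c := by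
    simp only [mhsTwo, mul_sum]
  rw [h, mhsOne, sum_mul_sum_Ico]
  simp only [mul_assoc, mul_comm (∑ m ∈ Ico 1 _, unitInv p m ^ c)]
  simp only [sum_mul_sum_Ico]
  simp only [mhsTwo, mhsThree, mul_add, sum_add_distrib, mul_sum, pow_add]
  simp only [mul_assoc]
  ring

/-! ### Shuffle relations -/

/-- `∑ 1 / (N ^ c n ^ a m ^ b)` over `n, m ≥ 1` with `N = n + m < p`. -/
noncomputable def shuffleTwo (c a b : ℕ) : ℤ_[p] :=
  ∑ N ∈ Ico 1 p, ∑ m ∈ Ico 1 N, unitInv p N ^ c * (unitInv p (N - m) ^ a * unitInv p m ^ b)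

theorem pow_mul_pow_unitInv {p : ℕ} [Fact p.Prime] {N m : ℕ} (hN : N ∈ Ico 1 p) (hm : m ∈ Ico 1 N)
    (c a b : ℕ) :
    unitInv p N ^ c * (unitInv p (N - m) ^ (a + 1) * unitInv p m ^ (b + 1))
      = unitInv p N ^ (c + 1) * (unitInv p (N - m) ^ a * unitInv p m ^ (b + 1))
        + unitInv p N ^ (c + 1) * (unitInv p (N - m) ^ (a + 1) * unitInv p m ^ b) := by
  have e : N - m + m = N := Nat.sub_add_cancel (mem_Ico.1 hm).2.le
  have h := unitInv_mul_unitInv (p := p) (m := N - m) (n := m)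
    (not_dvd_of_mem_Ico (by simp only [mem_Ico] at *; omega))
    (not_dvd_of_mem_Ico (by simp only [mem_Ico] at *; omega))
    (by rw [e]; exact not_dvd_of_mem_Ico hN)
  rw [e] at h
  linear_combination unitInv p N ^ c * unitInv p (N - m) ^ a * unitInv p m ^ b * h

theorem shuffleTwo_succ_succ (c a b : ℕ) :
    shuffleTwo p c (a + 1) (b + 1)
      = shuffleTwo p (c + 1) a (b + 1) + shuffleTwo p (c + 1) (a + 1) b := by
  simp only [shuffleTwo, ← sum_add_distrib]
  exact sum_congr rfl fun N hN => sum_congr rfl fun m hm => pow_mul_pow_unitInv hN hm c a b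

theorem shuffleTwo_zero_left (c b : ℕ) : shuffleTwo p c 0 b = mhsTwo p c b := by
  simp [shuffleTwo, mhsTwo]

theorem shuffleTwo_zero_right (c a : ℕ) : shuffleTwo p c a 0 = mhsTwo p c a := by
  simp only [shuffleTwo, mhsTwo, pow_zero, mul_one]
  exact sum_congr rfl fun N _ => sum_Ico_one_sub N fun m => unitInv p N ^ c * unitInv p m ^ a

theorem sum_reflect_mul (g : ℕ → ℤ_[p]) {b : ℕ} (hb : 0 < b) (J : ℕ) :
    (p : ℤ_[p]) ^ J ∣ ∑ M ∈ Ico 1 p, ∑ n ∈ Ico 1 M, unitInv p (p - M) ^ b * g n - (-1) ^ b *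
      ∑ j ∈ range J, ((b - 1 + j).choose j : ℤ_[p]) * (p : ℤ_[p]) ^ j *
        ∑ M ∈ Ico 1 p, ∑ n ∈ Ico 1 M, unitInv p M ^ (b + j) * g n := by
  have h2 : (-1) ^ b * ∑ j ∈ range J, ((b - 1 + j).choose j : ℤ_[p]) * (p : ℤ_[p]) ^ j *
        ∑ M ∈ Ico 1 p, ∑ n ∈ Ico 1 M, unitInv p M ^ (b + j) * g n
      = ∑ M ∈ Ico 1 p, ((-1) ^ b * ∑ j ∈ range J,
        ((b - 1 + j).choose j : ℤ_[p]) * (p : ℤ_[p]) ^ j * unitInv p M ^ (b + j))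
        * ∑ n ∈ Ico 1 M, g n := by
    simp only [← mul_sum]
    simp only [mul_sum (Ico 1 p), sum_mul, mul_assoc]
    rw [← mul_sum, sum_comm]
  rw [h2]
  simp only [← mul_sum]
  refine dvd_sum_sub_sum fun M hM => ?_
  rw [← sub_mul]
  exact (pow_dvd_unitInv_sub_pow_sub dvd_rfl (mem_Ico.1 hM).2.le hb J).mul_right _

/-- Partial fractions reduce the same `shuffleTwo p 0 a b` exactly to double sums; comparing the two
evaluations gives a shuffle relation modulo p^J. -/
theorem shuffleTwo_reflect (a : ℕ) {b : ℕ} (hb : 0 < b) (J : ℕ) :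
    (p : ℤ_[p]) ^ J ∣ shuffleTwo p 0 a b - (-1) ^ b *
      ∑ j ∈ range J, ((b - 1 + j).choose j : ℤ_[p]) * (p : ℤ_[p]) ^ j * mhsTwo p (b + j) a := by
  have h := sum_reflect_mul p (fun n => unitInv p n ^ a) hb J
  rw [shuffleTwo, sum_triangle_reflect]
  simp only [Nat.add_sub_cancel_left, pow_zero, one_mul,
    mul_comm (unitInv p _ ^ a)]
  exact h

/-- `∑ 1 / (N ^ c n ^ a m ^ b l ^ e)` over `n > l ≥ 1`, `m ≥ 1` with `N = n + m < p`. -/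
noncomputable def shuffleThree (c a b e : ℕ) : ℤ_[p] :=
  ∑ N ∈ Ico 1 p, ∑ m ∈ Ico 1 N,
    unitInv p N ^ c * (unitInv p (N - m) ^ a * unitInv p m ^ b) * ∑ l ∈ Ico 1 (N - m), unitInv p l ^ e

/-- `∑ 1 / (N ^ c D ^ d m ^ b l ^ e)` over `m, l ≥ 1` with `D = m + l < N < p`. -/
noncomputable def shuffleInner (c d b e : ℕ) : ℤ_[p] :=
  ∑ N ∈ Ico 1 p, unitInv p N ^ c *
    ∑ D ∈ Ico 1 N, ∑ l ∈ Ico 1 D, unitInv p D ^ d * (unitInv p (D - l) ^ b * unitInv p l ^ e)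

theorem shuffleThree_succ_succ (c a b e : ℕ) :
    shuffleThree p c (a + 1) (b + 1) e
      = shuffleThree p (c + 1) a (b + 1) e + shuffleThree p (c + 1) (a + 1) b e := by
  simp only [shuffleThree, ← sum_add_distrib]
  refine sum_congr rfl fun N hN => sum_congr rfl fun m hm => ?_
  rw [pow_mul_pow_unitInv hN hm c a b, add_mul]

theorem shuffleThree_zero_right (c a e : ℕ) : shuffleThree p c a 0 e = mhsThree p c a e := by
  simp only [shuffleThree, mhsThree, pow_zero, mul_one]
  refine sum_congr rfl fun N _ => ?_
  rw [sum_Ico_one_sub N fun m => unitInv p N ^ c * unitInv p m ^ a * ∑ l ∈ Ico 1 m, unitInv p l ^ e]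
  simp only [mul_assoc]

/-- Once n = N−m carries no weight, l < n only says m + l < N, so (m, l) is again a shuffle pair
with total D = m + l. -/
theorem shuffleThree_zero_left (c b e : ℕ) : shuffleThree p c 0 b e = shuffleInner p c 0 b e := by
  simp only [shuffleThree, shuffleInner, pow_zero, one_mul]
  refine sum_congr rfl fun N _ => ?_
  simp only [mul_assoc]
  rw [← mul_sum]
  congr 1
  simp only [mul_sum]
  exact sum_triangle_shift N fun m l => unitInv p m ^ b * unitInv p l ^ e

theorem shuffleInner_succ_succ (c d b e : ℕ) :
    shuffleInner p c d (b + 1) (e + 1)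
      = shuffleInner p c (d + 1) b (e + 1) + shuffleInner p c (d + 1) (b + 1) e := by
  simp only [shuffleInner, ← sum_add_distrib, ← mul_add]
  refine sum_congr rfl fun N hN => ?_
  congr 1
  refine sum_congr rfl fun D hD => sum_congr rfl fun l hl => ?_
  have hD' : D ∈ Ico 1 p := by simp only [mem_Ico] at *; omega
  rw [mul_add]
  exact pow_mul_pow_unitInv hD' hl d b e

theorem shuffleInner_zero_left (c d e : ℕ) : shuffleInner p c d 0 e = mhsThree p c d e := by
  simp only [shuffleInner, mhsThree, pow_zero, one_mul, mul_sum]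

theorem shuffleInner_zero_right (c d b : ℕ) : shuffleInner p c d b 0 = mhsThree p c d b := by
  simp only [shuffleInner, mhsThree, pow_zero, mul_one]
  simp only [← mul_sum]
  refine sum_congr rfl fun N _ => ?_
  congr 1
  exact sum_congr rfl fun D _ => by rw [sum_Ico_one_sub D fun l => unitInv p l ^ b]

theorem shuffleThree_reflect (a e : ℕ) {b : ℕ} (hb : 0 < b) (J : ℕ) :
    (p : ℤ_[p]) ^ J ∣ shuffleThree p 0 a b e - (-1) ^ b *
      ∑ j ∈ range J, ((b - 1 + j).choose j : ℤ_[p]) * (p : ℤ_[p]) ^ j * mhsThree p (b + j) a e := by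
  have h := sum_reflect_mul p (fun n => unitInv p n ^ a * ∑ l ∈ Ico 1 n, unitInv p l ^ e) hb J
  rw [shuffleThree, sum_triangle_reflect]
  simp only [Nat.add_sub_cancel_left, pow_zero, one_mul,
    mul_comm (unitInv p _ ^ a) (unitInv p _ ^ b), mul_assoc] at h ⊢
  exact h

end

section

variable {p : ℕ} [Fact p.Prime]

/-! ### Reduction modulo `p` -/

theorem sum_Ico_eq_sum_zmod {A : Type*} [AddCommMonoid A] (f : ZMod p → A) (h0 : f 0 = 0) :
    ∑ n ∈ Ico 1 p, f n = ∑ x : ZMod p, f x := by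
  have hp := (Fact.out : p.Prime).pos
  have h : ∑ x : ZMod p, f x = ∑ n ∈ range p, f n := by
    symm
    refine sum_nbij' (fun n => (n : ZMod p)) ZMod.val (fun _ _ => mem_univ _)
      (fun x _ => mem_range.2 (ZMod.val_lt x)) (fun n hn => ZMod.val_cast_of_lt (mem_range.1 hn))
      (fun x _ => ZMod.natCast_zmod_val x) fun _ _ => rfl
  rw [h, range_eq_Ico, sum_eq_sum_Ico_succ_bot hp]
  simp [h0]

theorem toZMod_unitInv (n : ℕ) : PadicInt.toZMod (unitInv p n) = (n : ZMod p)⁻¹ := by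
  by_cases h : p ∣ n
  · rw [unitInv_of_dvd h, (ZMod.natCast_eq_zero_iff n p).2 h, map_zero, inv_zero]
  · refine eq_inv_of_mul_eq_one_right ?_
    rw [← map_natCast (PadicInt.toZMod (p := p)), ← map_mul, mul_unitInv h, map_one]

theorem prime_dvd_iff_toZMod_eq_zero (x : ℤ_[p]) : (p : ℤ_[p]) ∣ x ↔ PadicInt.toZMod x = 0 := by
  rw [← RingHom.mem_ker, PadicInt.ker_toZMod, PadicInt.maximalIdeal_eq_span_p,
    Ideal.mem_span_singleton]

/-- Fermat's theorem; the strict bound a < p−1 keeps the right exponent positive, so x = 0 is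
covered too. -/
theorem zmod_inv_pow {x : ZMod p} {a : ℕ} (ha : 0 < a) (hap : a < p - 1) :
    x⁻¹ ^ a = x ^ (p - 1 - a) := by
  rcases eq_or_ne x 0 with rfl | hx
  · rw [inv_zero, zero_pow ha.ne', zero_pow (by omega)]
  · have h := ZMod.pow_card_sub_one_eq_one hx
    rw [inv_pow]
    refine inv_eq_of_mul_eq_one_right ?_
    rw [← pow_add, Nat.add_sub_cancel' hap.le, h]

theorem zmod_sum_pow {e : ℕ} (he : 0 < e) :
    ∑ x : ZMod p, x ^ e = if p - 1 ∣ e then -1 else 0 := by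
  have h := FiniteField.sum_pow_units (ZMod p) e
  rw [ZMod.card] at h
  rw [← h, ← Fintype.sum_subset (s := univ.filter fun x : ZMod p => x ≠ 0)]
  · refine sum_bij' (fun x hx => Units.mk0 x (mem_filter.1 hx).2) (fun x _ => (x : ZMod p)) ?_ ?_ ?_ ?_ ?_
    · simp
    · simp
    · simp
    · simp
    · simp
  · intro x hx
    simp only [mem_filter, mem_univ, true_and]
    rintro rfl
    exact hx (zero_pow he.ne')

theorem prime_dvd_mhsOne {a : ℕ} (ha : 0 < a) (hap : a < p - 1) : (p : ℤ_[p]) ∣ mhsOne p a := by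
  rw [prime_dvd_iff_toZMod_eq_zero, mhsOne, map_sum]
  simp only [map_pow, toZMod_unitInv]
  rw [sum_Ico_eq_sum_zmod (fun x => x⁻¹ ^ a) (by rw [inv_zero, zero_pow ha.ne'])]
  simp only [zmod_inv_pow ha hap]
  rw [zmod_sum_pow (by omega), if_neg]
  intro h
  have := Nat.le_of_dvd (by omega) h
  omega

/-! ### A relation between double sums modulo `p` -/

-- Summation against x^{−s} extracts a coefficient: the exponents p−1−s+k lie strictly between 0 and
-- 2(p−1), so the power sum is nonzero only for k = s.
open Polynomial in
theorem zmod_sum_pow_mul_eval {Q : (ZMod p)[X]} (hQ : Q.natDegree ≤ p - 1) {s : ℕ} (hs : 0 < s)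
    (hsp : s < p - 1) : ∑ x : ZMod p, x ^ (p - 1 - s) * Q.eval x = -Q.coeff s := by
  simp only [eval_eq_sum_range' (Nat.lt_succ_of_le hQ), mul_sum]
  rw [sum_comm]
  have h : ∀ k ∈ range (p - 1).succ, ∑ x : ZMod p, x ^ (p - 1 - s) * (Q.coeff k * x ^ k)
      = if k = s then -Q.coeff s else 0 := by
    intro k hk
    rw [mem_range] at hk
    have : ∀ x : ZMod p, x ^ (p - 1 - s) * (Q.coeff k * x ^ k) = Q.coeff k * x ^ (p - 1 - s + k) := by
      intro x; rw [pow_add]; ring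
    simp only [this, ← mul_sum]
    rw [zmod_sum_pow (by omega)]
    by_cases hks : k = s
    · subst hks
      rw [if_pos ⟨1, by omega⟩, if_pos rfl]; ring
    · rw [if_neg hks, if_neg, mul_zero]
      rintro ⟨c, hc⟩
      have h1 : c < 2 := by
        by_contra hc2
        have : (p - 1) * 2 ≤ (p - 1) * c := Nat.mul_le_mul_left _ (by omega)
        omega
      interval_cases c <;> omega
  rw [sum_congr rfl h, sum_ite_eq' (range _) s, if_pos (mem_range.2 (by omega))]

open Polynomial in
/-- A polynomial whose values are the partial sums of `1 / m` modulo `p`. -/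
theorem exists_polynomial_partial_sums (hp : 3 < p) : ∃ P : (ZMod p)[X], P.natDegree ≤ p - 1 ∧
    P.comp (X + 1) - P = X ^ (p - 2) ∧
    ∀ n < p, P.eval (n : ZMod p) = ∑ m ∈ Ico 1 n, (m : ZMod p)⁻¹ := by
  classical
  set f : ZMod p → ZMod p := fun x => ∑ m ∈ Ico 1 x.val, (m : ZMod p)⁻¹
  set P := Lagrange.interpolate univ id f
  have hinj : Set.InjOn (id : ZMod p → ZMod p) (univ : Finset (ZMod p)) := Set.injOn_id _
  have hev : ∀ x, P.eval x = f x := fun x => Lagrange.eval_interpolate_at_node f hinj (mem_univ x)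
  have hdeg : P.degree < p := by
    have := Lagrange.degree_interpolate_lt f hinj
    rwa [card_univ, ZMod.card] at this
  have hn : ∀ n < p, P.eval (n : ZMod p) = ∑ m ∈ Ico 1 n, (m : ZMod p)⁻¹ := by
    intro n hn
    rw [hev]
    simp only [f, ZMod.val_cast_of_lt hn]
  have hnat : P.natDegree ≤ p - 1 := by
    have : P.natDegree < p := by
      rcases eq_or_ne P 0 with h0 | h0
      · rw [h0, natDegree_zero]; omega
      · exact (natDegree_lt_iff_degree_lt h0).2 hdeg
    omega
  refine ⟨P, hnat, ?_, hn⟩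
  have hX : (X + 1 : (ZMod p)[X]).natDegree = 1 := by
    rw [← C_1]; exact natDegree_X_add_C 1
  -- The degree is below p, so vanishing at every point of 𝔽_p forces a polynomial identity.
  have hd : (P.comp (X + 1) - P - X ^ (p - 2)).degree
      < ((univ : Finset (ZMod p)).card : WithBot ℕ) := by
    rw [card_univ, ZMod.card]
    have h1 : (P.comp (X + 1) - P - X ^ (p - 2)).natDegree ≤ p - 1 := by
      refine (natDegree_sub_le _ _).trans (max_le ((natDegree_sub_le _ _).trans (max_le ?_ hnat)) ?_)
      · rw [natDegree_comp, hX, mul_one]; exact hnat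
      · rw [natDegree_X_pow]; omega
    exact degree_le_natDegree.trans_lt (Nat.cast_lt.2 (by omega))
  have hz := Polynomial.eq_zero_of_degree_lt_of_eval_finset_eq_zero univ hd ?_
  · exact sub_eq_zero.1 hz
  intro x _
  obtain ⟨n, hnp, rfl⟩ : ∃ n < p, (n : ZMod p) = x := ⟨x.val, ZMod.val_lt x, ZMod.natCast_zmod_val x⟩
  have hpow : (n : ZMod p) ^ (p - 2) = (n : ZMod p)⁻¹ := by
    have := zmod_inv_pow (x := (n : ZMod p)) (a := 1) one_pos (by omega)
    rw [pow_one] at this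
    rw [this]; congr 1
  simp only [eval_sub, eval_comp, eval_add, eval_X, eval_one, eval_pow, hpow]
  have hmain : P.eval ((n : ZMod p) + 1) = ∑ m ∈ Ico 1 (n + 1), (m : ZMod p)⁻¹ := by
    rcases Nat.lt_or_ge (n + 1) p with h | h
    · rw [← hn _ h]; push_cast; rfl
    -- The argument wraps around to 0 here, and the identity needed is ∑_{m<p} 1/m = 0 in 𝔽_p.
    · have hnp' : n + 1 = p := by omega
      have h0 : (n : ZMod p) + 1 = ((0 : ℕ) : ZMod p) := by
        have : ((n + 1 : ℕ) : ZMod p) = 0 := by rw [hnp']; exact ZMod.natCast_self p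
        push_cast at this ⊢; exact this
      rw [h0, hn 0 (by omega), hnp']
      have h1 := sum_Ico_eq_sum_zmod (p := p) (fun x => x⁻¹ ^ 1) (by simp)
      simp only [zmod_inv_pow one_pos (show 1 < p - 1 by omega)] at h1
      rw [zmod_sum_pow (by omega), if_neg] at h1
      · simp only [Ico_eq_empty_of_le (Nat.zero_le 1), sum_empty]
        rw [← h1]
        refine sum_congr rfl fun m _ => ?_
        rw [← zmod_inv_pow one_pos (show 1 < p - 1 by omega), pow_one]
      · intro h
        have := Nat.le_of_dvd (by omega) h
        omega
  rw [hmain, hn n hnp]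
  rcases Nat.eq_zero_or_pos n with rfl | hpos
  · simp
  · rw [sum_Ico_succ_top hpos]; ring

theorem toZMod_mhsTwo (a b : ℕ) : PadicInt.toZMod (mhsTwo p a b)
    = ∑ n ∈ Ico 1 p, (n : ZMod p)⁻¹ ^ a * ∑ m ∈ Ico 1 n, (m : ZMod p)⁻¹ ^ b := by
  simp only [mhsTwo, map_sum, map_mul, map_pow, toZMod_unitInv, mul_sum]

-- If P interpolates the partial sums of 1/m, then differentiating P(X+1) − P(X) = X^{p−2} shows
-- that P' interpolates a constant minus twice the partial sums of 1/m². Extracting the coefficient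
-- of degree s+1 in P and of degree s in P' expresses both double sums through the same coefficient.
open Polynomial in
theorem prime_dvd_mhsTwo_add_mhsTwo {s : ℕ} (hs : 0 < s) (hsp : s + 2 < p - 1) :
    (p : ℤ_[p]) ∣ (s + 1 : ℕ) * mhsTwo p (s + 1) 1 + 2 * mhsTwo p s 2 := by
  obtain ⟨P, hdeg, hP, hev⟩ := exists_polynomial_partial_sums (p := p) (by omega)
  have hder : (derivative P).comp (X + 1) - derivative P = C (-2) * X ^ (p - 3) := by
    have h := congrArg derivative hP
    rw [derivative_sub, derivative_comp, derivative_X_pow] at h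
    simp only [derivative_add, derivative_X, derivative_one, add_zero, one_mul] at h
    rw [h]
    congr 1
    · have : ((p - 2 : ℕ) : ZMod p) = -2 := by
        rw [Nat.cast_sub (by omega), ZMod.natCast_self]; norm_num
      rw [this]
  have hev' : ∀ n < p, (derivative P).eval (n : ZMod p)
      = (derivative P).eval 0 - 2 * ∑ m ∈ Ico 1 n, (m : ZMod p)⁻¹ ^ 2 := by
    intro n hn
    induction n with
    | zero => simp
    | succ n ih =>
      have h := congrArg (Polynomial.eval (n : ZMod p)) hder
      have hpow : (n : ZMod p) ^ (p - 3) = (n : ZMod p)⁻¹ ^ 2 := by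
        rw [zmod_inv_pow two_pos (by omega)]; congr 1
      simp only [eval_sub, eval_comp, eval_add, eval_X, eval_one, eval_mul, eval_C, eval_pow,
        hpow] at h
      have ih' := ih (by omega)
      push_cast
      rcases Nat.eq_zero_or_pos n with rfl | hpos
      · simp at h ih' ⊢
        linear_combination h
      · rw [sum_Ico_succ_top hpos]
        linear_combination h + ih'
  rw [prime_dvd_iff_toZMod_eq_zero]
  simp only [map_add, map_mul, map_natCast, map_ofNat, toZMod_mhsTwo, pow_one]
  have h1 : ∑ n ∈ Ico 1 p, (n : ZMod p)⁻¹ ^ (s + 1) * ∑ m ∈ Ico 1 n, (m : ZMod p)⁻¹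
      = -P.coeff (s + 1) := by
    rw [← zmod_sum_pow_mul_eval hdeg (Nat.succ_pos s) (by omega),
      ← sum_Ico_eq_sum_zmod _ (by rw [zero_pow (by omega), zero_mul])]
    refine sum_congr rfl fun n hn => ?_
    rw [hev n (mem_Ico.1 hn).2, zmod_inv_pow (Nat.succ_pos s) (by omega)]
  have h2 : ∑ n ∈ Ico 1 p, (n : ZMod p)⁻¹ ^ s * (derivative P).eval (n : ZMod p)
      = -(derivative P).coeff s := by
    rw [← zmod_sum_pow_mul_eval ((natDegree_derivative_le P).trans (by omega)) hs (by omega),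
      ← sum_Ico_eq_sum_zmod _ (by rw [zero_pow (by omega), zero_mul])]
    refine sum_congr rfl fun n hn => ?_
    rw [zmod_inv_pow hs (by omega)]
  have h3 : ∑ n ∈ Ico 1 p, (n : ZMod p)⁻¹ ^ s * (derivative P).eval (n : ZMod p)
      = (derivative P).eval 0 * ∑ n ∈ Ico 1 p, (n : ZMod p)⁻¹ ^ s
        - 2 * ∑ n ∈ Ico 1 p, (n : ZMod p)⁻¹ ^ s * ∑ m ∈ Ico 1 n, (m : ZMod p)⁻¹ ^ 2 := by
    rw [mul_sum, mul_sum, ← sum_sub_distrib]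
    refine sum_congr rfl fun n hn => ?_
    rw [hev' n (mem_Ico.1 hn).2]; ring
  have h4 : ∑ n ∈ Ico 1 p, (n : ZMod p)⁻¹ ^ s = 0 := by
    have := (prime_dvd_iff_toZMod_eq_zero _).1 (prime_dvd_mhsOne (p := p) hs (by omega))
    simpa only [mhsOne, map_sum, map_pow, toZMod_unitInv] using this
  rw [coeff_derivative] at h2
  rw [h1]
  push_cast
  rw [h4] at h3
  linear_combination -h2 + h3

end

/-! ### Low-weight harmonic sums modulo small powers of p -/

section

variable {p : ℕ} [Fact p.Prime]

/-- Allows the certificates below to have integer coefficients: denominators built from 2, 3, 5, 7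
are cleared first and cancelled here. -/
theorem pow_dvd_of_pow_dvd_natCast_mul (hp : 100 < p) {n D k : ℕ} (hD : D ∣ 2520 ^ k) {x : ℤ_[p]}
    (h : (p : ℤ_[p]) ^ n ∣ (D : ℤ_[p]) * x) : (p : ℤ_[p]) ^ n ∣ x := by
  have hpD : ¬ p ∣ D := by
    intro hd
    have h1 := (Fact.out : p.Prime).dvd_of_dvd_pow (hd.trans hD)
    have h2 : p ∣ 2 ^ 3 * 3 ^ 2 * 5 * 7 := h1
    have hpr := (Fact.out : p.Prime)
    simp only [hpr.dvd_mul] at h2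
    rcases h2 with ((h2 | h2) | h2) | h2
    · have := Nat.le_of_dvd (by norm_num) (hpr.dvd_of_dvd_pow h2); omega
    · have := Nat.le_of_dvd (by norm_num) (hpr.dvd_of_dvd_pow h2); omega
    · have := Nat.le_of_dvd (by norm_num) h2; omega
    · have := Nat.le_of_dvd (by norm_num) h2; omega
  rw [(PadicInt.isUnit_natCast_of_not_dvd hpD).dvd_mul_left] at h
  exact h

theorem dvd_mhsOne (hp : 100 < p) {a : ℕ} (ha : 0 < a) (h : a < 50) :
    (p : ℤ_[p]) ∣ mhsOne p a := prime_dvd_mhsOne ha (by omega)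

/-- In odd weight reflection reads 2H(a) ≡ −a·p·H(a+1) modulo p², and p ∣ H(a+1). -/
theorem sq_dvd_mhsOne (hp : 100 < p) {a : ℕ} (ha : Odd a) (h : a < 49) :
    (p : ℤ_[p]) ^ 2 ∣ mhsOne p a := by
  obtain ⟨e, he⟩ := mhsOne_reflect p ha.pos 2
  obtain ⟨z, hz⟩ := dvd_mhsOne hp (a := a + 1) (by omega) (by omega)
  simp only [ha.neg_one_pow, sum_range_succ, sum_range_zero, Nat.choose_zero_right,
    Nat.choose_one_right, add_zero, hz] at he
  refine pow_dvd_of_pow_dvd_natCast_mul hp (D := 2) (k := 1) (by norm_num) ⟨e - a * z, ?_⟩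
  have hc : ((a - 1 + 1 : ℕ) : ℤ_[p]) = a := by rw [Nat.sub_add_cancel ha.pos]
  rw [hc] at he
  push_cast at he ⊢
  linear_combination he

theorem two_mul_mhsOne_one (hp : 100 < p) :
    (p : ℤ_[p]) ^ 4 ∣ 2 * mhsOne p 1 + p * mhsOne p 2 := by
  obtain ⟨e, he⟩ := mhsOne_reflect p (a := 1) one_pos 4
  obtain ⟨z, hz⟩ := sq_dvd_mhsOne hp (a := 3) (by decide) (by norm_num)
  obtain ⟨w, hw⟩ := dvd_mhsOne hp (a := 4) (by norm_num) (by norm_num)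
  simp only [sum_range_succ, sum_range_zero, Nat.choose, Nat.reduceAdd, Nat.reduceSub] at he
  push_cast at he
  exact ⟨e - z - w, by linear_combination he - (p : ℤ_[p]) ^ 2 * hz - (p : ℤ_[p]) ^ 3 * hw⟩

theorem four_mul_mhsOne_one_sq (hp : 100 < p) :
    (p : ℤ_[p]) ^ 6 ∣ 4 * (mhsOne p 1 * mhsOne p 1) - p ^ 2 * (mhsOne p 2 * mhsOne p 2) := by
  obtain ⟨e, he⟩ := two_mul_mhsOne_one hp
  obtain ⟨z, hz⟩ := dvd_mhsOne hp (a := 2) (by norm_num) (by norm_num)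
  refine ⟨(p : ℤ_[p]) ^ 2 * e ^ 2 - 2 * e * z, ?_⟩
  linear_combination (2 * mhsOne p 1 - p * mhsOne p 2 + (p : ℤ_[p]) ^ 4 * e) * he
    - 2 * (p : ℤ_[p]) ^ 5 * e * hz

theorem two_mul_mhsOne_one_mul_mhsOne_two (hp : 100 < p) :
    (p : ℤ_[p]) ^ 5 ∣ 2 * (mhsOne p 1 * mhsOne p 2) + p * (mhsOne p 2 * mhsOne p 2) := by
  obtain ⟨e, he⟩ := two_mul_mhsOne_one hp
  obtain ⟨z, hz⟩ := dvd_mhsOne hp (a := 2) (by norm_num) (by norm_num)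
  exact ⟨e * z, by linear_combination mhsOne p 2 * he + (p : ℤ_[p]) ^ 4 * e * hz⟩

/-- The reflected shuffle gives 3H(1,1) + pH(2,1) ≡ 0, the stuffle gives 2H(1,1) = H(1)² − H(2), and
H(1)² is negligible. -/
theorem two_mul_prime_mul_mhsTwo_two_one (hp : 100 < p) :
    (p : ℤ_[p]) ^ 2 ∣ 2 * p * mhsTwo p 2 1 - 3 * mhsOne p 2 := by
  obtain ⟨e, he⟩ := shuffleTwo_reflect p 1 (b := 1) one_pos 2
  obtain ⟨z, hz⟩ := sq_dvd_mhsOne hp (a := 1) (by decide) (by norm_num)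
  have h := mhsOne_mul_mhsOne p 1 1
  simp only [sum_range_succ, sum_range_zero, Nat.choose, shuffleTwo_succ_succ,
    shuffleTwo_zero_left, shuffleTwo_zero_right, Nat.reduceAdd, Nat.reduceSub, zero_add,
    add_zero] at he h
  push_cast at he
  exact ⟨2 * e - 3 * z * mhsOne p 1,
    by linear_combination 2 * he + 3 * h - 3 * mhsOne p 1 * hz⟩

theorem two_mul_prime_mul_mhsOne_two_mul_mhsTwo (hp : 100 < p) :
    (p : ℤ_[p]) ^ 3 ∣ 2 * (p * (mhsOne p 2 * mhsTwo p 2 1)) - 3 * (mhsOne p 2 * mhsOne p 2) := by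
  obtain ⟨e, he⟩ := two_mul_prime_mul_mhsTwo_two_one hp
  obtain ⟨z, hz⟩ := dvd_mhsOne hp (a := 2) (by norm_num) (by norm_num)
  exact ⟨e * z, by linear_combination mhsOne p 2 * he + (p : ℤ_[p]) ^ 2 * e * hz⟩

end

/-! ### Linear relations among multiple harmonic sums -/

/-- Up to multiples of p^6, the expression is 12 times the difference between 35 times the depth-one
expansion of C_{2,3,p} and the asserted value of 35·C_{2,3,p}. The proof is a certificate: a
combination of reflections, shuffles and stuffles in which every other sum cancels. -/
theorem cubic_relation_sq {p : ℕ} [Fact p.Prime] (hp : 100 < p) :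
    (p : ℤ_[p]) ^ 6 ∣ 840 * (p : ℤ_[p]) * mhsTwo p 2 1 + (-1260) * (p : ℤ_[p]) * mhsOne p 3 + 1260
      * (p : ℤ_[p]) ^ 2 * mhsOne p 3 + (-735) * (p : ℤ_[p]) ^ 2 * mhsOne p 4 + 1890 *
      (p : ℤ_[p]) ^ 3 * mhsOne p 4 + (-840) * (p : ℤ_[p]) ^ 3 * mhsTwo p 4 1 + (-210) *
      (p : ℤ_[p]) ^ 3 * mhsOne p 5 + (-1155) * (p : ℤ_[p]) ^ 4 * mhsOne p 4 + 1470 *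
      (p : ℤ_[p]) ^ 4 * mhsOne p 5 + 49 * (p : ℤ_[p]) ^ 4 * mhsOne p 6 + 924 * (p : ℤ_[p]) ^ 5 *
      mhsTwo p 4 1 + (-2310) * (p : ℤ_[p]) ^ 5 * mhsOne p 5 + 525 * (p : ℤ_[p]) ^ 5 * mhsOne p 6 +
      828 * (p : ℤ_[p]) ^ 5 * mhsTwo p 6 1 + 42 * (p : ℤ_[p]) ^ 5 * mhsOne p 7 + (-1260) *
      mhsOne p 2 := by
  obtain ⟨e1, h1⟩ := sq_dvd_mhsOne hp (a := 7) (by decide) (by norm_num)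
  obtain ⟨e2, h2⟩ := sq_dvd_mhsOne hp (a := 5) (by decide) (by norm_num)
  obtain ⟨e3, h3⟩ := mhsOne_reflect p (a := 2) (by norm_num) 4
  obtain ⟨e4, h4⟩ := mhsOne_reflect p (a := 5) (by norm_num) 2
  obtain ⟨e5, h5⟩ := mhsOne_reflect p (a := 2) (by norm_num) 6
  obtain ⟨e6, h6⟩ := mhsOne_reflect p (a := 5) (by norm_num) 3
  obtain ⟨e7, h7⟩ := mhsOne_reflect p (a := 2) (by norm_num) 5
  obtain ⟨e8, h8⟩ := shuffleTwo_reflect p 1 (b := 2) (by norm_num) 5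
  obtain ⟨e9, h9⟩ := shuffleTwo_reflect p 4 (b := 1) (by norm_num) 3
  obtain ⟨e10, h10⟩ := shuffleTwo_reflect p 1 (b := 4) (by norm_num) 3
  obtain ⟨e11, h11⟩ := shuffleTwo_reflect p 2 (b := 2) (by norm_num) 4
  obtain ⟨e12, h12⟩ := shuffleTwo_reflect p 2 (b := 3) (by norm_num) 3
  obtain ⟨e13, h13⟩ := shuffleTwo_reflect p 4 (b := 2) (by norm_num) 2
  obtain ⟨e14, h14⟩ := shuffleTwo_reflect p 2 (b := 4) (by norm_num) 2
  obtain ⟨e15, h15⟩ := shuffleTwo_reflect p 1 (b := 2) (by norm_num) 3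
  obtain ⟨e16, h16⟩ := shuffleTwo_reflect p 1 (b := 1) (by norm_num) 6
  obtain ⟨e17, h17⟩ := shuffleTwo_reflect p 2 (b := 2) (by norm_num) 2
  obtain ⟨e18, h18⟩ := shuffleTwo_reflect p 3 (b := 2) (by norm_num) 1
  obtain ⟨e19, h19⟩ := shuffleTwo_reflect p 2 (b := 1) (by norm_num) 5
  have h20 := mhsOne_mul_mhsOne p 1 2
  have h21 := mhsOne_mul_mhsOne p 2 3
  have h22 := mhsOne_mul_mhsOne p 3 3
  have h23 := mhsOne_mul_mhsOne p 1 1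
  have h24 := mhsOne_mul_mhsOne p 1 4
  have h25 := mhsOne_mul_mhsOne p 2 2
  -- In weight 7 everything is multiplied by p^5, so the relation 6H(6,1) + 2H(5,2) ≡ 0 modulo p is
  -- enough.
  obtain ⟨e26, h26⟩ := prime_dvd_mhsTwo_add_mhsTwo (p := p) (s := 5) (by norm_num) (by omega)
  obtain ⟨e27, h27⟩ := two_mul_mhsOne_one_mul_mhsOne_two hp
  obtain ⟨e28, h28⟩ := dvd_mhsOne hp (a := 2) (by decide) (by norm_num)
  obtain ⟨e29, h29⟩ := sq_dvd_mhsOne hp (a := 3) (by decide) (by norm_num)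
  obtain ⟨e30, h30⟩ := four_mul_mhsOne_one_sq hp
  obtain ⟨e31, h31⟩ := sq_dvd_mhsOne hp (a := 1) (by decide) (by norm_num)
  obtain ⟨e32, h32⟩ := dvd_mhsOne hp (a := 4) (by decide) (by norm_num)
  simp only [sum_range_succ, sum_range_zero, Nat.choose, shuffleTwo_succ_succ,
    shuffleTwo_zero_left, shuffleTwo_zero_right, Nat.reduceAdd, Nat.reduceSub, zero_add, add_zero]
    at h3 h4 h5 h6 h7 h8 h9 h10 h11 h12 h13 h14 h15 h16 h17 h18 h19
  push_cast at h3 h4 h5 h6 h7 h8 h9 h10 h11 h12 h13 h14 h15 h16 h17 h18 h19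
  -- The certificate is scaled by 3 to have integer coefficients; the witness is the same
  -- combination of the error terms, divided by p^6.
  refine pow_dvd_of_pow_dvd_natCast_mul hp (D := 3) (k := 9) (by norm_num) ⟨?_, ?_⟩
  · exact (-5664) * e1 * (p : ℤ_[p]) + (-416) * e10 + (-214) * e11 + (-424) * e12 + 107 * e13 +
      (-214) * e14 + (-2772) * e15 + 2520 * e16 + (-1386) * e17 + (-924) * e18 + 844 * e19 +
      (-1386) * e2 * (p : ℤ_[p]) + (-6) * e26 + 1386 * e27 * (p : ℤ_[p]) ^ 2 + (-1260) * e27 + 626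
      * e28 * e29 + (-693) * e28 ^ 2 + 107 * e29 * mhsOne p 3 + 1386 * e3 + (-945) * e30 + (-12) *
      e31 * e32 + (-1575) * e4 + 630 * e5 + 638 * e6 + (-1890) * e7 + 832 * e8 + 214 * e9
  · push_cast
    linear_combination ((-5664) * (p : ℤ_[p]) ^ 5) * h1 + ((-1386) * (p : ℤ_[p]) ^ 5) * h2 + (1386
      * (p : ℤ_[p]) ^ 2) * h3 + ((-1575) * (p : ℤ_[p]) ^ 4) * h4 + (630) * h5 + (638 *
      (p : ℤ_[p]) ^ 3) * h6 + ((-1890) * (p : ℤ_[p])) * h7 + (832 * (p : ℤ_[p])) * h8 + (214 *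
      (p : ℤ_[p]) ^ 3) * h9 + ((-416) * (p : ℤ_[p]) ^ 3) * h10 + ((-214) * (p : ℤ_[p]) ^ 2) * h11
      + ((-424) * (p : ℤ_[p]) ^ 3) * h12 + (107 * (p : ℤ_[p]) ^ 4) * h13 + ((-214) *
      (p : ℤ_[p]) ^ 4) * h14 + ((-2772) * (p : ℤ_[p]) ^ 3) * h15 + (2520) * h16 + ((-1386) *
      (p : ℤ_[p]) ^ 4) * h17 + ((-924) * (p : ℤ_[p]) ^ 5) * h18 + (844 * (p : ℤ_[p])) * h19 +
      ((-2772) * (p : ℤ_[p]) ^ 3) * h20 + ((-626) * (p : ℤ_[p]) ^ 3) * h21 + ((-107) *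
      (p : ℤ_[p]) ^ 4) * h22 + (3780) * h23 + (2520 * (p : ℤ_[p])) * h20 + (12 * (p : ℤ_[p]) ^ 3)
      * h24 + ((-693) * (p : ℤ_[p]) ^ 4) * h25 + ((-6) * (p : ℤ_[p]) ^ 5) * h26 + (315 *
      (p : ℤ_[p]) ^ 2) * h25 + (1386 * (p : ℤ_[p]) ^ 3) * h27 + (626 * (p : ℤ_[p]) ^ 3 *
      mhsOne p 3) * h28 + (107 * (p : ℤ_[p]) ^ 4 * mhsOne p 3) * h29 + ((-945)) * h30 + ((-1260) *
      (p : ℤ_[p])) * h27 + ((-12) * (p : ℤ_[p]) ^ 3 * mhsOne p 4) * h31 + (626 * e28 *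
      (p : ℤ_[p]) ^ 4) * h29 + ((-12) * e31 * (p : ℤ_[p]) ^ 5) * h32 + ((-693) * (p : ℤ_[p]) ^ 4 *
      mhsOne p 2) * h28 + ((-693) * e28 * (p : ℤ_[p]) ^ 5) * h28

/-- The analogue for C_{3,3,p}, scaled by 60. -/
theorem cubic_relation_cube {p : ℕ} [Fact p.Prime] (hp : 100 < p) :
    (p : ℤ_[p]) ^ 6 ∣ (-180) * (p : ℤ_[p]) * mhsOne p 2 + 120 * (p : ℤ_[p]) ^ 2 * mhsTwo p 2 1 +
      (-180) * (p : ℤ_[p]) ^ 2 * mhsOne p 3 + (-105) * (p : ℤ_[p]) ^ 3 * mhsOne p 4 + 180 *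
      (p : ℤ_[p]) ^ 4 * mhsOne p 3 + (-120) * (p : ℤ_[p]) ^ 4 * mhsTwo p 4 1 + (-30) *
      (p : ℤ_[p]) ^ 4 * mhsOne p 5 + 270 * (p : ℤ_[p]) ^ 5 * mhsOne p 4 + 7 * (p : ℤ_[p]) ^ 5 *
      mhsOne p 6 := by
  obtain ⟨e1, h1⟩ := sq_dvd_mhsOne hp (a := 5) (by decide) (by norm_num)
  obtain ⟨e2, h2⟩ := dvd_mhsOne hp (a := 6) (by decide) (by norm_num)
  obtain ⟨e3, h3⟩ := mhsOne_reflect p (a := 3) (by norm_num) 2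
  obtain ⟨e4, h4⟩ := mhsOne_reflect p (a := 2) (by norm_num) 5
  obtain ⟨e5, h5⟩ := shuffleTwo_reflect p 2 (b := 3) (by norm_num) 2
  obtain ⟨e6, h6⟩ := shuffleTwo_reflect p 3 (b := 3) (by norm_num) 1
  obtain ⟨e7, h7⟩ := shuffleTwo_reflect p 3 (b := 2) (by norm_num) 2
  obtain ⟨e8, h8⟩ := shuffleTwo_reflect p 2 (b := 2) (by norm_num) 3
  obtain ⟨e9, h9⟩ := shuffleTwo_reflect p 2 (b := 1) (by norm_num) 4
  have h10 := mhsOne_mul_mhsOne p 3 3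
  have h11 := mhsOne_mul_mhsOne p 2 3
  have h12 := mhsOne_mul_mhsOne p 1 2
  obtain ⟨e13, h13⟩ := shuffleTwo_reflect p 1 (b := 1) (by norm_num) 5
  have h14 := mhsOne_mul_mhsOne p 1 1
  have h15 := mhsOne_mul_mhsOne p 2 2
  obtain ⟨e16, h16⟩ := sq_dvd_mhsOne hp (a := 3) (by decide) (by norm_num)
  obtain ⟨e17, h17⟩ := dvd_mhsOne hp (a := 2) (by decide) (by norm_num)
  obtain ⟨e18, h18⟩ := two_mul_mhsOne_one_mul_mhsOne_two hp
  obtain ⟨e19, h19⟩ := four_mul_mhsOne_one_sq hp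
  simp only [sum_range_succ, sum_range_zero, Nat.choose, shuffleTwo_succ_succ,
    shuffleTwo_zero_left, shuffleTwo_zero_right, Nat.reduceAdd, Nat.reduceSub, zero_add, add_zero]
    at h3 h4 h5 h6 h7 h8 h9 h13
  push_cast at h3 h4 h5 h6 h7 h8 h9 h13
  refine pow_dvd_of_pow_dvd_natCast_mul hp (D := 1) (k := 9) (by norm_num) ⟨?_, ?_⟩
  · exact 60 * e1 + 120 * e13 + 30 * e16 * e17 * (p : ℤ_[p]) + 5 * e16 * (p : ℤ_[p]) * mhsOne p 3
      + (-60) * e18 * (p : ℤ_[p]) + (-45) * e19 * (p : ℤ_[p]) + 152 * e2 + 90 * e3 + 30 * e4 +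
      (-30) * e5 + (-10) * e6 + (-10) * e7 + (-30) * e8 + 60 * e9
  · push_cast
    linear_combination (60 * (p : ℤ_[p]) ^ 4) * h1 + (152 * (p : ℤ_[p]) ^ 5) * h2 + (90 *
      (p : ℤ_[p]) ^ 4) * h3 + (30 * (p : ℤ_[p])) * h4 + ((-30) * (p : ℤ_[p]) ^ 4) * h5 + ((-10) *
      (p : ℤ_[p]) ^ 5) * h6 + ((-10) * (p : ℤ_[p]) ^ 4) * h7 + ((-30) * (p : ℤ_[p]) ^ 3) * h8 +
      (60 * (p : ℤ_[p]) ^ 2) * h9 + ((-5) * (p : ℤ_[p]) ^ 5) * h10 + ((-30) * (p : ℤ_[p]) ^ 4) *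
      h11 + (120 * (p : ℤ_[p]) ^ 2) * h12 + (120 * (p : ℤ_[p])) * h13 + (180 * (p : ℤ_[p])) * h14
      + (15 * (p : ℤ_[p]) ^ 3) * h15 + (5 * (p : ℤ_[p]) ^ 5 * mhsOne p 3) * h16 + (30 *
      (p : ℤ_[p]) ^ 4 * mhsOne p 3) * h17 + ((-60) * (p : ℤ_[p]) ^ 2) * h18 + ((-45) *
      (p : ℤ_[p])) * h19 + (30 * e17 * (p : ℤ_[p]) ^ 5) * h16

/-- Trades p²H(4,1,1), the only triple sum in the theorem, for H(2)². Triple shuffles and stuffles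
in weights 5 and 6 are combined, and pH(2)H(2,1) is replaced by (3/2)H(2)². -/
theorem mhsThree_relation {p : ℕ} [Fact p.Prime] (hp : 100 < p) :
    (p : ℤ_[p]) ^ 3 ∣ 8 * (p : ℤ_[p]) ^ 2 * mhsThree p 4 1 1 + 3 * (mhsOne p 2) ^ 2 := by
  obtain ⟨e1, h1⟩ := shuffleTwo_reflect p 1 (b := 5) (by norm_num) 1
  have h2 := mhsOne_mul_mhsOne p 4 2
  obtain ⟨e3, h3⟩ := mhsOne_reflect p (a := 4) (by norm_num) 3
  obtain ⟨e4, h4⟩ := shuffleTwo_reflect p 2 (b := 3) (by norm_num) 2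
  have h5 := mhsOne_mul_mhsOne p 3 2
  have h6 := mhsOne_mul_mhsOne p 5 1
  obtain ⟨e7, h7⟩ := dvd_mhsOne hp (a := 6) (by decide) (by norm_num)
  have h8 := mhsOne_mul_mhsTwo p 2 2 1
  have h9 := mhsOne_mul_mhsTwo p 3 1 2
  have h10 := mhsOne_mul_mhsTwo p 3 1 1
  obtain ⟨e11, h11⟩ := shuffleThree_reflect p 1 3 (b := 1) (by norm_num) 2
  have h12 := mhsOne_mul_mhsTwo p 4 1 1
  obtain ⟨e13, h13⟩ := shuffleTwo_reflect p 4 (b := 2) (by norm_num) 1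
  obtain ⟨e14, h14⟩ := shuffleThree_reflect p 1 4 (b := 1) (by norm_num) 1
  have h15 := mhsOne_mul_mhsOne p 3 3
  have h16 := mhsOne_mul_mhsTwo p 1 1 3
  obtain ⟨e17, h17⟩ := shuffleThree_reflect p 1 1 (b := 3) (by norm_num) 2
  have h18 := mhsOne_mul_mhsTwo p 2 1 3
  have h19 := mhsOne_mul_mhsTwo p 1 4 1
  obtain ⟨e20, h20⟩ := shuffleThree_reflect p 1 2 (b := 2) (by norm_num) 2
  obtain ⟨e21, h21⟩ := dvd_mhsOne hp (a := 2) (by decide) (by norm_num)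
  obtain ⟨e22, h22⟩ := sq_dvd_mhsOne hp (a := 1) (by decide) (by norm_num)
  obtain ⟨e23, h23⟩ := two_mul_prime_mul_mhsOne_two_mul_mhsTwo hp
  obtain ⟨e24, h24⟩ := sq_dvd_mhsOne hp (a := 3) (by decide) (by norm_num)
  obtain ⟨e25, h25⟩ := dvd_mhsOne hp (a := 4) (by decide) (by norm_num)
  simp only [sum_range_succ, sum_range_zero, Nat.choose, shuffleTwo_succ_succ,
    shuffleTwo_zero_left, shuffleTwo_zero_right, Nat.reduceAdd, Nat.reduceSub, zero_add, add_zero]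
    at h1 h3 h4 h13
  simp only [sum_range_succ, sum_range_zero, Nat.choose, shuffleThree_succ_succ,
    shuffleThree_zero_left, shuffleThree_zero_right, shuffleInner_succ_succ,
    shuffleInner_zero_left, shuffleInner_zero_right, Nat.reduceAdd, Nat.reduceSub, zero_add,
    add_zero] at h11 h14 h17 h20
  push_cast at h1 h3 h4 h13 h11 h14 h17 h20
  refine pow_dvd_of_pow_dvd_natCast_mul hp (D := 24) (k := 9) (by norm_num) ⟨?_, ?_⟩
  · exact 120 * e1 + (-60) * e11 + (-9) * e13 + (-84) * e14 + 36 * e17 + 12 * e20 + (-128) * e21 *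
      e24 * (p : ℤ_[p]) + 60 * e21 * mhsTwo p 1 3 + (-120) * e21 * mhsOne p 4 + (-84) * e22 *
      (p : ℤ_[p]) * mhsTwo p 4 1 + (-456) * e22 * (p : ℤ_[p]) * mhsOne p 5 + 144 * e22 *
      mhsTwo p 1 3 + (-24) * e23 + 24 * e24 * (p : ℤ_[p]) * mhsTwo p 1 2 + (-81) * e24 *
      (p : ℤ_[p]) * mhsOne p 3 + (-144) * e24 * mhsTwo p 1 1 + 252 * e25 * mhsTwo p 1 1 + (-32) *
      e3 + 32 * e4 + 337 * e7
  · push_cast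
    linear_combination (120 * (p : ℤ_[p]) ^ 2) * h1 + (120 * (p : ℤ_[p]) ^ 2) * h2 + ((-32)) * h3
      + (32 * (p : ℤ_[p])) * h4 + (128 * (p : ℤ_[p])) * h5 + (456 * (p : ℤ_[p]) ^ 2) * h6 + (337 *
      (p : ℤ_[p]) ^ 2) * h7 + (48 * (p : ℤ_[p])) * h8 + ((-24) * (p : ℤ_[p]) ^ 2) * h9 + (144 *
      (p : ℤ_[p])) * h10 + ((-60) * (p : ℤ_[p])) * h11 + ((-252) * (p : ℤ_[p]) ^ 2) * h12 + ((-9)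
      * (p : ℤ_[p]) ^ 2) * h13 + ((-84) * (p : ℤ_[p]) ^ 2) * h14 + (81 * (p : ℤ_[p]) ^ 2) * h15 +
      ((-144) * (p : ℤ_[p])) * h16 + (36 * (p : ℤ_[p])) * h17 + ((-60) * (p : ℤ_[p]) ^ 2) * h18 +
      (84 * (p : ℤ_[p]) ^ 2) * h19 + (12 * (p : ℤ_[p])) * h20 + ((-120) * (p : ℤ_[p]) ^ 2 *
      mhsOne p 4) * h21 + ((-128) * (p : ℤ_[p]) * mhsOne p 3) * h21 + ((-456) * (p : ℤ_[p]) ^ 2 *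
      mhsOne p 5) * h22 + ((-24)) * h23 + (24 * (p : ℤ_[p]) ^ 2 * mhsTwo p 1 2) * h24 + ((-144) *
      (p : ℤ_[p]) * mhsTwo p 1 1) * h24 + (252 * (p : ℤ_[p]) ^ 2 * mhsTwo p 1 1) * h25 + ((-81) *
      (p : ℤ_[p]) ^ 2 * mhsOne p 3) * h24 + (144 * (p : ℤ_[p]) * mhsTwo p 1 3) * h22 + (60 *
      (p : ℤ_[p]) ^ 2 * mhsTwo p 1 3) * h21 + ((-84) * (p : ℤ_[p]) ^ 2 * mhsTwo p 4 1) * h22 +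
      ((-128) * e21 * (p : ℤ_[p]) ^ 2) * h24

/-- What is left of the claim for C_{2,4,p}, up to a scalar and multiples of p³, once the bracket in
`pow_mul_dvd_six_mul_coeff_unitLog_four` is taken at M = p and p²H(4,1,1) is replaced by
−(3/8)H(2)². -/
theorem quartic_relation_sq {p : ℕ} [Fact p.Prime] (hp : 100 < p) :
    (p : ℤ_[p]) ^ 3 ∣ 120 * (p : ℤ_[p]) * mhsTwo p 2 2 + (-160) * (p : ℤ_[p]) * mhsTwo p 2 3 + 240
      * (p : ℤ_[p]) * mhsTwo p 3 1 + (-280) * (p : ℤ_[p]) * mhsTwo p 3 2 + 180 * (p : ℤ_[p]) *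
      mhsOne p 4 + (-312) * (p : ℤ_[p]) * mhsTwo p 4 1 + 120 * (p : ℤ_[p]) ^ 2 * mhsTwo p 2 3 +
      (-120) * (p : ℤ_[p]) ^ 2 * mhsTwo p 2 4 + 240 * (p : ℤ_[p]) ^ 2 * mhsTwo p 3 2 + (-200) *
      (p : ℤ_[p]) ^ 2 * mhsTwo p 3 3 + 360 * (p : ℤ_[p]) ^ 2 * mhsTwo p 4 1 + (-240) *
      (p : ℤ_[p]) ^ 2 * mhsTwo p 4 2 + (-240) * (p : ℤ_[p]) ^ 2 * mhsTwo p 5 1 + 72 *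
      (mhsOne p 2) ^ 2 + (-120) * mhsTwo p 2 2 + (-240) * mhsTwo p 3 1 + (-240) * mhsOne p 4 := by
  obtain ⟨e1, h1⟩ := dvd_mhsOne hp (a := 6) (by decide) (by norm_num)
  obtain ⟨e2, h2⟩ := mhsOne_reflect p (a := 4) (by norm_num) 3
  have h3 := mhsOne_mul_mhsOne p 4 1
  have h4 := mhsOne_mul_mhsOne p 3 3
  obtain ⟨e5, h5⟩ := shuffleTwo_reflect p 3 (b := 1) (by norm_num) 3
  have h6 := mhsOne_mul_mhsOne p 3 1
  obtain ⟨e7, h7⟩ := shuffleTwo_reflect p 4 (b := 1) (by norm_num) 2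
  obtain ⟨e8, h8⟩ := shuffleTwo_reflect p 3 (b := 3) (by norm_num) 1
  obtain ⟨e9, h9⟩ := shuffleTwo_reflect p 1 (b := 4) (by norm_num) 2
  obtain ⟨e10, h10⟩ := shuffleTwo_reflect p 2 (b := 2) (by norm_num) 3
  obtain ⟨e11, h11⟩ := shuffleTwo_reflect p 2 (b := 2) (by norm_num) 2
  obtain ⟨e12, h12⟩ := shuffleTwo_reflect p 2 (b := 3) (by norm_num) 1
  obtain ⟨e13, h13⟩ := shuffleTwo_reflect p 1 (b := 3) (by norm_num) 2
  have h14 := mhsOne_mul_mhsOne p 2 2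
  obtain ⟨e15, h15⟩ := shuffleTwo_reflect p 2 (b := 3) (by norm_num) 2
  obtain ⟨e16, h16⟩ := sq_dvd_mhsOne hp (a := 1) (by decide) (by norm_num)
  obtain ⟨e17, h17⟩ := sq_dvd_mhsOne hp (a := 3) (by decide) (by norm_num)
  obtain ⟨e18, h18⟩ := dvd_mhsOne hp (a := 2) (by decide) (by norm_num)
  simp only [sum_range_succ, sum_range_zero, Nat.choose, shuffleTwo_succ_succ,
    shuffleTwo_zero_left, shuffleTwo_zero_right, Nat.reduceAdd, Nat.reduceSub, zero_add, add_zero]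
    at h2 h5 h7 h8 h9 h10 h11 h12 h13 h15
  push_cast at h2 h5 h7 h8 h9 h10 h11 h12 h13 h15
  refine pow_dvd_of_pow_dvd_natCast_mul hp (D := 1) (k := 9) (by norm_num) ⟨?_, ?_⟩
  · exact 856 * e1 + (-60) * e10 + 120 * e11 + 120 * e12 + (-120) * e13 + (-52) * e15 + (-168) *
      e16 * e17 * (p : ℤ_[p]) + 120 * e16 * mhsOne p 3 + 312 * e16 * mhsOne p 4 + (-76) * e17 *
      (p : ℤ_[p]) * mhsOne p 3 + 60 * e18 ^ 2 + 78 * e2 + 84 * e5 + (-120) * e7 + (-44) * e8 +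
      (-72) * e9
  · push_cast
    linear_combination (856 * (p : ℤ_[p]) ^ 2) * h1 + (78) * h2 + ((-312) * (p : ℤ_[p])) * h3 +
      (76 * (p : ℤ_[p]) ^ 2) * h4 + (84) * h5 + (168) * h6 + ((-120) * (p : ℤ_[p])) * h7 + ((-44)
      * (p : ℤ_[p]) ^ 2) * h8 + ((-72) * (p : ℤ_[p])) * h9 + ((-60)) * h10 + ((-120) *
      (p : ℤ_[p])) * h6 + (120 * (p : ℤ_[p])) * h11 + (120 * (p : ℤ_[p]) ^ 2) * h12 + ((-120) *
      (p : ℤ_[p])) * h13 + (72) * h14 + ((-52) * (p : ℤ_[p])) * h15 + ((-60) * (p : ℤ_[p])) * h14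
      + (312 * (p : ℤ_[p]) * mhsOne p 4) * h16 + ((-76) * (p : ℤ_[p]) ^ 2 * mhsOne p 3) * h17 +
      ((-168) * mhsOne p 3) * h16 + (120 * (p : ℤ_[p]) * mhsOne p 3) * h16 + ((-168) * e16 *
      (p : ℤ_[p]) ^ 2) * h17 + (60 * (p : ℤ_[p]) * mhsOne p 2) * h18 + (60 * e18 *
      (p : ℤ_[p]) ^ 2) * h18

/-- The same reduction at M = p², for C_{3,4,p}. -/
theorem quartic_relation_cube {p : ℕ} [Fact p.Prime] (hp : 100 < p) :
    (p : ℤ_[p]) ^ 3 ∣ (-160) * (p : ℤ_[p]) * mhsTwo p 2 3 + (-280) * (p : ℤ_[p]) * mhsTwo p 3 2 +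
      (-312) * (p : ℤ_[p]) * mhsTwo p 4 1 + 120 * (p : ℤ_[p]) ^ 2 * mhsTwo p 2 2 + (-120) *
      (p : ℤ_[p]) ^ 2 * mhsTwo p 2 4 + 240 * (p : ℤ_[p]) ^ 2 * mhsTwo p 3 1 + (-200) *
      (p : ℤ_[p]) ^ 2 * mhsTwo p 3 3 + 180 * (p : ℤ_[p]) ^ 2 * mhsOne p 4 + (-240) *
      (p : ℤ_[p]) ^ 2 * mhsTwo p 4 2 + (-240) * (p : ℤ_[p]) ^ 2 * mhsTwo p 5 1 + 72 *
      (mhsOne p 2) ^ 2 + (-120) * mhsTwo p 2 2 + (-240) * mhsTwo p 3 1 + (-240) * mhsOne p 4 := by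
  have h1 := mhsOne_mul_mhsOne p 3 3
  obtain ⟨e2, h2⟩ := shuffleTwo_reflect p 1 (b := 3) (by norm_num) 1
  obtain ⟨e3, h3⟩ := shuffleTwo_reflect p 2 (b := 3) (by norm_num) 2
  obtain ⟨e4, h4⟩ := shuffleTwo_reflect p 2 (b := 4) (by norm_num) 1
  obtain ⟨e5, h5⟩ := dvd_mhsOne hp (a := 6) (by decide) (by norm_num)
  have h6 := mhsOne_mul_mhsOne p 3 1
  have h7 := mhsOne_mul_mhsOne p 1 3
  have h8 := mhsOne_mul_mhsOne p 4 2
  obtain ⟨e9, h9⟩ := dvd_mhsOne hp (a := 4) (by decide) (by norm_num)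
  obtain ⟨e10, h10⟩ := shuffleTwo_reflect p 3 (b := 3) (by norm_num) 1
  have h11 := mhsOne_mul_mhsOne p 2 2
  obtain ⟨e12, h12⟩ := shuffleTwo_reflect p 3 (b := 2) (by norm_num) 2
  obtain ⟨e13, h13⟩ := shuffleTwo_reflect p 3 (b := 1) (by norm_num) 3
  obtain ⟨e14, h14⟩ := shuffleTwo_reflect p 2 (b := 2) (by norm_num) 3
  obtain ⟨e15, h15⟩ := sq_dvd_mhsOne hp (a := 3) (by decide) (by norm_num)
  obtain ⟨e16, h16⟩ := sq_dvd_mhsOne hp (a := 1) (by decide) (by norm_num)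
  obtain ⟨e17, h17⟩ := dvd_mhsOne hp (a := 2) (by decide) (by norm_num)
  simp only [sum_range_succ, sum_range_zero, Nat.choose, shuffleTwo_succ_succ,
    shuffleTwo_zero_left, shuffleTwo_zero_right, Nat.reduceAdd, Nat.reduceSub, zero_add, add_zero]
    at h2 h3 h4 h10 h12 h13 h14
  push_cast at h2 h3 h4 h10 h12 h13 h14
  refine pow_dvd_of_pow_dvd_natCast_mul hp (D := 1) (k := 9) (by norm_num) ⟨?_, ?_⟩
  · exact 164 * e10 + 192 * e12 + 84 * e13 + (-60) * e14 + (-168) * e15 * e16 * (p : ℤ_[p]) + 80 *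
      e15 * (p : ℤ_[p]) * mhsOne p 3 + (-120) * e16 * (p : ℤ_[p]) * mhsOne p 3 + 156 * e17 *
      mhsOne p 4 + 120 * e2 + (-244) * e3 + (-276) * e4 + (-236) * e5 + 300 * e9
  · push_cast
    linear_combination ((-80) * (p : ℤ_[p]) ^ 2) * h1 + (120 * (p : ℤ_[p]) ^ 2) * h2 + ((-244) *
      (p : ℤ_[p])) * h3 + ((-276) * (p : ℤ_[p]) ^ 2) * h4 + ((-236) * (p : ℤ_[p]) ^ 2) * h5 +
      (168) * h6 + (120 * (p : ℤ_[p]) ^ 2) * h7 + ((-156) * (p : ℤ_[p]) ^ 2) * h8 + (300 *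
      (p : ℤ_[p]) ^ 2) * h9 + (164 * (p : ℤ_[p]) ^ 2) * h10 + (72) * h11 + (192 * (p : ℤ_[p])) *
      h12 + (84) * h13 + ((-60)) * h14 + (80 * (p : ℤ_[p]) ^ 2 * mhsOne p 3) * h15 + ((-168) *
      mhsOne p 3) * h16 + ((-120) * (p : ℤ_[p]) ^ 2 * mhsOne p 3) * h16 + (156 * (p : ℤ_[p]) ^ 2 *
      mhsOne p 4) * h17 + ((-168) * e16 * (p : ℤ_[p]) ^ 2) * h15

section

variable {p : ℕ} [Fact p.Prime]

/-! ### Transfer from the rational numbers to the `p`-adic integers -/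

/-- The numerator of x−y is its denominator times u−v, so nothing need be known about the
denominator. -/
theorem ratModEq_of_pow_dvd {n : ℕ} {x y : ℚ} {u v : ℤ_[p]} (hx : (x : ℚ_[p]) = u)
    (hy : (y : ℚ_[p]) = v) (h : (p : ℤ_[p]) ^ n ∣ u - v) : RatModEq (p ^ n) x y := by
  have hz : ((x - y : ℚ) : ℚ_[p]) = ((u - v : ℤ_[p]) : ℚ_[p]) := by
    push_cast; rw [hx, hy]
  have h1 : (((x - y).num : ℤ_[p])) = (((x - y).den : ℕ) : ℤ_[p]) * (u - v) := by
    have h2 : (((x - y).num : ℚ) : ℚ_[p]) = (((x - y).den : ℚ) : ℚ_[p]) * ((x - y : ℚ) : ℚ_[p]) := by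
      rw [← Rat.cast_mul, Rat.den_mul_eq_num]
    rw [hz] at h2
    apply PadicInt.ext
    push_cast at h2 ⊢
    exact h2
  unfold RatModEq
  push_cast
  rw [← PadicInt.pow_p_dvd_int_iff, h1]
  exact h.mul_left _

theorem cast_one_div_natCast {n : ℕ} (h : ¬ p ∣ n) :
    ((1 / (n : ℚ) : ℚ) : ℚ_[p]) = (unitInv p n : ℚ_[p]) := by
  have h1 := congrArg (fun x : ℤ_[p] => (x : ℚ_[p])) (mul_unitInv h)
  simp only [PadicInt.coe_mul, PadicInt.coe_natCast, PadicInt.coe_one] at h1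
  push_cast
  rw [one_div]
  exact inv_eq_of_mul_eq_one_right h1

theorem cast_multipleHarmonicSum_two (a b : ℕ) :
    ((multipleHarmonicSum (p - 1) [a, b] : ℚ) : ℚ_[p]) = (mhsTwo p a b : ℚ_[p]) := by
  rw [multipleHarmonicSum, mhsTwo, sum_sigma', Rat.cast_sum, PadicInt.coe_sum]
  have hp := (Fact.out : p.Prime).pos
  refine sum_nbij' (fun n : Fin 2 → ℕ => (⟨n 0, n 1⟩ : (_ : ℕ) × ℕ)) (fun x => ![x.1, x.2]) ?_ ?_ ?_ ?_ ?_
  · intro n hn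
    have hn' := mem_filter.1 hn
    have h0 := mem_Icc.1 (Fintype.mem_piFinset.1 hn'.1 (0 : Fin 2))
    have h1 := mem_Icc.1 (Fintype.mem_piFinset.1 hn'.1 (1 : Fin 2))
    have h01 : n 1 < n 0 := hn'.2 (0 : Fin 2) (1 : Fin 2) (Nat.zero_lt_one : (0 : ℕ) < 1)
    simp only [mem_sigma, mem_Ico]
    refine ⟨⟨h0.1, ?_⟩, h1.1, h01⟩
    have := h0.2
    omega
  · rintro ⟨x, y⟩ h
    simp only [mem_sigma, mem_Ico] at h
    refine mem_filter.2 ⟨Fintype.mem_piFinset.2 fun i => ?_, fun i j hij => ?_⟩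
    · change Fin 2 at i
      fin_cases i <;> (simp; omega)
    · change Fin 2 at i j
      fin_cases i <;> fin_cases j <;> simp at hij ⊢ <;> omega
  · intro n _
    funext i
    change Fin 2 at i
    fin_cases i <;> rfl
  · intro x _; rfl
  · intro n hn
    have hn' := mem_filter.1 hn
    have hd : ∀ i : Fin 2, ¬ p ∣ n i := fun i => by
      have h0 := mem_Icc.1 (Fintype.mem_piFinset.1 hn'.1 i)
      exact Nat.not_dvd_of_pos_of_lt h0.1 (by have := h0.2; omega)
    have e : ∏ i : Fin [a, b].length, (n i : ℚ) ^ [a, b].get i = (n 0 : ℚ) ^ a * (n 1 : ℚ) ^ b :=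
      Fin.prod_univ_two (fun i : Fin 2 => (n i : ℚ) ^ [a, b].get i)
    rw [e, one_div, mul_inv, ← inv_pow, ← inv_pow, ← one_div, ← one_div]
    rw [Rat.cast_mul, Rat.cast_pow, Rat.cast_pow, cast_one_div_natCast (hd 0),
      cast_one_div_natCast (hd 1)]
    push_cast
    rfl

theorem cast_multipleHarmonicSum_three (a b c : ℕ) :
    ((multipleHarmonicSum (p - 1) [a, b, c] : ℚ) : ℚ_[p]) = (mhsThree p a b c : ℚ_[p]) := by
  have h3 : mhsThree p a b c = ∑ n ∈ Ico 1 p, ∑ m ∈ Ico 1 n, ∑ l ∈ Ico 1 m,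
      unitInv p n ^ a * (unitInv p m ^ b * unitInv p l ^ c) := by
    simp only [mhsThree, mul_sum]
  rw [multipleHarmonicSum, h3, sum_sigma', sum_sigma', Rat.cast_sum, PadicInt.coe_sum]
  have hp := (Fact.out : p.Prime).pos
  refine sum_nbij' (fun n : Fin 3 → ℕ => (⟨⟨n 0, n 1⟩, n 2⟩ : (_ : (_ : ℕ) × ℕ) × ℕ))
    (fun x => ![x.1.1, x.1.2, x.2]) ?_ ?_ ?_ ?_ ?_
  · intro n hn
    have hn' := mem_filter.1 hn
    have h0 := mem_Icc.1 (Fintype.mem_piFinset.1 hn'.1 (0 : Fin 3))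
    have h1 := mem_Icc.1 (Fintype.mem_piFinset.1 hn'.1 (1 : Fin 3))
    have h2 := mem_Icc.1 (Fintype.mem_piFinset.1 hn'.1 (2 : Fin 3))
    have h01 : n 1 < n 0 := hn'.2 (0 : Fin 3) (1 : Fin 3) (Nat.zero_lt_one : (0 : ℕ) < 1)
    have h12 : n 2 < n 1 := hn'.2 (1 : Fin 3) (2 : Fin 3) (Nat.one_lt_two : (1 : ℕ) < 2)
    simp only [mem_sigma, mem_Ico]
    refine ⟨⟨⟨h0.1, ?_⟩, h1.1, h01⟩, h2.1, h12⟩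
    have := h0.2
    omega
  · rintro ⟨⟨x, y⟩, z⟩ h
    simp only [mem_sigma, mem_Ico] at h
    refine mem_filter.2 ⟨Fintype.mem_piFinset.2 fun i => ?_, fun i j hij => ?_⟩
    · change Fin 3 at i
      fin_cases i <;> simp <;> omega
    · change Fin 3 at i j
      fin_cases i <;> fin_cases j <;> simp at hij ⊢ <;> omega
  · intro n _
    funext i
    change Fin 3 at i
    fin_cases i <;> rfl
  · intro x _; rfl
  · intro n hn
    have hn' := mem_filter.1 hn
    have hd : ∀ i : Fin 3, ¬ p ∣ n i := fun i => by
      have h0 := mem_Icc.1 (Fintype.mem_piFinset.1 hn'.1 i)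
      exact Nat.not_dvd_of_pos_of_lt h0.1 (by have := h0.2; omega)
    have e : ∏ i : Fin [a, b, c].length, (n i : ℚ) ^ [a, b, c].get i
        = (n 0 : ℚ) ^ a * (n 1 : ℚ) ^ b * (n 2 : ℚ) ^ c :=
      Fin.prod_univ_three (fun i : Fin 3 => (n i : ℚ) ^ [a, b, c].get i)
    rw [e, one_div, mul_inv, mul_inv, ← inv_pow, ← inv_pow, ← inv_pow, ← one_div, ← one_div,
      ← one_div]
    rw [Rat.cast_mul, Rat.cast_mul, Rat.cast_pow, Rat.cast_pow, Rat.cast_pow,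
      cast_one_div_natCast (hd 0), cast_one_div_natCast (hd 1), cast_one_div_natCast (hd 2)]
    push_cast
    rw [mul_assoc]

/-- The power series `∑_{p ∤ n} X ^ n / n`. -/
noncomputable def unitLog (p : ℕ) [Fact p.Prime] : PowerSeries ℤ_[p] := PowerSeries.mk (unitInv p)

/-- Indices equal to 0 or divisible by p have zero coefficient in L, so the tuples of sum p^r that
contribute are exactly those of the curious sum. -/
theorem cast_curiousSum (r k : ℕ) :
    ((curiousSum r k p : ℚ) : ℚ_[p]) = ((PowerSeries.coeff (p ^ r) (unitLog p ^ k) : ℤ_[p]) : ℚ_[p]) := by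
  have e : unitLog p ^ k = ∏ _i : Fin k, unitLog p := by simp
  rw [e, PowerSeries.coeff_prod, curiousSum, Rat.cast_sum]
  simp only [unitLog, PowerSeries.coeff_mk]
  rw [← sum_filter_of_ne (p := fun l : Fin k →₀ ℕ => ∀ i, ¬ p ∣ l i), PadicInt.coe_sum]
  · refine sum_nbij' (fun n => Finsupp.equivFunOnFinite.symm n) (fun l => l) ?_ ?_ ?_ ?_ ?_
    · intro n hn
      simp only [mem_filter, Fintype.mem_piFinset, mem_Icc] at hn
      simp only [mem_filter, mem_finsuppAntidiag, subset_univ, and_true]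
      refine ⟨hn.2.1, fun i hi => hn.2.2 (hi.trans (dvd_prod_of_mem n (mem_univ i)))⟩
    · intro l hl
      simp only [mem_filter, mem_finsuppAntidiag, subset_univ, and_true] at hl
      simp only [mem_filter, Fintype.mem_piFinset, mem_Icc]
      refine ⟨fun i => ⟨?_, ?_⟩, hl.1, ?_⟩
      · rcases Nat.eq_zero_or_pos (l i) with h | h
        · exact absurd (h ▸ dvd_zero p) (hl.2 i)
        · exact h
      · rw [← hl.1]
        exact single_le_sum (f := fun i => l i) (fun _ _ => Nat.zero_le _) (mem_univ i)
      · rw [(Nat.Prime.prime Fact.out).dvd_finsetProd_iff]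
        rintro ⟨i, _, hi⟩
        exact hl.2 i hi
    · intro n _; rfl
    · intro l _; simp
    · intro n hn
      simp only [mem_filter, Fintype.mem_piFinset, mem_Icc] at hn
      have hd : ∀ i, ¬ p ∣ n i := fun i hi => hn.2.2 (hi.trans (dvd_prod_of_mem n (mem_univ i)))
      rw [one_div, ← prod_inv_distrib, Rat.cast_prod]
      have : ∀ s : Finset (Fin k), ((∏ i ∈ s, unitInv p (n i) : ℤ_[p]) : ℚ_[p])
          = ∏ i ∈ s, (unitInv p (n i) : ℚ_[p]) := fun s => map_prod PadicInt.Coe.ringHom _ _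
      simp only [Finsupp.equivFunOnFinite_symm_apply_apply]
      rw [this]
      refine prod_congr rfl fun i _ => ?_
      rw [← cast_one_div_natCast (hd i), one_div]
  · intro l _ hne i hi
    exact hne (prod_eq_zero (mem_univ i) (unitInv_of_dvd hi))

end

section

variable {p : ℕ} [Fact p.Prime]

/-! ### Sums of integer-valued polynomials over an interval of length a power of `p` -/

/-- The functions `n ↦ ∑_{j ≤ d} c_j (n choose j)` with `c_j ∈ ℤ_[p]`. -/
noncomputable def binSpan (p : ℕ) [Fact p.Prime] (d : ℕ) : Submodule ℤ_[p] (ℕ → ℤ_[p]) :=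
  Submodule.span ℤ_[p] {f | ∃ j ≤ d, f = fun n => (n.choose j : ℤ_[p])}

theorem choose_mem_binSpan {j d : ℕ} (h : j ≤ d) : (fun n => (n.choose j : ℤ_[p])) ∈ binSpan p d :=
  Submodule.subset_span ⟨j, h, rfl⟩

theorem binSpan_mono {d e : ℕ} (h : d ≤ e) : binSpan p d ≤ binSpan p e :=
  Submodule.span_mono fun _ ⟨j, hj, hf⟩ => ⟨j, hj.trans h, hf⟩

theorem const_mem_binSpan (c : ℤ_[p]) (d : ℕ) : (fun _ => c) ∈ binSpan p d := by
  have h := (binSpan p d).smul_mem c (choose_mem_binSpan (p := p) (Nat.zero_le d))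
  convert h using 1
  funext n
  simp

theorem natCast_mul_mem_binSpan {d : ℕ} {f : ℕ → ℤ_[p]} (hf : f ∈ binSpan p d) :
    (fun n : ℕ => (n : ℤ_[p]) * f n) ∈ binSpan p (d + 1) := by
  induction hf using Submodule.span_induction with
  | mem f hf =>
    obtain ⟨j, hj, rfl⟩ := hf
    have h := (binSpan p (d + 1)).add_mem
      ((binSpan p (d + 1)).smul_mem ((j + 1 : ℕ) : ℤ_[p]) (choose_mem_binSpan (p := p)
        (Nat.succ_le_succ hj)))
      ((binSpan p (d + 1)).smul_mem (j : ℤ_[p]) (choose_mem_binSpan (p := p)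
        (hj.trans (Nat.le_succ d))))
    convert h using 1
    funext n
    have e : n * n.choose j = (j + 1) * n.choose (j + 1) + j * n.choose j := by
      have h1 := Nat.choose_succ_right_eq n j
      rcases Nat.lt_or_ge n j with hlt | hge
      · rw [Nat.choose_eq_zero_of_lt hlt, Nat.choose_eq_zero_of_lt (by omega)]; simp
      · obtain ⟨t, rfl⟩ := Nat.exists_eq_add_of_le hge
        rw [Nat.add_sub_cancel_left] at h1
        linarith
    simp only [Pi.add_apply, Pi.smul_apply, smul_eq_mul]
    exact_mod_cast e
  | zero => simpa using const_mem_binSpan (0 : ℤ_[p]) (d + 1)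
  | add f g _ _ hf hg =>
    convert (binSpan p (d + 1)).add_mem hf hg using 1
    funext n; simp [mul_add]
  | smul c f _ hf =>
    convert (binSpan p (d + 1)).smul_mem c hf using 1
    funext n; simp [mul_left_comm]

theorem pow_mul_mem_binSpan {d : ℕ} {f : ℕ → ℤ_[p]} (hf : f ∈ binSpan p d) (s : ℕ) :
    (fun n : ℕ => (n : ℤ_[p]) ^ s * f n) ∈ binSpan p (d + s) := by
  induction s with
  | zero => simpa using hf
  | succ s ih =>
    have h := natCast_mul_mem_binSpan ih
    simp only [← mul_assoc, ← pow_succ'] at h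
    exact h

theorem pow_mem_binSpan (s : ℕ) : (fun n : ℕ => (n : ℤ_[p]) ^ s) ∈ binSpan p s := by
  simpa using pow_mul_mem_binSpan (const_mem_binSpan (1 : ℤ_[p]) 0) s

theorem sum_choose_range (j n : ℕ) : ∑ v ∈ range n, v.choose j = n.choose (j + 1) := by
  induction n with
  | zero => simp
  | succ n ih => rw [sum_range_succ, ih, Nat.choose_succ_succ, add_comm]

theorem sum_range_mem_binSpan {d : ℕ} {f : ℕ → ℤ_[p]} (hf : f ∈ binSpan p d) :
    (fun n => ∑ v ∈ range n, f v) ∈ binSpan p (d + 1) := by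
  induction hf using Submodule.span_induction with
  | mem f hf =>
    obtain ⟨j, hj, rfl⟩ := hf
    convert choose_mem_binSpan (p := p) (Nat.succ_le_succ hj) using 1
    funext n
    rw [Nat.succ_eq_add_one, ← sum_choose_range j n, Nat.cast_sum]
  | zero => simpa using const_mem_binSpan (0 : ℤ_[p]) (d + 1)
  | add f g _ _ hf hg =>
    convert (binSpan p (d + 1)).add_mem hf hg using 1
    funext n; simp [sum_add_distrib]
  | smul c f _ hf =>
    convert (binSpan p (d + 1)).smul_mem c hf using 1
    funext n; simp [mul_sum]

/-- On a basis element the sum is the binomial coefficient of p^k over j+1, and (j+1) times it is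
p^k times an integer, with j+1 prime to p. Working in the binomial basis makes the class stable
under partial summation as well, which handles iterated power sums. -/
theorem pow_dvd_sum_of_mem_binSpan {d : ℕ} {f : ℕ → ℤ_[p]} (hf : f ∈ binSpan p d) (hd : d + 1 < p)
    (k : ℕ) : ((p ^ k : ℕ) : ℤ_[p]) ∣ ∑ v ∈ range (p ^ k), f v := by
  induction hf using Submodule.span_induction with
  | mem f hf =>
    obtain ⟨j, hj, rfl⟩ := hf
    have e : (j + 1) * (p ^ k).choose (j + 1) = p ^ k * (p ^ k - 1).choose j := by
      obtain ⟨t, ht⟩ : ∃ t, p ^ k = t + 1 :=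
        ⟨p ^ k - 1, (Nat.sub_add_cancel (Nat.pos_of_ne_zero
          (pow_ne_zero k (Fact.out : p.Prime).ne_zero))).symm⟩
      rw [ht, Nat.add_sub_cancel, Nat.add_one_mul_choose_eq, mul_comm]
    have hco : Nat.Coprime (p ^ k) (j + 1) :=
      Nat.Coprime.pow_left k ((Nat.Prime.coprime_iff_not_dvd Fact.out).2
        (Nat.not_dvd_of_pos_of_lt (Nat.succ_pos j) (by omega)))
    have h : p ^ k ∣ (p ^ k).choose (j + 1) := hco.dvd_of_dvd_mul_left (Dvd.intro _ e.symm)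
    have h2 := natCast_dvd_natCast_padicInt (p := p) h
    rwa [← sum_choose_range, Nat.cast_sum] at h2
  | zero => simp
  | add f g _ _ hf hg => simpa [sum_add_distrib] using dvd_add hf hg
  | smul c f _ hf => simpa [← mul_sum] using hf.mul_left c

/-- The power sum `∑_{u < M} u ^ s`. -/
noncomputable def powSum (p : ℕ) [Fact p.Prime] (M s : ℕ) : ℤ_[p] := ∑ u ∈ range M, (u : ℤ_[p]) ^ s

/-- The double power sum `∑_{v < u < M} v ^ s u ^ t`. -/
noncomputable def powSumTwo (p : ℕ) [Fact p.Prime] (M s t : ℕ) : ℤ_[p] :=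
  ∑ u ∈ range M, (u : ℤ_[p]) ^ t * ∑ v ∈ range u, (v : ℤ_[p]) ^ s

theorem dvd_powSum {s : ℕ} (hs : s + 1 < p) (k : ℕ) :
    ((p ^ k : ℕ) : ℤ_[p]) ∣ powSum p (p ^ k) s :=
  pow_dvd_sum_of_mem_binSpan (pow_mem_binSpan s) hs k

theorem dvd_powSumTwo {s t : ℕ} (hs : s + t + 2 < p) (k : ℕ) :
    ((p ^ k : ℕ) : ℤ_[p]) ∣ powSumTwo p (p ^ k) s t :=
  pow_dvd_sum_of_mem_binSpan (pow_mul_mem_binSpan (sum_range_mem_binSpan (pow_mem_binSpan s)) t)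
    (by omega) k

theorem powSum_zero (M : ℕ) : powSum p M 0 = M := by simp [powSum]

theorem powSum_one (M : ℕ) : 2 * powSum p M 1 = M * (M - 1) := by
  induction M with
  | zero => simp [powSum]
  | succ M ih =>
    simp only [powSum, sum_range_succ] at ih ⊢
    push_cast
    linear_combination ih

theorem powSum_two (M : ℕ) : 6 * powSum p M 2 = M * ((M - 1) * (2 * M - 1)) := by
  induction M with
  | zero => simp [powSum]
  | succ M ih =>
    simp only [powSum, sum_range_succ] at ih ⊢
    push_cast
    linear_combination ih

theorem powSum_three (M : ℕ) : 4 * powSum p M 3 = M * (M * (M - 1) ^ 2) := by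
  induction M with
  | zero => simp [powSum]
  | succ M ih =>
    simp only [powSum, sum_range_succ] at ih ⊢
    push_cast
    linear_combination ih

theorem powSum_four (M : ℕ) :
    30 * powSum p M 4 = M * ((M - 1) * (2 * M - 1) * (3 * M ^ 2 - 3 * M - 1)) := by
  induction M with
  | zero => simp [powSum]
  | succ M ih =>
    simp only [powSum, sum_range_succ] at ih ⊢
    push_cast
    linear_combination ih

theorem powSum_five (M : ℕ) :
    12 * powSum p M 5 = M * (M * (M - 1) ^ 2 * (2 * M ^ 2 - 2 * M - 1)) := by
  induction M with
  | zero => simp [powSum]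
  | succ M ih =>
    simp only [powSum, sum_range_succ] at ih ⊢
    push_cast
    linear_combination ih

/-! ### Elementary symmetric functions and residue classes -/

theorem two_mul_sum_range_pairs {R : Type*} [CommRing R] (x : ℕ → R) (n : ℕ) :
    2 * ∑ m ∈ range n, x m * ∑ l ∈ range m, x l
      = (∑ m ∈ range n, x m) ^ 2 - ∑ m ∈ range n, x m ^ 2 := by
  induction n with
  | zero => simp
  | succ n ih => simp only [sum_range_succ]; linear_combination ih

theorem six_mul_sum_range_triples {R : Type*} [CommRing R] (x : ℕ → R) (n : ℕ) :
    6 * ∑ m ∈ range n, x m * ∑ l ∈ range m, x l * ∑ k ∈ range l, x k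
      = (∑ m ∈ range n, x m) ^ 3 - 3 * (∑ m ∈ range n, x m) * ∑ m ∈ range n, x m ^ 2
        + 2 * ∑ m ∈ range n, x m ^ 3 := by
  induction n with
  | zero => simp
  | succ n ih =>
    have h := two_mul_sum_range_pairs x n
    simp only [sum_range_succ]
    linear_combination ih + 3 * x n * h

theorem sum_range_mul_eq {A : Type*} [AddCommMonoid A] (p M : ℕ) (g : ℕ → A) :
    ∑ n ∈ range (p * M), g n = ∑ u ∈ range M, ∑ i ∈ range p, g (p * u + i) := by
  induction M with
  | zero => simp
  | succ M ih => rw [Nat.mul_succ, sum_range_add, ih, sum_range_succ]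

/-- The indicator of divisibility by `p`. -/
noncomputable def dvdInd (p : ℕ) [Fact p.Prime] (n : ℕ) : ℤ_[p] := if p ∣ n then 1 else 0

theorem sum_range_dvdInd_mul {i : ℕ} (hi : i < p) (u : ℕ) (g : ℕ → ℤ_[p]) :
    ∑ l ∈ range (p * u + i), dvdInd p (p * u + i - l) * g l = ∑ v ∈ range u, g (p * v + i) := by
  have key : ∀ v j, j < p → p * v + j < p * u + i →
      dvdInd p (p * u + i - (p * v + j)) = if j = i then 1 else 0 := by
    intro v j hj hlt
    unfold dvdInd
    congr 1
    rw [← Nat.modEq_iff_dvd' hlt.le, eq_iff_iff]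
    simp only [Nat.ModEq, Nat.mul_add_mod, Nat.mod_eq_of_lt hj, Nat.mod_eq_of_lt hi]
  rw [sum_range_add, sum_range_mul_eq]
  have h2 : ∑ j ∈ range i, dvdInd p (p * u + i - (p * u + j)) * g (p * u + j) = 0 := by
    refine sum_eq_zero fun j hj => ?_
    rw [mem_range] at hj
    rw [key u j (hj.trans hi) (by omega), if_neg hj.ne, zero_mul]
  rw [h2, add_zero]
  refine sum_congr rfl fun v hv => ?_
  rw [mem_range] at hv
  have hvu : p * v + p ≤ p * u := by
    rw [← Nat.mul_succ]; exact Nat.mul_le_mul_left p hv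
  rw [sum_eq_single i]
  · rw [key v i hi (by omega), if_pos rfl, one_mul]
  · intro j hj hji
    rw [key v j (mem_range.1 hj) (by have := mem_range.1 hj; omega), if_neg hji, zero_mul]
  · intro h; exact absurd (mem_range.2 hi) h

/-- If p divides D and m−D then it divides m, so one factor always vanishes. -/
theorem dvdInd_mul_unitInv {m D : ℕ} (h : D ≤ m) (hD : p ∣ D) :
    dvdInd p (m - D) * unitInv p m = 0 := by
  unfold dvdInd
  split_ifs with h1
  · rw [unitInv_of_dvd ((Nat.dvd_sub_iff_left h hD).1 h1), mul_zero]
  · rw [zero_mul]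

/-! ### Coefficients of the powers of the truncated logarithm -/

/-- Compare coefficients in (L^{j+1})' = (j+1) L^j L', where X·L' = ∑_{p∤n} X^n. -/
theorem natCast_mul_coeff_unitLog_pow (j m : ℕ) :
    (m : ℤ_[p]) * PowerSeries.coeff m (unitLog p ^ (j + 1))
      = (j + 1 : ℕ) * ∑ l ∈ range m, (1 - dvdInd p (m - l)) * PowerSeries.coeff l (unitLog p ^ j) := by
  cases m with
  | zero => simp
  | succ n =>
    have h1 : PowerSeries.coeff n (PowerSeries.derivative ℤ_[p] (unitLog p ^ (j + 1)))
        = (j + 1 : ℕ) * ∑ l ∈ range (n + 1),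
          (1 - dvdInd p (n + 1 - l)) * PowerSeries.coeff l (unitLog p ^ j) := by
      rw [PowerSeries.derivative_pow, Nat.add_sub_cancel, mul_assoc, ← map_natCast (PowerSeries.C),
        PowerSeries.coeff_C_mul, PowerSeries.coeff_mul, Nat.sum_antidiagonal_eq_sum_range_succ_mk]
      congr 1
      refine sum_congr rfl fun l hl => ?_
      rw [mem_range] at hl
      have e : n - l + 1 = n + 1 - l := by omega
      rw [PowerSeries.coeff_derivative, unitLog, PowerSeries.coeff_mk, ← unitLog, mul_comm]
      congr 1
      have e2 : ((n - l : ℕ) : ℤ_[p]) + 1 = ((n + 1 - l : ℕ) : ℤ_[p]) := by rw [← e]; push_cast; rfl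
      rw [e2, e]
      unfold dvdInd
      split_ifs with h
      · rw [unitInv_of_dvd h]; simp
      · rw [mul_comm, mul_unitInv h]; simp
    rw [← h1, PowerSeries.coeff_derivative, mul_comm]
    push_cast; rfl

theorem coeff_unitLog_pow_of_not_dvd {m : ℕ} (hm : ¬ p ∣ m) (j : ℕ) :
    PowerSeries.coeff m (unitLog p ^ (j + 1))
      = (j + 1 : ℕ) * (unitInv p m *
        ∑ l ∈ range m, (1 - dvdInd p (m - l)) * PowerSeries.coeff l (unitLog p ^ j)) := by
  have h := natCast_mul_coeff_unitLog_pow (p := p) j m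
  have h2 := mul_unitInv hm
  linear_combination unitInv p m * h - PowerSeries.coeff m (unitLog p ^ (j + 1)) * h2

/-- Two steps of the recursion. Because p ∣ q, the outer condition p ∤ q−m means p ∤ m and is
absorbed by the factor 1/m. -/
theorem natCast_mul_coeff_unitLog_pow_of_dvd {q : ℕ} (hq : p ∣ q) (j : ℕ) :
    (q : ℤ_[p]) * PowerSeries.coeff q (unitLog p ^ (j + 2))
      = (j + 2 : ℕ) * (j + 1 : ℕ) * ∑ m ∈ range q, unitInv p m *
        ∑ l ∈ range m, (1 - dvdInd p (m - l)) * PowerSeries.coeff l (unitLog p ^ j) := by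
  rw [natCast_mul_coeff_unitLog_pow, mul_assoc, mul_sum _ _ (((j + 1 : ℕ) : ℤ_[p]))]
  congr 1
  refine sum_congr rfl fun m hm => ?_
  rw [mem_range] at hm
  by_cases h : p ∣ m
  · rw [unitInv_of_dvd h, dvdInd, if_pos (Nat.dvd_sub hq h)]; simp
  · rw [coeff_unitLog_pow_of_not_dvd h, dvdInd, if_neg fun hd => h ((Nat.dvd_sub_iff_right hm.le hq).1 hd)]
    ring

/-- `q C_{r,3} = 3 (A² - ∑ A_i²)` with `A_i` the sum over the residue class of `i`. -/
theorem natCast_mul_coeff_unitLog_cube (M : ℕ) :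
    ((p * M : ℕ) : ℤ_[p]) * PowerSeries.coeff (p * M) (unitLog p ^ 3)
      = 3 * ((∑ n ∈ range (p * M), unitInv p n) ^ 2
        - ∑ i ∈ range p, (∑ u ∈ range M, unitInv p (p * u + i)) ^ 2) := by
  rw [natCast_mul_coeff_unitLog_pow_of_dvd (dvd_mul_right p M) 1]
  -- All pairs minus the pairs in a common residue class. Symmetrising turns each into half of a
  -- square minus a sum of squares, and the sums of squares agree and cancel.
  have h1 : ∑ m ∈ range (p * M), unitInv p m *
      ∑ l ∈ range m, (1 - dvdInd p (m - l)) * PowerSeries.coeff l (unitLog p ^ 1)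
      = ∑ m ∈ range (p * M), unitInv p m * ∑ l ∈ range m, unitInv p l
        - ∑ i ∈ range p, ∑ u ∈ range M, unitInv p (p * u + i) * ∑ v ∈ range u, unitInv p (p * v + i) := by
    have e : ∑ i ∈ range p, ∑ u ∈ range M, unitInv p (p * u + i) * ∑ v ∈ range u, unitInv p (p * v + i)
        = ∑ m ∈ range (p * M), unitInv p m * ∑ l ∈ range m, dvdInd p (m - l) * unitInv p l := by
      rw [sum_range_mul_eq, sum_comm]
      refine sum_congr rfl fun u _ => sum_congr rfl fun i hi => ?_
      rw [sum_range_dvdInd_mul (mem_range.1 hi)]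
    rw [e, ← sum_sub_distrib]
    refine sum_congr rfl fun m _ => ?_
    rw [← mul_sub, ← sum_sub_distrib]
    congr 1
    refine sum_congr rfl fun l _ => ?_
    rw [pow_one, unitLog, PowerSeries.coeff_mk]; ring
  rw [h1]
  have h2 := two_mul_sum_range_pairs (unitInv p) (p * M)
  have h3 : ∑ i ∈ range p, 2 * ∑ u ∈ range M, unitInv p (p * u + i) * ∑ v ∈ range u, unitInv p (p * v + i)
      = ∑ i ∈ range p, ((∑ u ∈ range M, unitInv p (p * u + i)) ^ 2
        - ∑ u ∈ range M, unitInv p (p * u + i) ^ 2) :=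
    sum_congr rfl fun i _ => two_mul_sum_range_pairs (fun u => unitInv p (p * u + i)) M
  have h4 := sum_range_mul_eq p M fun n => unitInv p n ^ 2
  rw [sum_comm] at h4
  rw [← mul_sum, sum_sub_distrib] at h3
  push_cast
  linear_combination 3 * h2 - 3 * h3 - 3 * h4

end

section

variable {p : ℕ} [Fact p.Prime]

/-! ### Power sums over residue classes -/

theorem sum_range_eq_sum_Ico_one {A : Type*} [AddCommMonoid A] {g : ℕ → A} (h0 : g 0 = 0) (n : ℕ) :
    ∑ i ∈ range n, g i = ∑ i ∈ Ico 1 n, g i := by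
  cases n with
  | zero => simp
  | succ n => rw [range_eq_Ico, sum_eq_sum_Ico_succ_bot (Nat.succ_pos n), h0, zero_add]

theorem sum_range_unitInv_pow {a : ℕ} (ha : 0 < a) (n : ℕ) :
    ∑ i ∈ range n, unitInv p i ^ a = ∑ i ∈ Ico 1 n, unitInv p i ^ a :=
  sum_range_eq_sum_Ico_one (by rw [unitInv_zero, zero_pow ha.ne']) n

theorem pow_dvd_sum_residue_sub {a : ℕ} (ha : 0 < a) (J N i : ℕ) :
    (p : ℤ_[p]) ^ J ∣ ∑ u ∈ range N, unitInv p (p * u + i) ^ a - ∑ s ∈ range J,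
      ((a - 1 + s).choose s : ℤ_[p]) * (-(p : ℤ_[p])) ^ s * powSum p N s * unitInv p i ^ (a + s) := by
  have h : ∑ s ∈ range J,
      ((a - 1 + s).choose s : ℤ_[p]) * (-(p : ℤ_[p])) ^ s * powSum p N s * unitInv p i ^ (a + s)
      = ∑ u ∈ range N, ∑ s ∈ range J, ((a - 1 + s).choose s : ℤ_[p])
        * (-((p * u : ℕ) : ℤ_[p])) ^ s * unitInv p i ^ (a + s) := by
    rw [sum_comm]
    refine sum_congr rfl fun s _ => ?_
    rw [powSum, mul_sum, sum_mul]
    refine sum_congr rfl fun u _ => ?_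
    push_cast
    rw [← neg_mul, mul_pow]; ring
  rw [h]
  refine dvd_sum_sub_sum fun u _ => ?_
  refine dvd_trans ?_ (pow_dvd_unitInv_add_pow_sub (dvd_mul_right p u) i ha J)
  push_cast
  rw [mul_pow]
  exact dvd_mul_right _ _

/-- A term with s ≥ n carries p^s and a power sum divisible by p^k. Since k ≤ 2, expanding two terms
further already reaches the required precision. -/
theorem pow_mul_pow_dvd_sum_residue_sub {k n a : ℕ} (hk : k ≤ 2) (ha : 0 < a) (hn : n + 4 < p)
    (i : ℕ) :
    (p : ℤ_[p]) ^ k * (p : ℤ_[p]) ^ n ∣ ∑ u ∈ range (p ^ k), unitInv p (p * u + i) ^ a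
      - ∑ s ∈ range n, ((a - 1 + s).choose s : ℤ_[p]) * (-(p : ℤ_[p])) ^ s * powSum p (p ^ k) s
        * unitInv p i ^ (a + s) := by
  have h := pow_dvd_sum_residue_sub (p := p) ha (n + 2) (p ^ k) i
  rw [sum_range_succ, sum_range_succ] at h
  have h1 : (p : ℤ_[p]) ^ k * (p : ℤ_[p]) ^ n ∣ (p : ℤ_[p]) ^ (n + 2) := by
    rw [← pow_add]; exact pow_dvd_pow _ (by omega)
  have h2 : ∀ s, n ≤ s → s + 1 < p → (p : ℤ_[p]) ^ k * (p : ℤ_[p]) ^ n ∣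
      ((a - 1 + s).choose s : ℤ_[p]) * (-(p : ℤ_[p])) ^ s * powSum p (p ^ k) s
        * unitInv p i ^ (a + s) := by
    intro s hs hsp
    have h3 := dvd_powSum (p := p) hsp k
    push_cast at h3
    rw [neg_pow]
    have h4 : (p : ℤ_[p]) ^ k * (p : ℤ_[p]) ^ n ∣ powSum p (p ^ k) s * (p : ℤ_[p]) ^ s :=
      mul_dvd_mul h3 (pow_dvd_pow _ hs)
    have e : ((a - 1 + s).choose s : ℤ_[p]) * ((-1) ^ s * (p : ℤ_[p]) ^ s) * powSum p (p ^ k) s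
        * unitInv p i ^ (a + s) = powSum p (p ^ k) s * (p : ℤ_[p]) ^ s
          * (((a - 1 + s).choose s : ℤ_[p]) * (-1) ^ s * unitInv p i ^ (a + s)) := by ring
    rw [e]
    exact h4.mul_right _
  have h5 := dvd_add (dvd_add (h1.trans h) (h2 n le_rfl (by omega)))
    (h2 (n + 1) (Nat.le_succ n) (by omega))
  convert h5 using 1
  ring

/-- `∑ 1 / n ^ a` over `n < q` prime to `p`. -/
noncomputable def unitPowSum (p : ℕ) [Fact p.Prime] (q a : ℕ) : ℤ_[p] :=
  ∑ n ∈ range q, unitInv p n ^ a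

theorem unitPowSum_mul (M a : ℕ) :
    unitPowSum p (p * M) a = ∑ i ∈ range p, ∑ u ∈ range M, unitInv p (p * u + i) ^ a := by
  rw [unitPowSum, sum_range_mul_eq, sum_comm]

theorem pow_dvd_unitPowSum_sub {a : ℕ} (ha : 0 < a) (J N : ℕ) :
    (p : ℤ_[p]) ^ J ∣ unitPowSum p (p * N) a - ∑ s ∈ range J,
      ((a - 1 + s).choose s : ℤ_[p]) * (-(p : ℤ_[p])) ^ s * powSum p N s * mhsOne p (a + s) := by
  have e : ∑ s ∈ range J,
      ((a - 1 + s).choose s : ℤ_[p]) * (-(p : ℤ_[p])) ^ s * powSum p N s * mhsOne p (a + s)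
      = ∑ i ∈ range p, ∑ s ∈ range J, ((a - 1 + s).choose s : ℤ_[p]) * (-(p : ℤ_[p])) ^ s
        * powSum p N s * unitInv p i ^ (a + s) := by
    rw [sum_comm]
    refine sum_congr rfl fun s _ => ?_
    rw [← mul_sum, sum_range_unitInv_pow (by omega), mhsOne]
  rw [e, unitPowSum_mul]
  exact dvd_sum_sub_sum fun i _ => pow_dvd_sum_residue_sub ha J N i

theorem pow_mul_pow_dvd_unitPowSum_sub {k n a : ℕ} (hk : k ≤ 2) (ha : 0 < a) (hn : n + 4 < p) :
    (p : ℤ_[p]) ^ k * (p : ℤ_[p]) ^ n ∣ unitPowSum p (p * p ^ k) a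
      - ∑ s ∈ range n, ((a - 1 + s).choose s : ℤ_[p]) * (-(p : ℤ_[p])) ^ s * powSum p (p ^ k) s
        * mhsOne p (a + s) := by
  have e : ∑ s ∈ range n, ((a - 1 + s).choose s : ℤ_[p]) * (-(p : ℤ_[p])) ^ s * powSum p (p ^ k) s
      * mhsOne p (a + s)
      = ∑ i ∈ range p, ∑ s ∈ range n, ((a - 1 + s).choose s : ℤ_[p]) * (-(p : ℤ_[p])) ^ s
        * powSum p (p ^ k) s * unitInv p i ^ (a + s) := by
    rw [sum_comm]
    refine sum_congr rfl fun s _ => ?_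
    rw [← mul_sum, sum_range_unitInv_pow (by omega), mhsOne]
  rw [e, unitPowSum_mul]
  exact dvd_sum_sub_sum fun i _ => pow_mul_pow_dvd_sum_residue_sub hk ha hn i

theorem unitPowSum_reflect {q : ℕ} (hq : p ∣ q) {a : ℕ} (ha : 0 < a) (J : ℕ) :
    (q : ℤ_[p]) ^ J ∣ unitPowSum p q a - (-1) ^ a * ∑ j ∈ range J,
      ((a - 1 + j).choose j : ℤ_[p]) * (q : ℤ_[p]) ^ j * unitPowSum p q (a + j) := by
  have h := sum_unitInv_pow_reflect p hq ha J
  have e : ∀ j, ∑ n ∈ Ico 1 q, unitInv p n ^ (a + j) = unitPowSum p q (a + j) := fun j =>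
    (sum_range_unitInv_pow (by omega) q).symm
  simp only [e] at h
  rwa [← sum_range_unitInv_pow ha] at h

theorem dvd_unitPowSum (hp : 100 < p) {k a : ℕ} (hk : k ≤ 2) (ha : 0 < a) (ha2 : a < 50) :
    (p : ℤ_[p]) * (p : ℤ_[p]) ^ k ∣ unitPowSum p (p * p ^ k) a := by
  have h := pow_mul_pow_dvd_unitPowSum_sub (p := p) (k := k) (n := 1) hk ha (by omega)
  obtain ⟨e, he⟩ := dvd_mhsOne hp ha ha2
  obtain ⟨w, hw⟩ := h
  simp only [sum_range_succ, sum_range_zero, powSum_zero, Nat.choose_zero_right, add_zero, he] at hw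
  push_cast at hw
  exact ⟨w + e, by linear_combination hw⟩

theorem sq_dvd_unitPowSum_one (hp : 100 < p) {k : ℕ} (hk : k ≤ 2) :
    ((p : ℤ_[p]) * (p : ℤ_[p]) ^ k) ^ 2 ∣ unitPowSum p (p * p ^ k) 1 := by
  obtain ⟨w, hw⟩ := unitPowSum_reflect (p := p) (dvd_mul_right p (p ^ k)) one_pos 2
  obtain ⟨z, hz⟩ := dvd_unitPowSum hp hk (a := 2) (by norm_num) (by norm_num)
  simp only [sum_range_succ, sum_range_zero, Nat.choose, Nat.reduceAdd, Nat.reduceSub, hz] at hw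
  push_cast at hw
  have h2 : ((p : ℤ_[p]) * (p : ℤ_[p]) ^ k) ^ 2 ∣ 2 * unitPowSum p (p * p ^ k) 1 :=
    ⟨w - z, by linear_combination hw⟩
  have h3 : IsUnit (2 : ℤ_[p]) := by
    have := PadicInt.isUnit_natCast_of_not_dvd (p := p) (n := 2)
      (Nat.not_dvd_of_pos_of_lt (by norm_num) (by omega))
    exact_mod_cast this
  rwa [h3.dvd_mul_left] at h2

theorem sum_mul_sum_unitInv_pow (c d : ℕ → ℤ_[p]) {a : ℕ} (ha : 0 < a) (b m n : ℕ) :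
    ∑ i ∈ range p, (∑ s ∈ range m, c s * unitInv p i ^ (a + s))
        * (∑ t ∈ range n, d t * unitInv p i ^ (b + t))
      = ∑ s ∈ range m, ∑ t ∈ range n, c s * d t * mhsOne p (a + b + s + t) := by
  simp only [sum_mul_sum]
  rw [sum_comm]
  refine sum_congr rfl fun s _ => ?_
  rw [sum_comm]
  refine sum_congr rfl fun t _ => ?_
  rw [mhsOne, ← sum_range_unitInv_pow (by omega), mul_sum]
  refine sum_congr rfl fun i _ => ?_
  rw [show a + b + s + t = (a + s) + (b + t) by ring, pow_add]
  ring

/-! ### The cubic sum -/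

/-- Here q = p^{k+2}, A² is divisible by q⁴, and ∑A_i² has the factor p^{2(k+1)}. After division by
q the first drops out modulo p^6 and the second keeps the factor p^k. -/
theorem pow_dvd_coeff_unitLog_cube (hp : 100 < p) {k : ℕ} (hk : k < 2) {τ : ℕ → ℤ_[p]}
    (hτ : ∀ s < 6, powSum p (p ^ (k + 1)) s = (p : ℤ_[p]) ^ (k + 1) * τ s) :
    (p : ℤ_[p]) ^ 6 ∣ PowerSeries.coeff (p * p ^ (k + 1)) (unitLog p ^ 3)
      + 3 * (p : ℤ_[p]) ^ k * ∑ s ∈ range 6, ∑ t ∈ range 6,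
        (-(p : ℤ_[p])) ^ (s + t) * (τ s * τ t) * mhsOne p (s + t + 2) := by
  set P : ℤ_[p] := (p : ℤ_[p]) with hP
  have hP0 : P ≠ 0 := by rw [hP]; exact_mod_cast (Fact.out : p.Prime).ne_zero
  have h1 := natCast_mul_coeff_unitLog_cube (p := p) (p ^ (k + 1))
  obtain ⟨w, hw⟩ := sq_dvd_unitPowSum_one hp (k := k + 1) (by omega)
  simp only [unitPowSum, pow_one] at hw
  rw [hw] at h1
  have h2 : P ^ (2 * (k + 1)) * P ^ 6 ∣ ∑ i ∈ range p, (∑ u ∈ range (p ^ (k + 1)), unitInv p (p * u + i)) ^ 2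
      - ∑ i ∈ range p, (P ^ (k + 1) * ∑ s ∈ range 6, (-P) ^ s * τ s * unitInv p i ^ (1 + s)) ^ 2 := by
    refine dvd_sum_sub_sum fun i _ => ?_
    obtain ⟨e, he⟩ := pow_mul_pow_dvd_sum_residue_sub (p := p) (k := k + 1) (n := 6) (a := 1)
      (by omega) one_pos (by omega) i
    have e2 : ∑ s ∈ range 6, ((1 - 1 + s).choose s : ℤ_[p]) * (-(p : ℤ_[p])) ^ s
        * powSum p (p ^ (k + 1)) s * unitInv p i ^ (1 + s)
        = P ^ (k + 1) * ∑ s ∈ range 6, (-P) ^ s * τ s * unitInv p i ^ (1 + s) := by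
      rw [mul_sum]
      refine sum_congr rfl fun s hs => ?_
      rw [hτ s (mem_range.1 hs)]
      simp only [Nat.sub_self, zero_add, Nat.choose_self, Nat.cast_one]
      ring
    rw [e2] at he
    simp only [pow_one] at he
    set S := ∑ s ∈ range 6, (-P) ^ s * τ s * unitInv p i ^ (1 + s)
    set B := ∑ u ∈ range (p ^ (k + 1)), unitInv p (p * u + i)
    have he2 : B = P ^ (k + 1) * (S + P ^ 6 * e) := by linear_combination he
    rw [he2]
    exact ⟨2 * S * e + P ^ 6 * e ^ 2, by ring⟩
  have h3 : ∑ i ∈ range p, (P ^ (k + 1) * ∑ s ∈ range 6, (-P) ^ s * τ s * unitInv p i ^ (1 + s)) ^ 2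
      = P ^ (2 * (k + 1)) * ∑ s ∈ range 6, ∑ t ∈ range 6,
        (-P) ^ (s + t) * (τ s * τ t) * mhsOne p (s + t + 2) := by
    have e := sum_mul_sum_unitInv_pow (p := p) (fun s => (-P) ^ s * τ s) (fun s => (-P) ^ s * τ s)
      one_pos 1 6 6
    simp only [mul_pow, ← mul_sum]
    rw [← pow_mul, mul_comm (k + 1) 2]
    congr 1
    simp only [sq]
    rw [e]
    refine sum_congr rfl fun s _ => sum_congr rfl fun t _ => ?_
    rw [show 1 + 1 + s + t = s + t + 2 by ring, pow_add]
    ring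
  rw [h3] at h2
  obtain ⟨v, hv⟩ := h2
  set S := ∑ s ∈ range 6, ∑ t ∈ range 6, (-P) ^ (s + t) * (τ s * τ t) * mhsOne p (s + t + 2)
  refine ⟨3 * P ^ (3 * k) * w ^ 2 - 3 * P ^ k * v, ?_⟩
  have h4 : P ^ (k + 2) ≠ 0 := pow_ne_zero _ hP0
  refine mul_left_cancel₀ h4 ?_
  push_cast at h1
  rw [← hP] at h1
  linear_combination h1 - 3 * hv

end

section

variable {p : ℕ} [Fact p.Prime]

/-- The quotients `∑_{u < M} u ^ s / M` by `M = p ^ k`, for `s < 6`. -/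
theorem exists_powSum_quotient (hp : 100 < p) (k : ℕ) :
    ∃ τ : ℕ → ℤ_[p], (∀ s < 6, powSum p (p ^ k) s = (p : ℤ_[p]) ^ k * τ s) ∧
      τ 0 = 1 ∧ 2 * τ 1 = (p : ℤ_[p]) ^ k - 1 ∧
      6 * τ 2 = ((p : ℤ_[p]) ^ k - 1) * (2 * (p : ℤ_[p]) ^ k - 1) ∧
      4 * τ 3 = (p : ℤ_[p]) ^ k * ((p : ℤ_[p]) ^ k - 1) ^ 2 ∧
      30 * τ 4 = ((p : ℤ_[p]) ^ k - 1) * (2 * (p : ℤ_[p]) ^ k - 1)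
        * (3 * ((p : ℤ_[p]) ^ k) ^ 2 - 3 * (p : ℤ_[p]) ^ k - 1) ∧
      12 * τ 5 = (p : ℤ_[p]) ^ k * ((p : ℤ_[p]) ^ k - 1) ^ 2
        * (2 * ((p : ℤ_[p]) ^ k) ^ 2 - 2 * (p : ℤ_[p]) ^ k - 1) := by
  have h : ∀ s : ℕ, ∃ t : ℤ_[p], s < 6 → powSum p (p ^ k) s = (p : ℤ_[p]) ^ k * t := by
    intro s
    by_cases hs : s < 6
    · obtain ⟨t, ht⟩ := dvd_powSum (p := p) (s := s) (by omega) k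
      push_cast at ht
      exact ⟨t, fun _ => ht⟩
    · exact ⟨0, fun h => absurd h hs⟩
  choose τ hτ using h
  have hM : (p : ℤ_[p]) ^ k ≠ 0 :=
    pow_ne_zero k (by exact_mod_cast (Fact.out : p.Prime).ne_zero)
  have h0 := powSum_zero (p := p) (p ^ k)
  have h1 := powSum_one (p := p) (p ^ k)
  have h2 := powSum_two (p := p) (p ^ k)
  have h3 := powSum_three (p := p) (p ^ k)
  have h4 := powSum_four (p := p) (p ^ k)
  have h5 := powSum_five (p := p) (p ^ k)
  rw [hτ 0 (by norm_num)] at h0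
  rw [hτ 1 (by norm_num)] at h1
  rw [hτ 2 (by norm_num)] at h2
  rw [hτ 3 (by norm_num)] at h3
  rw [hτ 4 (by norm_num)] at h4
  rw [hτ 5 (by norm_num)] at h5
  push_cast at h0 h1 h2 h3 h4 h5
  refine ⟨τ, hτ, ?_, ?_, ?_, ?_, ?_, ?_⟩ <;> refine mul_left_cancel₀ hM ?_
  · linear_combination h0
  · linear_combination h1
  · linear_combination h2
  · linear_combination h3
  · linear_combination h4
  · linear_combination h5

theorem sixty_mul_sum_quotient {P M : ℤ_[p]} {τ : ℕ → ℤ_[p]} (h : ℕ → ℤ_[p])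
    (h0 : τ 0 = 1) (h1 : 2 * τ 1 = M - 1) (h2 : 6 * τ 2 = (M - 1) * (2 * M - 1))
    (h3 : 4 * τ 3 = M * (M - 1) ^ 2)
    (h4 : 30 * τ 4 = (M - 1) * (2 * M - 1) * (3 * M ^ 2 - 3 * M - 1))
    (h5 : 12 * τ 5 = M * (M - 1) ^ 2 * (2 * M ^ 2 - 2 * M - 1)) :
    60 * ∑ s ∈ range 6, P ^ s * τ s * h s
      = 60 * h 0 + P * (30 * (M - 1)) * h 1 + P ^ 2 * (10 * ((M - 1) * (2 * M - 1))) * h 2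
        + P ^ 3 * (15 * (M * (M - 1) ^ 2)) * h 3
        + P ^ 4 * (2 * ((M - 1) * (2 * M - 1) * (3 * M ^ 2 - 3 * M - 1))) * h 4
        + P ^ 5 * (5 * (M * (M - 1) ^ 2 * (2 * M ^ 2 - 2 * M - 1))) * h 5 := by
  simp only [sum_range_succ, sum_range_zero]
  linear_combination 60 * h 0 * h0 + 30 * P * h 1 * h1 + 10 * P ^ 2 * h 2 * h2
    + 15 * P ^ 3 * h 3 * h3 + 2 * P ^ 4 * h 4 * h4 + 5 * P ^ 5 * h 5 * h5

/-- The double sum is bilinear in τ, so the linear formula is applied in t and then in s; 3600 =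
60². -/
theorem mul_sum_sum_quotient {P M : ℤ_[p]} {τ : ℕ → ℤ_[p]} (h : ℕ → ℤ_[p])
    (h0 : τ 0 = 1) (h1 : 2 * τ 1 = M - 1) (h2 : 6 * τ 2 = (M - 1) * (2 * M - 1))
    (h3 : 4 * τ 3 = M * (M - 1) ^ 2)
    (h4 : 30 * τ 4 = (M - 1) * (2 * M - 1) * (3 * M ^ 2 - 3 * M - 1))
    (h5 : 12 * τ 5 = M * (M - 1) ^ 2 * (2 * M ^ 2 - 2 * M - 1)) :
    3600 * ∑ s ∈ range 6, ∑ t ∈ range 6, P ^ (s + t) * (τ s * τ t) * h (s + t + 2)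
      = (fun f : ℕ → ℤ_[p] => 60 * f 0 + P * (30 * (M - 1)) * f 1
        + P ^ 2 * (10 * ((M - 1) * (2 * M - 1))) * f 2
        + P ^ 3 * (15 * (M * (M - 1) ^ 2)) * f 3
        + P ^ 4 * (2 * ((M - 1) * (2 * M - 1) * (3 * M ^ 2 - 3 * M - 1))) * f 4
        + P ^ 5 * (5 * (M * (M - 1) ^ 2 * (2 * M ^ 2 - 2 * M - 1))) * f 5) fun s =>
          60 * h (s + 2) + P * (30 * (M - 1)) * h (s + 3)
        + P ^ 2 * (10 * ((M - 1) * (2 * M - 1))) * h (s + 4)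
        + P ^ 3 * (15 * (M * (M - 1) ^ 2)) * h (s + 5)
        + P ^ 4 * (2 * ((M - 1) * (2 * M - 1) * (3 * M ^ 2 - 3 * M - 1))) * h (s + 6)
        + P ^ 5 * (5 * (M * (M - 1) ^ 2 * (2 * M ^ 2 - 2 * M - 1))) * h (s + 7) := by
  have e : ∀ s, 60 * ∑ t ∈ range 6, P ^ t * τ t * h (s + t + 2)
      = 60 * h (s + 2) + P * (30 * (M - 1)) * h (s + 3)
        + P ^ 2 * (10 * ((M - 1) * (2 * M - 1))) * h (s + 4)
        + P ^ 3 * (15 * (M * (M - 1) ^ 2)) * h (s + 5)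
        + P ^ 4 * (2 * ((M - 1) * (2 * M - 1) * (3 * M ^ 2 - 3 * M - 1))) * h (s + 6)
        + P ^ 5 * (5 * (M * (M - 1) ^ 2 * (2 * M ^ 2 - 2 * M - 1))) * h (s + 7) := by
    intro s
    have h := sixty_mul_sum_quotient (P := P) (fun t => h (s + t + 2)) h0 h1 h2 h3 h4 h5
    simp only [Nat.add_assoc, Nat.reduceAdd] at h ⊢
    exact h
  refine Eq.trans ?_ ((sixty_mul_sum_quotient (P := P)
    (fun s => 60 * ∑ t ∈ range 6, P ^ t * τ t * h (s + t + 2)) h0 h1 h2 h3 h4 h5).trans ?_)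
  swap
  · simp only [e]
  simp only [mul_sum]
  refine sum_congr rfl fun s _ => sum_congr rfl fun t _ => ?_
  rw [pow_add]
  ring

theorem curious_cube_sq (hp : 100 < p) :
    (p : ℤ_[p]) ^ 6 ∣ 35 * PowerSeries.coeff (p ^ 2) (unitLog p ^ 3)
      - (-70 * p * mhsTwo p 2 1 + (70 * (p : ℤ_[p]) ^ 3 - 77 * (p : ℤ_[p]) ^ 5) * mhsTwo p 4 1
        - 69 * (p : ℤ_[p]) ^ 5 * mhsTwo p 6 1) := by
  obtain ⟨τ, hτ, h0, h1, h2, h3, h4, h5⟩ := exists_powSum_quotient hp 1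
  obtain ⟨w, hw⟩ := pow_dvd_coeff_unitLog_cube hp (k := 0) (by norm_num) hτ
  obtain ⟨v, hv⟩ := cubic_relation_sq hp
  have h := mul_sum_sum_quotient (P := -(p : ℤ_[p])) (mhsOne p) h0 h1 h2 h3 h4 h5
  rw [zero_add, pow_one, ← sq] at hw
  simp only [pow_zero, pow_one, Nat.reduceAdd, mul_one] at h hw
  refine pow_dvd_of_pow_dvd_natCast_mul hp (D := 43200) (k := 3) (by norm_num) ⟨?_, ?_⟩
  -- Here 1512000 = 35·43200 and 3·1512000 = 1260·3600. The explicit sum gathers the monomials of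
  -- the expansion carrying p^6, which `cubic_relation_sq` omits.
  · exact 1512000 * w + 3600 * v
      + (9450000 * (p : ℤ_[p]) * mhsOne p 6 + (-3402000) * (p : ℤ_[p]) * mhsOne p 7 + (-529200) *
    (p : ℤ_[p]) * mhsOne p 8 + (-559440) * (p : ℤ_[p]) ^ 10 * mhsOne p 10 + 3528000 *
    (p : ℤ_[p]) ^ 10 * mhsOne p 11 + (-661500) * (p : ℤ_[p]) ^ 10 * mhsOne p 12 + (-1663200) *
    (p : ℤ_[p]) ^ 11 * mhsOne p 11 + 1890000 * (p : ℤ_[p]) ^ 11 * mhsOne p 12 + 302400 *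
    (p : ℤ_[p]) ^ 12 * mhsOne p 11 + (-1764000) * (p : ℤ_[p]) ^ 12 * mhsOne p 12 + 756000 *
    (p : ℤ_[p]) ^ 13 * mhsOne p 12 + (-126000) * (p : ℤ_[p]) ^ 14 * mhsOne p 12 + (-5040) *
    (p : ℤ_[p]) ^ 2 * mhsOne p 10 + (-3452400) * (p : ℤ_[p]) ^ 2 * mhsOne p 6 + 10962000 *
    (p : ℤ_[p]) ^ 2 * mhsOne p 7 + (-308700) * (p : ℤ_[p]) ^ 2 * mhsOne p 8 + (-201600) *
    (p : ℤ_[p]) ^ 2 * mhsOne p 9 + (-10357200) * (p : ℤ_[p]) ^ 3 * mhsOne p 7 + 5292000 *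
    (p : ℤ_[p]) ^ 3 * mhsOne p 8 + 529200 * (p : ℤ_[p]) ^ 3 * mhsOne p 9 + 289800 *
    (p : ℤ_[p]) ^ 4 * mhsOne p 10 + 25200 * (p : ℤ_[p]) ^ 4 * mhsOne p 11 + 3175200 *
    (p : ℤ_[p]) ^ 4 * mhsOne p 7 + (-9437400) * (p : ℤ_[p]) ^ 4 * mhsOne p 8 + 1058400 *
    (p : ℤ_[p]) ^ 4 * mhsOne p 9 + (-529200) * (p : ℤ_[p]) ^ 5 * mhsOne p 10 + 6577200 *
    (p : ℤ_[p]) ^ 5 * mhsOne p 8 + (-5292000) * (p : ℤ_[p]) ^ 5 * mhsOne p 9 + (-1199520) *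
    (p : ℤ_[p]) ^ 6 * mhsOne p 10 + (-378000) * (p : ℤ_[p]) ^ 6 * mhsOne p 11 + (-31500) *
    (p : ℤ_[p]) ^ 6 * mhsOne p 12 + (-1644300) * (p : ℤ_[p]) ^ 6 * mhsOne p 8 + 7257600 *
    (p : ℤ_[p]) ^ 6 * mhsOne p 9 + 4536000 * (p : ℤ_[p]) ^ 7 * mhsOne p 10 + 529200 *
    (p : ℤ_[p]) ^ 7 * mhsOne p 11 + (-4309200) * (p : ℤ_[p]) ^ 7 * mhsOne p 9 + (-5329800) *
    (p : ℤ_[p]) ^ 8 * mhsOne p 10 + 1058400 * (p : ℤ_[p]) ^ 8 * mhsOne p 11 + 315000 *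
    (p : ℤ_[p]) ^ 8 * mhsOne p 12 + 957600 * (p : ℤ_[p]) ^ 8 * mhsOne p 9 + 2797200 *
    (p : ℤ_[p]) ^ 9 * mhsOne p 10 + (-3402000) * (p : ℤ_[p]) ^ 9 * mhsOne p 11 + (-378000) *
    (p : ℤ_[p]) ^ 9 * mhsOne p 12 + 3780000 * mhsOne p 5 + (-8064000) * mhsOne p 6 + (-529200) *
    mhsOne p 7 + 50400 * mhsOne p 8)
  · push_cast
    linear_combination 1512000 * hw + 3600 * hv - 1260 * h

theorem curious_cube_cube (hp : 100 < p) :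
    (p : ℤ_[p]) ^ 6 ∣ PowerSeries.coeff (p ^ 3) (unitLog p ^ 3)
      - (-2 * (p : ℤ_[p]) ^ 2 * mhsTwo p 2 1 + 2 * (p : ℤ_[p]) ^ 4 * mhsTwo p 4 1) := by
  obtain ⟨τ, hτ, h0, h1, h2, h3, h4, h5⟩ := exists_powSum_quotient hp 2
  obtain ⟨w, hw⟩ := pow_dvd_coeff_unitLog_cube hp (k := 1) (by norm_num) hτ
  obtain ⟨v, hv⟩ := cubic_relation_cube hp
  have h := mul_sum_sum_quotient (P := -(p : ℤ_[p])) (mhsOne p) h0 h1 h2 h3 h4 h5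
  rw [← pow_succ'] at hw
  simp only [pow_one, Nat.reduceAdd, zero_add] at h hw
  refine pow_dvd_of_pow_dvd_natCast_mul hp (D := 216000) (k := 3) (by norm_num) ⟨?_, ?_⟩
  · exact 216000 * w + 3600 * v
      + ((-594000) * (p : ℤ_[p]) * mhsOne p 4 + 270000 * (p : ℤ_[p]) * mhsOne p 6 + 7200 * (p : ℤ_[p]) *
    mhsOne p 8 + (-54000) * (p : ℤ_[p]) ^ 10 * mhsOne p 11 + 453600 * (p : ℤ_[p]) ^ 10 *
    mhsOne p 7 + (-756000) * (p : ℤ_[p]) ^ 10 * mhsOne p 9 + (-171360) * (p : ℤ_[p]) ^ 11 *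
    mhsOne p 10 + 939600 * (p : ℤ_[p]) ^ 11 * mhsOne p 8 + 75600 * (p : ℤ_[p]) ^ 12 * mhsOne p 11
    + 1036800 * (p : ℤ_[p]) ^ 12 * mhsOne p 9 + 648000 * (p : ℤ_[p]) ^ 13 * mhsOne p 10 + 45000 *
    (p : ℤ_[p]) ^ 13 * mhsOne p 12 + (-234900) * (p : ℤ_[p]) ^ 13 * mhsOne p 8 + 151200 *
    (p : ℤ_[p]) ^ 14 * mhsOne p 11 + (-615600) * (p : ℤ_[p]) ^ 14 * mhsOne p 9 + (-761400) *
    (p : ℤ_[p]) ^ 15 * mhsOne p 10 + (-54000) * (p : ℤ_[p]) ^ 15 * mhsOne p 12 + (-486000) *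
    (p : ℤ_[p]) ^ 16 * mhsOne p 11 + 136800 * (p : ℤ_[p]) ^ 16 * mhsOne p 9 + 399600 *
    (p : ℤ_[p]) ^ 17 * mhsOne p 10 + (-94500) * (p : ℤ_[p]) ^ 17 * mhsOne p 12 + 504000 *
    (p : ℤ_[p]) ^ 18 * mhsOne p 11 + (-79920) * (p : ℤ_[p]) ^ 19 * mhsOne p 10 + 270000 *
    (p : ℤ_[p]) ^ 19 * mhsOne p 12 + (-1188000) * (p : ℤ_[p]) ^ 2 * mhsOne p 5 + (-75600) *
    (p : ℤ_[p]) ^ 2 * mhsOne p 7 + (-237600) * (p : ℤ_[p]) ^ 20 * mhsOne p 11 + (-252000) *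
    (p : ℤ_[p]) ^ 21 * mhsOne p 12 + 43200 * (p : ℤ_[p]) ^ 22 * mhsOne p 11 + 108000 *
    (p : ℤ_[p]) ^ 23 * mhsOne p 12 + (-18000) * (p : ℤ_[p]) ^ 25 * mhsOne p 12 + (-720) *
    (p : ℤ_[p]) ^ 3 * mhsOne p 10 + (-1152000) * (p : ℤ_[p]) ^ 3 * mhsOne p 6 + (-75600) *
    (p : ℤ_[p]) ^ 3 * mhsOne p 8 + 540000 * (p : ℤ_[p]) ^ 4 * mhsOne p 5 + (-486000) *
    (p : ℤ_[p]) ^ 4 * mhsOne p 7 + (-28800) * (p : ℤ_[p]) ^ 4 * mhsOne p 9 + 1350000 *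
    (p : ℤ_[p]) ^ 5 * mhsOne p 6 + (-44100) * (p : ℤ_[p]) ^ 5 * mhsOne p 8 + 3600 *
    (p : ℤ_[p]) ^ 6 * mhsOne p 11 + 1566000 * (p : ℤ_[p]) ^ 6 * mhsOne p 7 + 75600 *
    (p : ℤ_[p]) ^ 6 * mhsOne p 9 + 41400 * (p : ℤ_[p]) ^ 7 * mhsOne p 10 + (-493200) *
    (p : ℤ_[p]) ^ 7 * mhsOne p 6 + 756000 * (p : ℤ_[p]) ^ 7 * mhsOne p 8 + (-1479600) *
    (p : ℤ_[p]) ^ 8 * mhsOne p 7 + 151200 * (p : ℤ_[p]) ^ 8 * mhsOne p 9 + (-75600) *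
    (p : ℤ_[p]) ^ 9 * mhsOne p 10 + (-4500) * (p : ℤ_[p]) ^ 9 * mhsOne p 12 + (-1348200) *
    (p : ℤ_[p]) ^ 9 * mhsOne p 8 + 756000 * mhsOne p 5 + 21600 * mhsOne p 7)
  · push_cast
    linear_combination 216000 * hw + 3600 * hv - 180 * (p : ℤ_[p]) * h

end

/-! ### Triple sums over a pair in one residue class -/

/-- The substitution is (a, D, m) ↦ (q−m, q−D, q−a). The ranges contain 0 but not q, and the two
vanishing hypotheses remove the mismatch. -/
theorem sum_tetrahedron_reflect {A : Type*} [AddCommMonoid A] (q : ℕ) (F : ℕ → ℕ → ℕ → A)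
    (h0 : ∀ D m, F 0 D m = 0) (hq : ∀ a D, F a D q = 0) :
    ∑ m ∈ range q, ∑ D ∈ range m, ∑ a ∈ range D, F a D m
      = ∑ m ∈ range q, ∑ D ∈ range m, ∑ a ∈ range D, F (q - m) (q - D) (q - a) := by
  have e1 : ∀ m D, ∑ a ∈ range D, F a D m = ∑ a ∈ Ico 1 D, F a D m := fun m D =>
    sum_range_eq_sum_Ico_one (h0 D m) D
  have e2 : ∀ m D, ∑ a ∈ range D, F (q - m) (q - D) (q - a)
      = ∑ a ∈ Ico 1 D, F (q - m) (q - D) (q - a) := fun m D =>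
    sum_range_eq_sum_Ico_one (g := fun a => F (q - m) (q - D) (q - a)) (hq _ _) D
  simp only [e1, e2]
  rw [sum_sigma', sum_sigma', sum_sigma', sum_sigma']
  refine sum_nbij' (fun x => ⟨⟨q - x.2, q - x.1.2⟩, q - x.1.1⟩)
    (fun x => ⟨⟨q - x.2, q - x.1.2⟩, q - x.1.1⟩) ?_ ?_ ?_ ?_ ?_
  · rintro ⟨⟨m, D⟩, a⟩ h; simp only [mem_sigma, mem_Ico, mem_range] at h ⊢; omega
  · rintro ⟨⟨m, D⟩, a⟩ h; simp only [mem_sigma, mem_Ico, mem_range] at h ⊢; omega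
  · rintro ⟨⟨m, D⟩, a⟩ h
    simp only [mem_sigma, mem_Ico, mem_range, Sigma.mk.injEq, heq_eq_eq] at h ⊢
    omega
  · rintro ⟨⟨m, D⟩, a⟩ h
    simp only [mem_sigma, mem_Ico, mem_range, Sigma.mk.injEq, heq_eq_eq] at h ⊢
    omega
  · rintro ⟨⟨m, D⟩, a⟩ h
    simp only [mem_sigma, mem_Ico, mem_range] at h ⊢
    congr 1 <;> omega

/-- Separates block numbers u > v ≥ w from residues. The smallest index is either in an earlier
block with any residue j, or in block v with j < i, hence the two products. -/
theorem sum_sum_pair_mul_sum {R : Type*} [CommRing R] (p M : ℕ) (f g h a b c : ℕ → R) :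
    ∑ i ∈ range p, ∑ u ∈ range M, f u * a i * ∑ v ∈ range u, g v * b i
        * (∑ w ∈ range v, ∑ j ∈ range p, h w * c j + ∑ j ∈ range i, h v * c j)
      = (∑ u ∈ range M, f u * ∑ v ∈ range u, g v * ∑ w ∈ range v, h w)
          * ((∑ i ∈ range p, a i * b i) * ∑ j ∈ range p, c j)
        + (∑ u ∈ range M, f u * ∑ v ∈ range u, g v * h v)
          * ∑ i ∈ range p, a i * b i * ∑ j ∈ range i, c j := by
  set A := ∑ u ∈ range M, f u * ∑ v ∈ range u, g v * ∑ w ∈ range v, h w with hA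
  set B := ∑ u ∈ range M, f u * ∑ v ∈ range u, g v * h v with hB
  have e0 : A * ((∑ i ∈ range p, a i * b i) * ∑ j ∈ range p, c j)
      + B * ∑ i ∈ range p, a i * b i * ∑ j ∈ range i, c j
      = ∑ i ∈ range p, (a i * b i * (∑ j ∈ range p, c j) * A
        + a i * b i * (∑ j ∈ range i, c j) * B) := by
    rw [sum_add_distrib, ← sum_mul, ← sum_mul, ← sum_mul]
    ring
  rw [e0]
  refine sum_congr rfl fun i _ => ?_
  rw [hA, hB, mul_sum (range M), mul_sum (range M), ← sum_add_distrib]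
  refine sum_congr rfl fun u _ => ?_
  have e : ∀ v, g v * b i * (∑ w ∈ range v, ∑ j ∈ range p, h w * c j + ∑ j ∈ range i, h v * c j)
      = b i * (∑ j ∈ range p, c j) * (g v * ∑ w ∈ range v, h w)
        + b i * (∑ j ∈ range i, c j) * (g v * h v) := by
    intro v
    simp only [← mul_sum, ← sum_mul]
    ring
  rw [sum_congr rfl fun v _ => e v, sum_add_distrib, ← mul_sum, ← mul_sum]
  ring

theorem sum_rotate {A ι κ μ : Type*} [AddCommMonoid A] (r : Finset ι) (s : Finset κ) (t : Finset μ)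
    (f : ι → κ → μ → A) :
    ∑ n ∈ r, ∑ i ∈ s, ∑ u ∈ t, f n i u = ∑ i ∈ s, ∑ u ∈ t, ∑ n ∈ r, f n i u := by
  rw [sum_comm]
  exact sum_congr rfl fun i _ => sum_comm

theorem sum_sum_pair_mul_sum_expand {R ι : Type*} [CommRing R] (p M : ℕ) (r : Finset ι)
    (F G H : ι → ℕ → ℕ → R) :
    ∑ i ∈ range p, ∑ u ∈ range M, (∑ n ∈ r, F n u i) * ∑ v ∈ range u, (∑ l ∈ r, G l v i)
        * (∑ w ∈ range v, ∑ j ∈ range p, (∑ k ∈ r, H k w j) + ∑ j ∈ range i, ∑ k ∈ r, H k v j)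
      = ∑ n ∈ r, ∑ l ∈ r, ∑ k ∈ r, ∑ i ∈ range p, ∑ u ∈ range M, F n u i * ∑ v ∈ range u, G l v i
        * (∑ w ∈ range v, ∑ j ∈ range p, H k w j + ∑ j ∈ range i, H k v j) := by
  symm
  refine ((sum_congr rfl fun n _ => (sum_congr rfl fun l _ => sum_rotate _ _ _ _).trans
    (sum_rotate _ _ _ _)).trans (sum_rotate _ _ _ _)).trans ?_
  refine sum_congr rfl fun i _ => sum_congr rfl fun u _ => ?_
  rw [sum_mul]
  refine sum_congr rfl fun n _ => ?_
  simp only [← mul_sum]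
  congr 1
  refine ((sum_congr rfl fun l _ => sum_comm).trans sum_comm).trans ?_
  refine sum_congr rfl fun v _ => ?_
  rw [sum_mul]
  refine sum_congr rfl fun l _ => ?_
  rw [← mul_sum, sum_add_distrib]
  congr 2
  · rw [sum_rotate]
  · rw [sum_comm]

section

variable {p : ℕ} [Fact p.Prime]

/-- `∑ 1 / (a ^ α D ^ β m ^ γ)` over the triples `0 < a < D < m < q` of integers prime to `p` with
`D ≡ m` modulo `p`. -/
noncomputable def pairSum (p : ℕ) [Fact p.Prime] (q α β γ : ℕ) : ℤ_[p] :=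
  ∑ m ∈ range q, unitInv p m ^ γ * ∑ D ∈ range m, dvdInd p (m - D)
    * (unitInv p D ^ β * ∑ a ∈ range D, unitInv p a ^ α)

/-- Reflection changes the condition D ≡ a into m ≡ D, and each inverse becomes −(1/n + q/n² +
q²/n³) modulo q³. The three signs give −1, so the two constrained sums cancel up to terms of one
more order in q. -/
theorem pow_three_dvd_pairSum_reflect {q : ℕ} (hq : p ∣ q) :
    (q : ℤ_[p]) ^ 3 ∣ ∑ m ∈ range q, unitInv p m * ∑ D ∈ range m, unitInv p D
        * ∑ a ∈ range D, dvdInd p (D - a) * unitInv p a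
      + (pairSum p q 1 1 1 + q * (pairSum p q 2 1 1 + pairSum p q 1 2 1 + pairSum p q 1 1 2)
        + q ^ 2 * (pairSum p q 3 1 1 + pairSum p q 1 3 1 + pairSum p q 1 1 3
          + pairSum p q 2 2 1 + pairSum p q 2 1 2 + pairSum p q 1 2 2)) := by
  have h := sum_tetrahedron_reflect q
    (fun a D m => unitInv p m * (unitInv p D * (dvdInd p (D - a) * unitInv p a)))
    (by simp) (by simp [unitInv_of_dvd hq])
  simp only [← mul_sum] at h
  rw [h]
  set x := unitInv p
  set y : ℕ → ℤ_[p] := fun n => x n + q * x n ^ 2 + q ^ 2 * x n ^ 3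
  have hx : ∀ n ≤ q, (q : ℤ_[p]) ^ 3 ∣ x (q - n) - -y n := by
    intro n hn
    have := pow_dvd_unitInv_sub_pow_sub hq hn one_pos 3
    simp only [sum_range_succ, sum_range_zero, Nat.choose, Nat.reduceAdd, Nat.reduceSub] at this
    convert this using 1
    simp only [y, x]
    push_cast
    ring
  have e : pairSum p q 1 1 1 + q * (pairSum p q 2 1 1 + pairSum p q 1 2 1 + pairSum p q 1 1 2)
        + q ^ 2 * (pairSum p q 3 1 1 + pairSum p q 1 3 1 + pairSum p q 1 1 3
          + pairSum p q 2 2 1 + pairSum p q 2 1 2 + pairSum p q 1 2 2)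
      = ∑ m ∈ range q, ∑ D ∈ range m, ∑ a ∈ range D, dvdInd p (m - D) * (x a * x D * x m
        + q * (x a ^ 2 * x D * x m + x a * x D ^ 2 * x m + x a * x D * x m ^ 2)
        + q ^ 2 * (x a ^ 3 * x D * x m + x a * x D ^ 3 * x m + x a * x D * x m ^ 3
          + x a ^ 2 * x D ^ 2 * x m + x a ^ 2 * x D * x m ^ 2 + x a * x D ^ 2 * x m ^ 2)) := by
    simp only [pairSum, mul_sum, ← sum_add_distrib]
    refine sum_congr rfl fun m _ => sum_congr rfl fun D _ => sum_congr rfl fun a _ => ?_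
    ring
  rw [e]
  simp only [← sum_add_distrib]
  refine dvd_sum fun m hm => dvd_sum fun D hD => dvd_sum fun a ha => ?_
  rw [mem_range] at hm hD ha
  rw [show q - D - (q - m) = m - D by omega]
  obtain ⟨e1, h1⟩ := hx m hm.le
  obtain ⟨e2, h2⟩ := hx D (hD.trans hm).le
  obtain ⟨e3, h3⟩ := hx a (ha.trans (hD.trans hm)).le
  obtain ⟨w, hw⟩ := dvd_mul_sub_mul_of_dvd (dvd_mul_sub_mul_of_dvd (hx m hm.le)
    (hx D (hD.trans hm).le)) (hx a (ha.trans (hD.trans hm)).le)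
  simp only [y] at hw
  -- The subtracted monomials are those of degree at least 3 in q in the product of the three
  -- truncations.
  refine ⟨dvdInd p (m - D) * (w - (x a ^ 3 * x D ^ 2 * x m + x a ^ 3 * x D * x m ^ 2
    + x a ^ 2 * x D ^ 3 * x m + x a * x D ^ 3 * x m ^ 2 + x a ^ 2 * x D * x m ^ 3
    + x a * x D ^ 2 * x m ^ 3 + x a ^ 2 * x D ^ 2 * x m ^ 2)
    - q * (x a ^ 3 * x D ^ 3 * x m + x a ^ 3 * x D * x m ^ 3 + x a * x D ^ 3 * x m ^ 3
      + x a ^ 3 * x D ^ 2 * x m ^ 2 + x a ^ 2 * x D ^ 3 * x m ^ 2 + x a ^ 2 * x D ^ 2 * x m ^ 3)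
    - q ^ 2 * (x a ^ 3 * x D ^ 3 * x m ^ 2 + x a ^ 3 * x D ^ 2 * x m ^ 3
      + x a ^ 2 * x D ^ 3 * x m ^ 3)
    - q ^ 3 * (x a ^ 3 * x D ^ 3 * x m ^ 3)), ?_⟩
  linear_combination dvdInd p (m - D) * hw

theorem pairSum_mul (M α β γ : ℕ) :
    pairSum p (p * M) α β γ = ∑ i ∈ range p, ∑ u ∈ range M, unitInv p (p * u + i) ^ γ
      * ∑ v ∈ range u, unitInv p (p * v + i) ^ β
        * (∑ w ∈ range v, ∑ j ∈ range p, unitInv p (p * w + j) ^ α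
          + ∑ j ∈ range i, unitInv p (p * v + j) ^ α) := by
  rw [pairSum, sum_range_mul_eq, sum_comm]
  refine sum_congr rfl fun i hi => sum_congr rfl fun u _ => ?_
  rw [sum_range_dvdInd_mul (mem_range.1 hi) u
    fun D => unitInv p D ^ β * ∑ a ∈ range D, unitInv p a ^ α]
  congr 1
  refine sum_congr rfl fun v _ => ?_
  rw [sum_range_add, sum_range_mul_eq]

/-- The triple power sum `∑_{w < v < u < M} w ^ k v ^ l u ^ n`. -/
noncomputable def powSumThree (p : ℕ) [Fact p.Prime] (M k l n : ℕ) : ℤ_[p] :=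
  ∑ u ∈ range M, (u : ℤ_[p]) ^ n * ∑ v ∈ range u, (v : ℤ_[p]) ^ l * ∑ w ∈ range v, (w : ℤ_[p]) ^ k

theorem dvd_powSumThree {k l n : ℕ} (hs : k + l + n + 3 < p) (e : ℕ) :
    ((p ^ e : ℕ) : ℤ_[p]) ∣ powSumThree p (p ^ e) k l n :=
  pow_dvd_sum_of_mem_binSpan (pow_mul_mem_binSpan (sum_range_mem_binSpan (pow_mul_mem_binSpan
    (sum_range_mem_binSpan (pow_mem_binSpan k)) l)) n) (by omega) e

theorem pow_dvd_unitInv_residue_sub {a : ℕ} (ha : 0 < a) (J u i : ℕ) :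
    (p : ℤ_[p]) ^ J ∣ unitInv p (p * u + i) ^ a - ∑ s ∈ range J,
      (u : ℤ_[p]) ^ s * (((a - 1 + s).choose s : ℤ_[p]) * (-(p : ℤ_[p])) ^ s
        * unitInv p i ^ (a + s)) := by
  have h := pow_dvd_unitInv_add_pow_sub (dvd_mul_right p u) i ha J
  have h2 : (p : ℤ_[p]) ^ J ∣ ((p * u : ℕ) : ℤ_[p]) ^ J := by
    push_cast
    rw [mul_pow]
    exact dvd_mul_right _ _
  convert h2.trans h using 2
  refine sum_congr rfl fun s _ => ?_
  push_cast
  rw [← neg_mul, mul_pow]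
  ring

theorem pow_dvd_pairSum_sub {α β γ : ℕ} (hα : 0 < α) (hβ : 0 < β) (hγ : 0 < γ) (J M : ℕ) :
    (p : ℤ_[p]) ^ J ∣ pairSum p (p * M) α β γ
      - ∑ n ∈ range J, ∑ l ∈ range J, ∑ k ∈ range J,
        ((α - 1 + k).choose k * (β - 1 + l).choose l * (γ - 1 + n).choose n : ℤ_[p])
          * (-(p : ℤ_[p])) ^ (k + l + n)
          * (powSumThree p M k l n * (mhsOne p (β + γ + l + n) * mhsOne p (α + k))
            + powSumTwo p M (k + l) n * mhsTwo p (β + γ + l + n) (α + k)) := by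
  set c : ℕ → ℕ → ℕ → ℤ_[p] := fun a s i =>
    ((a - 1 + s).choose s : ℤ_[p]) * (-(p : ℤ_[p])) ^ s * unitInv p i ^ (a + s) with hc
  have hx := fun {a : ℕ} (ha : 0 < a) u i => pow_dvd_unitInv_residue_sub (p := p) ha J u i
  have h1 := sum_sum_pair_mul_sum_expand p M (range J) (fun n u i => (u : ℤ_[p]) ^ n * c γ n i)
    (fun n u i => (u : ℤ_[p]) ^ n * c β n i) (fun n u i => (u : ℤ_[p]) ^ n * c α n i)
  have key : ∀ n l k : ℕ, ∑ i ∈ range p, ∑ u ∈ range M, (u : ℤ_[p]) ^ n * c γ n i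
        * ∑ v ∈ range u, (v : ℤ_[p]) ^ l * c β l i
          * (∑ w ∈ range v, ∑ j ∈ range p, (w : ℤ_[p]) ^ k * c α k j
            + ∑ j ∈ range i, (v : ℤ_[p]) ^ k * c α k j)
      = ((α - 1 + k).choose k * (β - 1 + l).choose l * (γ - 1 + n).choose n : ℤ_[p])
          * (-(p : ℤ_[p])) ^ (k + l + n)
          * (powSumThree p M k l n * (mhsOne p (β + γ + l + n) * mhsOne p (α + k))
            + powSumTwo p M (k + l) n * mhsTwo p (β + γ + l + n) (α + k)) := by
    intro n l k
    rw [sum_sum_pair_mul_sum p M (fun u => (u : ℤ_[p]) ^ n) (fun u => (u : ℤ_[p]) ^ l)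
      (fun u => (u : ℤ_[p]) ^ k) (c γ n) (c β l) (c α k)]
    have e1 : ∑ i ∈ range p, c γ n i * c β l i = ((β - 1 + l).choose l * (γ - 1 + n).choose n : ℤ_[p])
        * (-(p : ℤ_[p])) ^ (l + n) * mhsOne p (β + γ + l + n) := by
      rw [mhsOne, ← sum_range_unitInv_pow (by omega), mul_sum]
      refine sum_congr rfl fun i _ => ?_
      simp only [hc]
      ring
    have e2 : ∑ j ∈ range p, c α k j = ((α - 1 + k).choose k : ℤ_[p]) * (-(p : ℤ_[p])) ^ k
        * mhsOne p (α + k) := by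
      rw [mhsOne, ← sum_range_unitInv_pow (by omega), mul_sum]
    have e3 : ∑ i ∈ range p, c γ n i * c β l i * ∑ j ∈ range i, c α k j
        = ((α - 1 + k).choose k * (β - 1 + l).choose l * (γ - 1 + n).choose n : ℤ_[p])
          * (-(p : ℤ_[p])) ^ (k + l + n) * mhsTwo p (β + γ + l + n) (α + k) := by
      have e4 : ∀ i, ∑ j ∈ range i, c α k j = ((α - 1 + k).choose k : ℤ_[p]) * (-(p : ℤ_[p])) ^ k
          * ∑ j ∈ Ico 1 i, unitInv p j ^ (α + k) := by
        intro i
        rw [← sum_range_unitInv_pow (by omega), mul_sum]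
      rw [mhsTwo, mul_sum, sum_range_eq_sum_Ico_one (by simp)]
      refine sum_congr rfl fun i _ => ?_
      rw [e4, ← mul_sum]
      simp only [hc]
      ring
    have e5 : ∑ u ∈ range M, (u : ℤ_[p]) ^ n * ∑ v ∈ range u, (v : ℤ_[p]) ^ l * (v : ℤ_[p]) ^ k
        = powSumTwo p M (k + l) n := by
      simp only [powSumTwo, pow_add, mul_comm]
    rw [e1, e2, e3, e5, ← powSumThree]
    ring
  simp only [key] at h1
  rw [← h1, pairSum_mul]
  refine dvd_sum_sub_sum fun i _ => dvd_sum_sub_sum fun u _ => dvd_mul_sub_mul_of_dvd (hx hγ u i) ?_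
  refine dvd_sum_sub_sum fun v _ => dvd_mul_sub_mul_of_dvd (hx hβ v i) ?_
  rw [add_sub_add_comm]
  refine dvd_add ?_ ?_
  · exact dvd_sum_sub_sum fun w _ => dvd_sum_sub_sum fun j _ => hx hα w j
  · exact dvd_sum_sub_sum fun j _ => hx hα v j

end

/-! ### Truncating the expansions of the pair sums -/

theorem dvd_sum_range_sub_sum_range {R : Type*} [CommRing R] {d : R} {f : ℕ → R} {m J : ℕ}
    (hm : m ≤ J) (h : ∀ n < J, m ≤ n → d ∣ f n) : d ∣ ∑ n ∈ range J, f n - ∑ n ∈ range m, f n := by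
  rw [← sum_range_add_sum_Ico f hm, add_sub_cancel_left]
  exact dvd_sum fun n hn => h n (mem_Ico.1 hn).2 (mem_Ico.1 hn).1

theorem dvd_sum_cube_sub_sum_simplex {R : Type*} [CommRing R] {d : R} {g : ℕ → ℕ → ℕ → R} {e J : ℕ}
    (he : e ≤ J) (h : ∀ n < J, ∀ l < J, ∀ k < J, e ≤ k + l + n → d ∣ g n l k) :
    d ∣ ∑ n ∈ range J, ∑ l ∈ range J, ∑ k ∈ range J, g n l k
      - ∑ n ∈ range e, ∑ l ∈ range (e - n), ∑ k ∈ range (e - n - l), g n l k := by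
  refine dvd_sub_trans (dvd_sum_range_sub_sum_range he fun n hn hen =>
    dvd_sum fun l hl => dvd_sum fun k hk => h n hn l (mem_range.1 hl) k (mem_range.1 hk) (by omega))
    (dvd_sum_sub_sum fun n hn => ?_)
  have hn' := (mem_range.1 hn).trans_le he
  refine dvd_sub_trans (dvd_sum_range_sub_sum_range (by omega) fun l hl hel =>
    dvd_sum fun k hk => h n hn' l hl k (mem_range.1 hk) (by omega)) (dvd_sum_sub_sum fun l hl => ?_)
  exact dvd_sum_range_sub_sum_range (by omega) fun k hk hek =>
    h n hn' l ((mem_range.1 hl).trans_le (by omega)) k hk (by omega)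

section

variable {p : ℕ} [Fact p.Prime]

theorem powSumTwo_zero_zero (M : ℕ) : 2 * powSumTwo p M 0 0 = M * (M - 1) := by
  induction M with
  | zero => simp [powSumTwo]
  | succ M ih =>
    simp only [powSumTwo, sum_range_succ _ M, pow_zero, sum_const, card_range, nsmul_eq_mul,
      one_mul] at ih ⊢
    push_cast
    linear_combination ih

theorem powSumTwo_zero_right (M t : ℕ) : powSumTwo p M 0 t = powSum p M (t + 1) := by
  simp [powSumTwo, powSum, pow_succ]

theorem powSumTwo_one_zero (M : ℕ) : 6 * powSumTwo p M 1 0 = M * ((M - 1) * (M - 2)) := by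
  induction M with
  | zero => simp [powSumTwo]
  | succ M ih =>
    have h := powSum_one (p := p) M
    simp only [powSumTwo, sum_range_succ _ M, powSum] at ih h ⊢
    push_cast
    linear_combination ih + 3 * h

theorem powSumTwo_one_one (M : ℕ) : 24 * powSumTwo p M 1 1 = M * ((M - 1) * (M - 2) * (3 * M - 1)) := by
  induction M with
  | zero => simp [powSumTwo]
  | succ M ih =>
    have h := powSum_one (p := p) M
    simp only [powSumTwo, sum_range_succ _ M, powSum] at ih h ⊢
    push_cast
    linear_combination ih + 12 * M * h

theorem powSumTwo_two_zero (M : ℕ) : 12 * powSumTwo p M 2 0 = M * ((M - 1) ^ 2 * (M - 2)) := by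
  induction M with
  | zero => simp [powSumTwo]
  | succ M ih =>
    have h := powSum_two (p := p) M
    simp only [powSumTwo, sum_range_succ _ M, powSum] at ih h ⊢
    push_cast
    linear_combination ih + 2 * h

theorem powSumThree_zero (M : ℕ) : 6 * powSumThree p M 0 0 0 = M * ((M - 1) * (M - 2)) := by
  rw [← powSumTwo_one_zero]
  simp [powSumThree, powSumTwo]

/-- Products of two sums H are already divisible by p². Otherwise a term of positive degree gets one
p from its power of −p and another from the double power sum. -/
theorem sq_dvd_pairSum_sub (hp : 100 < p) {e α β γ : ℕ} (he : 0 < e) (hα : 0 < α) (hβ : 0 < β)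
    (hγ : 0 < γ) (h : α + β + γ < 40) :
    (p : ℤ_[p]) ^ 2 ∣ pairSum p (p * p ^ e) α β γ
      - powSumTwo p (p ^ e) 0 0 * mhsTwo p (β + γ) α := by
  refine dvd_sub_trans (pow_dvd_pairSum_sub hα hβ hγ 2 (p ^ e)) ?_
  have hH : ∀ l n k, l < 2 → n < 2 → k < 2 → (p : ℤ_[p]) ^ 2 ∣
      mhsOne p (β + γ + l + n) * mhsOne p (α + k) := fun l n k _ _ _ => by
    rw [sq]
    exact mul_dvd_mul (dvd_mhsOne hp (by omega) (by omega)) (dvd_mhsOne hp (by omega) (by omega))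
  refine dvd_sub_trans (dvd_sum_cube_sub_sum_simplex (e := 1) (by norm_num) ?_) ?_
  · intro n hn l hl k hk h0
    rw [mul_add]
    refine dvd_add (((hH l n k hl hn hk).mul_left _).mul_left _) ?_
    have d1 := dvd_powSumTwo (p := p) (s := k + l) (t := n) (by omega) e
    push_cast at d1
    have d2 : (p : ℤ_[p]) ∣ (-(p : ℤ_[p])) ^ (k + l + n) :=
      (dvd_neg.2 dvd_rfl).trans (dvd_pow_self _ (by omega))
    have d3 := mul_dvd_mul d2 ((dvd_pow_self (p : ℤ_[p]) he.ne').trans d1)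
    rw [← sq] at d3
    rw [mul_assoc, ← mul_assoc (_ ^ _)]
    exact (d3.mul_right _).mul_left _
  · have h0 := hH 0 0 0 two_pos two_pos two_pos
    simp only [sum_range_one, Nat.choose_zero_right, Nat.cast_one, pow_zero, add_zero, mul_one,
      one_mul, add_sub_cancel_right, Nat.sub_zero] at h0 ⊢
    exact h0.mul_left _

/-- The part with H·H already has p² times p^e, so only its constant term survives; the part with
double sums has only p^e and needs total degree up to 2. -/
theorem pow_mul_pow_dvd_pairSum_sub (hp : 100 < p) {e α β γ : ℕ} (he : e ≤ 2) (hα : 0 < α)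
    (hβ : 0 < β) (hγ : 0 < γ) (h : α + β + γ < 40) :
    (p : ℤ_[p]) ^ 3 * (p : ℤ_[p]) ^ e ∣ pairSum p (p * p ^ e) α β γ
      - (powSumThree p (p ^ e) 0 0 0 * (mhsOne p (β + γ) * mhsOne p α)
        + ∑ n ∈ range 3, ∑ l ∈ range (3 - n), ∑ k ∈ range (3 - n - l),
        ((α - 1 + k).choose k * (β - 1 + l).choose l * (γ - 1 + n).choose n : ℤ_[p])
          * (-(p : ℤ_[p])) ^ (k + l + n)
          * (powSumTwo p (p ^ e) (k + l) n * mhsTwo p (β + γ + l + n) (α + k))) := by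
  have h5 : (p : ℤ_[p]) ^ 3 * (p : ℤ_[p]) ^ e ∣ (p : ℤ_[p]) ^ 5 := by
    rw [← pow_add]; exact pow_dvd_pow _ (by omega)
  have hp0 : ∀ m, (p : ℤ_[p]) ^ m ∣ (-(p : ℤ_[p])) ^ m := fun m => by
    rw [neg_pow]; exact dvd_mul_left _ _
  refine dvd_sub_trans (h5.trans (pow_dvd_pairSum_sub hα hβ hγ 5 (p ^ e))) ?_
  simp only [mul_add, sum_add_distrib]
  rw [add_sub_add_comm]
  refine dvd_add (dvd_sub_trans (dvd_sum_cube_sub_sum_simplex (e := 1) (by norm_num) ?_) ?_)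
    (dvd_sum_cube_sub_sum_simplex (e := 3) (by norm_num) ?_)
  · intro n hn l hl k hk h0
    have d1 := dvd_powSumThree (p := p) (k := k) (l := l) (n := n) (by omega) e
    push_cast at d1
    have d2 := mul_dvd_mul ((dvd_pow_self (p : ℤ_[p]) (by omega)).trans (hp0 (k + l + n)))
      (mul_dvd_mul d1 (mul_dvd_mul (dvd_mhsOne hp (a := β + γ + l + n) (by omega) (by omega))
        (dvd_mhsOne hp (a := α + k) (by omega) (by omega))))
    rw [mul_assoc]
    refine Dvd.dvd.mul_left ?_ _
    convert d2 using 1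
    ring
  · simp
  · intro n hn l hl k hk h0
    have d1 := dvd_powSumTwo (p := p) (s := k + l) (t := n) (by omega) e
    push_cast at d1
    rw [mul_assoc, ← mul_assoc (_ ^ _)]
    exact ((mul_dvd_mul ((pow_dvd_pow _ h0).trans (hp0 _)) d1).mul_right _).mul_left _

/-- The factor 24 clears the denominators of the iterated power sums; the products H(1)H(3) are
divisible by p⁴ and disappear. -/
theorem pairSum_four (hp : 100 < p) {e : ℕ} (he : e ≤ 2) {M : ℤ_[p]} (hM : M = (p : ℤ_[p]) ^ e) :
    (p : ℤ_[p]) ^ 3 * M ∣ 24 * (pairSum p (p * p ^ e) 2 1 1 + pairSum p (p * p ^ e) 1 2 1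
      + pairSum p (p * p ^ e) 1 1 2) - M * (4 * ((M - 1) * (M - 2)) * (mhsOne p 2 * mhsOne p 2)
      + 1 * (12 * (M - 1)) * mhsTwo p 2 2
      + (-2) * (p : ℤ_[p]) * (4 * ((M - 1) * (M - 2))) * mhsTwo p 2 3
      + 3 * (p : ℤ_[p]) ^ 2 * (2 * ((M - 1) ^ 2 * (M - 2))) * mhsTwo p 2 4
      + 2 * (12 * (M - 1)) * mhsTwo p 3 1
      + (-1) * (p : ℤ_[p]) * (4 * ((M - 1) * (2 * M - 1))) * mhsTwo p 3 2
      + (-3) * (p : ℤ_[p]) * (4 * ((M - 1) * (M - 2))) * mhsTwo p 3 2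
      + 2 * (p : ℤ_[p]) ^ 2 * ((M - 1) * (M - 2) * (3 * M - 1)) * mhsTwo p 3 3
      + 4 * (p : ℤ_[p]) ^ 2 * (2 * ((M - 1) ^ 2 * (M - 2))) * mhsTwo p 3 3
      + (-3) * (p : ℤ_[p]) * (4 * ((M - 1) * (2 * M - 1))) * mhsTwo p 4 1
      + (-3) * (p : ℤ_[p]) * (4 * ((M - 1) * (M - 2))) * mhsTwo p 4 1
      + 1 * (p : ℤ_[p]) ^ 2 * (6 * (M * (M - 1) ^ 2)) * mhsTwo p 4 2
      + 4 * (p : ℤ_[p]) ^ 2 * ((M - 1) * (M - 2) * (3 * M - 1)) * mhsTwo p 4 2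
      + 4 * (p : ℤ_[p]) ^ 2 * (2 * ((M - 1) ^ 2 * (M - 2))) * mhsTwo p 4 2
      + 4 * (p : ℤ_[p]) ^ 2 * (6 * (M * (M - 1) ^ 2)) * mhsTwo p 5 1
      + 4 * (p : ℤ_[p]) ^ 2 * ((M - 1) * (M - 2) * (3 * M - 1)) * mhsTwo p 5 1
      + 4 * (p : ℤ_[p]) ^ 2 * (2 * ((M - 1) ^ 2 * (M - 2))) * mhsTwo p 5 1) := by
  obtain ⟨e1, h1⟩ := pow_mul_pow_dvd_pairSum_sub hp he (α := 2) (β := 1) (γ := 1) (by norm_num)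
    (by norm_num) (by norm_num) (by norm_num)
  obtain ⟨e2, h2⟩ := pow_mul_pow_dvd_pairSum_sub hp he (α := 1) (β := 2) (γ := 1) (by norm_num)
    (by norm_num) (by norm_num) (by norm_num)
  obtain ⟨e3, h3⟩ := pow_mul_pow_dvd_pairSum_sub hp he (α := 1) (β := 1) (γ := 2) (by norm_num)
    (by norm_num) (by norm_num) (by norm_num)
  obtain ⟨f1, g1⟩ := sq_dvd_mhsOne hp (a := 1) (by decide) (by norm_num)
  obtain ⟨f3, g3⟩ := sq_dvd_mhsOne hp (a := 3) (by decide) (by norm_num)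
  have s0 := powSumTwo_zero_zero (p := p) (p ^ e)
  have s1 := powSumTwo_one_zero (p := p) (p ^ e)
  have s2 := powSumTwo_two_zero (p := p) (p ^ e)
  have s3 := powSumTwo_one_one (p := p) (p ^ e)
  have s4 := powSum_two (p := p) (p ^ e)
  have s5 := powSum_three (p := p) (p ^ e)
  have s6 := powSumThree_zero (p := p) (p ^ e)
  have t1 := powSumTwo_zero_right (p := p) (p ^ e) 1
  have t2 := powSumTwo_zero_right (p := p) (p ^ e) 2
  simp only [sum_range_succ, sum_range_zero, Nat.choose, Nat.reduceAdd, Nat.reduceSub, zero_add,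
    add_zero, g1, g3] at h1 h2 h3 t1 t2
  rw [← t1] at s4
  rw [← t2] at s5
  push_cast at h1 h2 h3 s0 s1 s2 s3 s4 s5 s6
  rw [← hM] at h1 h2 h3 s0 s1 s2 s3 s4 s5 s6
  clear t1 t2
  generalize powSumTwo p (p ^ e) 0 0 = u0 at *
  generalize powSumTwo p (p ^ e) 1 0 = u1 at *
  generalize powSumTwo p (p ^ e) 2 0 = u2 at *
  generalize powSumTwo p (p ^ e) 1 1 = u3 at *
  generalize powSumTwo p (p ^ e) 0 1 = u4 at *
  generalize powSumTwo p (p ^ e) 0 2 = u5 at *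
  generalize powSumThree p (p ^ e) 0 0 0 = v at *
  refine ⟨24 * (e1 + e2 + e3) + 8 * p * ((M - 1) * (M - 2)) * f1 * f3, ?_⟩
  linear_combination 24 * h1 + 24 * h2 + 24 * h3 + (4 * mhsOne p 2 * mhsOne p 2 + 8 * (p : ℤ_[p]) ^ 4 * f1 * f3) * s6
    + 12 * (1 * mhsTwo p 2 2
      + 2 * mhsTwo p 3 1) * s0
    + 4 * ((-3) * (p : ℤ_[p]) * mhsTwo p 3 2
      + (-2) * (p : ℤ_[p]) * mhsTwo p 2 3
      + (-3) * (p : ℤ_[p]) * mhsTwo p 4 1) * s1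
    + 2 * (4 * (p : ℤ_[p]) ^ 2 * mhsTwo p 4 2
      + 4 * (p : ℤ_[p]) ^ 2 * mhsTwo p 3 3
      + 3 * (p : ℤ_[p]) ^ 2 * mhsTwo p 2 4
      + 4 * (p : ℤ_[p]) ^ 2 * mhsTwo p 5 1) * s2
    + 1 * (4 * (p : ℤ_[p]) ^ 2 * mhsTwo p 4 2
      + 2 * (p : ℤ_[p]) ^ 2 * mhsTwo p 3 3
      + 4 * (p : ℤ_[p]) ^ 2 * mhsTwo p 5 1) * s3
    + 4 * ((-1) * (p : ℤ_[p]) * mhsTwo p 3 2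
      + (-3) * (p : ℤ_[p]) * mhsTwo p 4 1) * s4
    + 6 * (1 * (p : ℤ_[p]) ^ 2 * mhsTwo p 4 2
      + 4 * (p : ℤ_[p]) ^ 2 * mhsTwo p 5 1) * s5

/-- Only the constant term counts, and its power sum M(M−1)/2 is −M/2 modulo p². The weights 1, 2, 3
count the exponent triples with β+γ equal to 2, 3, 4. -/
theorem pairSum_five (hp : 100 < p) {e : ℕ} (he : 0 < e) :
    (p : ℤ_[p]) ^ 2 ∣ 2 * (pairSum p (p * p ^ e) 3 1 1 + pairSum p (p * p ^ e) 1 3 1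
      + pairSum p (p * p ^ e) 1 1 3 + pairSum p (p * p ^ e) 2 2 1 + pairSum p (p * p ^ e) 2 1 2
      + pairSum p (p * p ^ e) 1 2 2)
      + (p : ℤ_[p]) ^ e * (mhsTwo p 2 3 + 2 * mhsTwo p 3 2 + 3 * mhsTwo p 4 1) := by
  have h : ∀ {α β γ : ℕ}, 0 < α → 0 < β → 0 < γ → α + β + γ < 40 → (p : ℤ_[p]) ^ 2 ∣
      2 * pairSum p (p * p ^ e) α β γ + (p : ℤ_[p]) ^ e * mhsTwo p (β + γ) α := by
    intro α β γ hα hβ hγ hs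
    obtain ⟨w, hw⟩ := sq_dvd_pairSum_sub hp he hα hβ hγ hs
    obtain ⟨z, hz⟩ := dvd_pow_self (p : ℤ_[p]) he.ne'
    have s0 := powSumTwo_zero_zero (p := p) (p ^ e)
    push_cast at s0
    rw [hz] at s0 ⊢
    exact ⟨2 * w + z ^ 2 * mhsTwo p (β + γ) α, by
      linear_combination 2 * hw + mhsTwo p (β + γ) α * s0⟩
  have h1 := dvd_add (dvd_add (dvd_add (h (α := 3) (β := 1) (γ := 1) (by norm_num) (by norm_num)
    (by norm_num) (by norm_num)) (h (α := 1) (β := 3) (γ := 1) (by norm_num) (by norm_num)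
    (by norm_num) (by norm_num))) (h (α := 1) (β := 1) (γ := 3) (by norm_num) (by norm_num)
    (by norm_num) (by norm_num))) (dvd_add (dvd_add (h (α := 2) (β := 2) (γ := 1) (by norm_num)
    (by norm_num) (by norm_num) (by norm_num)) (h (α := 2) (β := 1) (γ := 2) (by norm_num)
    (by norm_num) (by norm_num) (by norm_num))) (h (α := 1) (β := 2) (γ := 2) (by norm_num)
    (by norm_num) (by norm_num) (by norm_num)))
  convert h1 using 1
  simp only [Nat.reduceAdd]
  ring

end

section

variable {p : ℕ} [Fact p.Prime]

/-! ### Decomposition of the quartic sum -/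

theorem coeff_unitLog_sq (D : ℕ) :
    PowerSeries.coeff D (unitLog p ^ 2)
      = 2 * (unitInv p D * ∑ a ∈ range D, (1 - dvdInd p (D - a)) * unitInv p a)
        + dvdInd p D * PowerSeries.coeff D (unitLog p ^ 2) := by
  have e : ∀ a, PowerSeries.coeff a (unitLog p ^ 1) = unitInv p a := fun a => by
    rw [pow_one, unitLog, PowerSeries.coeff_mk]
  by_cases h : p ∣ D
  · rw [unitInv_of_dvd h, dvdInd, if_pos h]; ring
  · have h1 := coeff_unitLog_pow_of_not_dvd h 1
    simp only [e] at h1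
    rw [dvdInd, if_neg h, zero_mul, add_zero, h1]
    push_cast
    ring

/-- Inclusion–exclusion over the conditions p ∤ m−D and p ∤ D−a. Indices D divisible by p fall
outside the recursion and keep their coefficient of L²; for them p ∤ m−D follows from p ∤ m. -/
theorem natCast_mul_coeff_unitLog_four {q : ℕ} (hq : p ∣ q) :
    (q : ℤ_[p]) * PowerSeries.coeff q (unitLog p ^ 4)
      = 24 * (∑ m ∈ range q, unitInv p m * ∑ D ∈ range m, unitInv p D * ∑ a ∈ range D, unitInv p a
          - ∑ m ∈ range q, unitInv p m * ∑ D ∈ range m, unitInv p D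
            * ∑ a ∈ range D, dvdInd p (D - a) * unitInv p a
          - pairSum p q 1 1 1
          + ∑ m ∈ range q, unitInv p m * ∑ D ∈ range m, dvdInd p (m - D) * (unitInv p D
            * ∑ a ∈ range D, dvdInd p (D - a) * unitInv p a))
        + 12 * ∑ m ∈ range q, unitInv p m * ∑ D ∈ range m, dvdInd p D
          * PowerSeries.coeff D (unitLog p ^ 2) := by
  rw [natCast_mul_coeff_unitLog_pow_of_dvd hq 2, pairSum]
  simp only [pow_one, mul_sum, ← sum_add_distrib, ← sum_sub_distrib]
  refine sum_congr rfl fun m _ => sum_congr rfl fun D hD => ?_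
  have h0 : dvdInd p D * (dvdInd p (m - D) * unitInv p m) = 0 := by
    by_cases h : p ∣ D
    · rw [dvdInd_mul_unitInv (mem_range.1 hD).le h, mul_zero]
    · rw [dvdInd, if_neg h, zero_mul]
  have h1 := coeff_unitLog_sq (p := p) D
  have h2 : ∑ a ∈ range D, (1 - dvdInd p (D - a)) * unitInv p a
      = ∑ a ∈ range D, unitInv p a - ∑ a ∈ range D, dvdInd p (D - a) * unitInv p a := by
    simp only [← sum_sub_distrib, sub_mul, one_mul]
  rw [h2] at h1
  simp only [← mul_sum, sum_add_distrib, sum_sub_distrib]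
  push_cast
  linear_combination 12 * unitInv p m * (1 - dvdInd p (m - D)) * h1
    - 12 * PowerSeries.coeff D (unitLog p ^ 2) * h0

theorem sum_residue_triples (M : ℕ) :
    ∑ m ∈ range (p * M), unitInv p m * ∑ D ∈ range m, dvdInd p (m - D) * (unitInv p D
        * ∑ a ∈ range D, dvdInd p (D - a) * unitInv p a)
      = ∑ i ∈ range p, ∑ u ∈ range M, unitInv p (p * u + i) * ∑ v ∈ range u, unitInv p (p * v + i)
        * ∑ w ∈ range v, unitInv p (p * w + i) := by
  rw [sum_range_mul_eq, sum_comm]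
  refine sum_congr rfl fun i hi => sum_congr rfl fun u _ => ?_
  rw [mem_range] at hi
  rw [sum_range_dvdInd_mul hi u
    fun D => unitInv p D * ∑ a ∈ range D, dvdInd p (D - a) * unitInv p a]
  congr 1
  refine sum_congr rfl fun v _ => ?_
  rw [sum_range_dvdInd_mul hi v]

/-- Newton's identity for the third elementary symmetric function, over all n and over each residue
class; both contribute the full sum of cubes, hence the 4. -/
theorem six_mul_sum_triples_add (M : ℕ) :
    6 * (∑ m ∈ range (p * M), unitInv p m * ∑ D ∈ range m, unitInv p D * ∑ a ∈ range D, unitInv p a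
      + ∑ m ∈ range (p * M), unitInv p m * ∑ D ∈ range m, dvdInd p (m - D) * (unitInv p D
        * ∑ a ∈ range D, dvdInd p (D - a) * unitInv p a))
      = unitPowSum p (p * M) 1 ^ 3 - 3 * unitPowSum p (p * M) 1 * unitPowSum p (p * M) 2
        + 4 * unitPowSum p (p * M) 3
        + ∑ i ∈ range p, (∑ u ∈ range M, unitInv p (p * u + i)) ^ 3
        - 3 * ∑ i ∈ range p, (∑ u ∈ range M, unitInv p (p * u + i))
          * ∑ u ∈ range M, unitInv p (p * u + i) ^ 2 := by
  have h1 := six_mul_sum_range_triples (unitInv p) (p * M)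
  have h2 : ∑ i ∈ range p, 6 * ∑ u ∈ range M, unitInv p (p * u + i)
        * ∑ v ∈ range u, unitInv p (p * v + i) * ∑ w ∈ range v, unitInv p (p * w + i) = _ :=
    sum_congr rfl fun i _ => six_mul_sum_range_triples (fun u => unitInv p (p * u + i)) M
  have h3 := unitPowSum_mul (p := p) M 3
  simp only [sum_add_distrib, sum_sub_distrib, ← mul_sum, mul_assoc] at h2
  rw [sum_residue_triples]
  rw [← h3] at h2
  simp only [unitPowSum, pow_one] at h2 ⊢
  linear_combination h1 + h2

/-- Twice the sum is M³(2H(3) − 3p(M−1)H(4)) plus negligible terms, and 2H(3) ≡ −3pH(4) modulo p³ by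
reflection. -/
theorem sum_residue_cube (hp : 100 < p) {e : ℕ} (he : 0 < e) (he2 : e ≤ 2) :
    (p : ℤ_[p]) ^ 4 * ((p : ℤ_[p]) ^ e) ^ 2 ∣
      2 * ∑ i ∈ range p, (∑ u ∈ range (p ^ e), unitInv p (p * u + i)) ^ 3 := by
  obtain ⟨τ, hτ, h0, h1, -⟩ := exists_powSum_quotient hp e
  obtain ⟨N, hN⟩ := dvd_pow_self (p : ℤ_[p]) he.ne'
  have hi : ∀ i, (p : ℤ_[p]) ^ 3 * ((p : ℤ_[p]) ^ e) ^ 3 ∣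
      (∑ u ∈ range (p ^ e), unitInv p (p * u + i)) ^ 3
      - ((p : ℤ_[p]) ^ e) ^ 3 * (unitInv p i ^ 3 - 3 * p * τ 1 * unitInv p i ^ 4
        + (p : ℤ_[p]) ^ 2 * (3 * τ 1 ^ 2 + 3 * τ 2) * unitInv p i ^ 5) := by
    intro i
    obtain ⟨w, hw⟩ := pow_mul_pow_dvd_sum_residue_sub (p := p) (k := e) (n := 3) (a := 1) he2 one_pos
      (by omega) i
    simp only [sum_range_succ, sum_range_zero, hτ 0 (by norm_num), hτ 1 (by norm_num),
      hτ 2 (by norm_num), h0, Nat.choose, Nat.reduceAdd, Nat.reduceSub, pow_one] at hw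
    push_cast at hw
    set x := unitInv p i
    set M := (p : ℤ_[p]) ^ e
    set P := (p : ℤ_[p])
    set A := ∑ u ∈ range (p ^ e), unitInv p (p * u + i)
    have hA : A = M * (x - P * τ 1 * x ^ 2 + P ^ 2 * τ 2 * x ^ 3 + P ^ 3 * w) := by
      linear_combination hw
    have h3 : P ^ 3 ∣ (x - P * τ 1 * x ^ 2 + P ^ 2 * τ 2 * x ^ 3) ^ 3
        - (x ^ 3 - 3 * P * τ 1 * x ^ 4 + P ^ 2 * (3 * τ 1 ^ 2 + 3 * τ 2) * x ^ 5) :=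
      ⟨-6 * τ 1 * τ 2 * x ^ 6 - τ 1 ^ 3 * x ^ 6
        + P * (3 * τ 2 ^ 2 * x ^ 7 + 3 * τ 1 ^ 2 * τ 2 * x ^ 7)
        - 3 * P ^ 2 * τ 1 * τ 2 ^ 2 * x ^ 8 + P ^ 3 * τ 2 ^ 3 * x ^ 9, by ring⟩
    obtain ⟨z, hz⟩ := h3
    set S := x - P * τ 1 * x ^ 2 + P ^ 2 * τ 2 * x ^ 3
    refine ⟨z + 3 * S ^ 2 * w + 3 * S * P ^ 3 * w ^ 2 + P ^ 6 * w ^ 3, ?_⟩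
    rw [hA]
    linear_combination M ^ 3 * hz
  obtain ⟨w, hw⟩ := dvd_sum_sub_sum (s := range p) fun i _ => hi i
  rw [← mul_sum, sum_add_distrib, sum_sub_distrib, ← mul_sum, ← mul_sum,
    sum_range_unitInv_pow (by norm_num), sum_range_unitInv_pow (by norm_num),
    sum_range_unitInv_pow (by norm_num)] at hw
  rw [← mhsOne, ← mhsOne, ← mhsOne] at hw
  obtain ⟨z3, h3⟩ := mhsOne_reflect p (a := 3) (by norm_num) 3
  obtain ⟨z4, h4⟩ := dvd_mhsOne hp (a := 4) (by norm_num) (by norm_num)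
  obtain ⟨z5, h5⟩ := dvd_mhsOne hp (a := 5) (by norm_num) (by norm_num)
  simp only [sum_range_succ, sum_range_zero, Nat.choose, Nat.reduceAdd, Nat.reduceSub, h4, h5] at h3
  push_cast at h3
  rw [h4, h5] at hw
  rw [hN] at hw h1 ⊢
  refine ⟨N * (2 * w + z3 - 6 * z5 - 3 * N * z4 + 2 * (3 * τ 1 ^ 2 + 3 * τ 2) * z5), ?_⟩
  linear_combination 2 * hw + (p * N) ^ 3 * h3 - 3 * (p : ℤ_[p]) ^ 5 * N ^ 3 * z4 * h1

/-- Twice the sum is M²(2H(3) − 3p(M−1)H(4)) at this precision, and the same reflection leaves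
−3pM³H(4). -/
theorem sum_residue_mul_sq (hp : 100 < p) {e : ℕ} (he2 : e ≤ 2) :
    (p : ℤ_[p]) ^ 4 * ((p : ℤ_[p]) ^ e) ^ 2 ∣
      2 * ∑ i ∈ range p, (∑ u ∈ range (p ^ e), unitInv p (p * u + i))
          * ∑ u ∈ range (p ^ e), unitInv p (p * u + i) ^ 2
        + 3 * p * ((p : ℤ_[p]) ^ e) ^ 3 * mhsOne p 4 := by
  obtain ⟨τ, hτ, h0, h1, -⟩ := exists_powSum_quotient hp e
  have hi : ∀ i, (p : ℤ_[p]) ^ 4 * ((p : ℤ_[p]) ^ e) ^ 2 ∣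
      (∑ u ∈ range (p ^ e), unitInv p (p * u + i)) * (∑ u ∈ range (p ^ e), unitInv p (p * u + i) ^ 2)
      - ((p : ℤ_[p]) ^ e) ^ 2 * (unitInv p i ^ 3 - 3 * p * τ 1 * unitInv p i ^ 4
        + (p : ℤ_[p]) ^ 2 * (4 * τ 2 + 2 * τ 1 ^ 2) * unitInv p i ^ 5
        - 5 * (p : ℤ_[p]) ^ 3 * (τ 3 + τ 1 * τ 2) * unitInv p i ^ 6) := by
    intro i
    obtain ⟨w, hw⟩ := pow_mul_pow_dvd_sum_residue_sub (p := p) (k := e) (n := 4) (a := 1) he2 one_pos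
      (by omega) i
    obtain ⟨v, hv⟩ := pow_mul_pow_dvd_sum_residue_sub (p := p) (k := e) (n := 4) (a := 2) he2 two_pos
      (by omega) i
    simp only [sum_range_succ, sum_range_zero, hτ 0 (by norm_num), hτ 1 (by norm_num),
      hτ 2 (by norm_num), hτ 3 (by norm_num), h0, Nat.choose, Nat.reduceAdd, Nat.reduceSub,
      pow_one] at hw hv
    push_cast at hw hv
    set x := unitInv p i
    set M := (p : ℤ_[p]) ^ e
    set P := (p : ℤ_[p])
    set A := ∑ u ∈ range (p ^ e), unitInv p (p * u + i)
    set B := ∑ u ∈ range (p ^ e), unitInv p (p * u + i) ^ 2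
    have hA : A = M * (x - P * τ 1 * x ^ 2 + P ^ 2 * τ 2 * x ^ 3 - P ^ 3 * τ 3 * x ^ 4
        + P ^ 4 * w) := by
      linear_combination hw
    have hB : B = M * (x ^ 2 - 2 * P * τ 1 * x ^ 3 + 3 * P ^ 2 * τ 2 * x ^ 4
        - 4 * P ^ 3 * τ 3 * x ^ 5 + P ^ 4 * v) := by
      linear_combination hv
    have h3 : P ^ 4 ∣ (x - P * τ 1 * x ^ 2 + P ^ 2 * τ 2 * x ^ 3 - P ^ 3 * τ 3 * x ^ 4)
        * (x ^ 2 - 2 * P * τ 1 * x ^ 3 + 3 * P ^ 2 * τ 2 * x ^ 4 - 4 * P ^ 3 * τ 3 * x ^ 5)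
        - (x ^ 3 - 3 * P * τ 1 * x ^ 4 + P ^ 2 * (4 * τ 2 + 2 * τ 1 ^ 2) * x ^ 5
          - 5 * P ^ 3 * (τ 3 + τ 1 * τ 2) * x ^ 6) :=
      ⟨(6 * τ 1 * τ 3 + 3 * τ 2 ^ 2) * x ^ 7 - 7 * P * τ 2 * τ 3 * x ^ 8
        + 4 * P ^ 2 * τ 3 ^ 2 * x ^ 9, by ring⟩
    obtain ⟨z, hz⟩ := h3
    rw [hA, hB]
    set S := x - P * τ 1 * x ^ 2 + P ^ 2 * τ 2 * x ^ 3 - P ^ 3 * τ 3 * x ^ 4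
    set T := x ^ 2 - 2 * P * τ 1 * x ^ 3 + 3 * P ^ 2 * τ 2 * x ^ 4 - 4 * P ^ 3 * τ 3 * x ^ 5
    refine ⟨z + S * v + T * w + P ^ 4 * w * v, ?_⟩
    linear_combination M ^ 2 * hz
  obtain ⟨w, hw⟩ := dvd_sum_sub_sum (s := range p) fun i _ => hi i
  rw [← mul_sum, sum_sub_distrib, sum_add_distrib, sum_sub_distrib, ← mul_sum, ← mul_sum, ← mul_sum,
    sum_range_unitInv_pow (by norm_num), sum_range_unitInv_pow (by norm_num),
    sum_range_unitInv_pow (by norm_num), sum_range_unitInv_pow (by norm_num)] at hw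
  rw [← mhsOne, ← mhsOne, ← mhsOne, ← mhsOne] at hw
  obtain ⟨z3, h3⟩ := mhsOne_reflect p (a := 3) (by norm_num) 4
  obtain ⟨z5, h5⟩ := sq_dvd_mhsOne hp (a := 5) (by decide) (by norm_num)
  obtain ⟨z6, h6⟩ := dvd_mhsOne hp (a := 6) (by norm_num) (by norm_num)
  simp only [sum_range_succ, sum_range_zero, Nat.choose, Nat.reduceAdd, Nat.reduceSub, h5, h6] at h3
  push_cast at h3
  rw [h5, h6] at hw
  refine ⟨2 * w + z3 - 6 * z5 - 10 * z6 + 2 * (4 * τ 2 + 2 * τ 1 ^ 2) * z5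
    - 10 * (τ 3 + τ 1 * τ 2) * z6, ?_⟩
  linear_combination 2 * hw + ((p : ℤ_[p]) ^ e) ^ 2 * h3
    - 3 * p * ((p : ℤ_[p]) ^ e) ^ 2 * mhsOne p 4 * h1

theorem unitPowSum_three_reflect (hp : 100 < p) {e : ℕ} (he : 0 < e) (he2 : e ≤ 2) :
    (p : ℤ_[p]) ^ 4 * ((p : ℤ_[p]) ^ e) ^ 2 ∣ 2 * unitPowSum p (p * p ^ e) 3
      + 3 * p * ((p : ℤ_[p]) ^ e) ^ 2 * mhsOne p 4 := by
  obtain ⟨τ, hτ, h0, -⟩ := exists_powSum_quotient hp e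
  obtain ⟨N, hN⟩ := dvd_pow_self (p : ℤ_[p]) he.ne'
  obtain ⟨w, hw⟩ := unitPowSum_reflect (p := p) (dvd_mul_right p (p ^ e)) (a := 3) (by norm_num) 3
  obtain ⟨v, hv⟩ := dvd_unitPowSum hp he2 (a := 5) (by norm_num) (by norm_num)
  obtain ⟨u, hu⟩ := pow_mul_pow_dvd_unitPowSum_sub (p := p) (k := e) (n := 3) (a := 4) he2
    (by norm_num) (by omega)
  obtain ⟨z5, h5⟩ := sq_dvd_mhsOne hp (a := 5) (by decide) (by norm_num)
  obtain ⟨z6, h6⟩ := dvd_mhsOne hp (a := 6) (by norm_num) (by norm_num)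
  simp only [sum_range_succ, sum_range_zero, hτ 0 (by norm_num), hτ 1 (by norm_num),
    hτ 2 (by norm_num), h0, Nat.choose, Nat.reduceAdd, Nat.reduceSub, h5, h6, hv] at hw hu
  push_cast at hw hu
  rw [hN] at hw hu ⊢
  refine ⟨N * w - 6 * N * v - 3 * u + 12 * τ 1 * z5 - 30 * τ 2 * z6, ?_⟩
  linear_combination hw - 3 * p * (p * N) * hu

/-- The part of the quartic sum that is a polynomial in power sums. -/
theorem quartic_symmetric_part (hp : 100 < p) {e : ℕ} (he : 0 < e) (he2 : e ≤ 2) {q : ℕ}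
    (hq : q = p * p ^ e) :
    (p : ℤ_[p]) ^ 4 * ((p : ℤ_[p]) ^ e) ^ 2 ∣
      24 * (∑ m ∈ range q, unitInv p m * ∑ D ∈ range m, unitInv p D * ∑ a ∈ range D, unitInv p a
        + ∑ m ∈ range q, unitInv p m * ∑ D ∈ range m, dvdInd p (m - D) * (unitInv p D
          * ∑ a ∈ range D, dvdInd p (D - a) * unitInv p a))
      + 24 * p * ((p : ℤ_[p]) ^ e) ^ 2 * mhsOne p 4 - 18 * p * ((p : ℤ_[p]) ^ e) ^ 3 * mhsOne p 4 := by
  subst hq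
  obtain ⟨N, hN⟩ := dvd_pow_self (p : ℤ_[p]) he.ne'
  -- Multiplied by 4, the terms containing the weight-one sum are negligible, the weight-three sum
  -- gives −24pM²H(4), and the mixed residue sum gives 18pM³H(4).
  have h := six_mul_sum_triples_add (p := p) (p ^ e)
  obtain ⟨w1, h1⟩ := sum_residue_cube hp he he2
  obtain ⟨w2, h2⟩ := sum_residue_mul_sq hp he2
  obtain ⟨w3, h3⟩ := unitPowSum_three_reflect hp he he2
  obtain ⟨v, hv⟩ := sq_dvd_unitPowSum_one hp he2
  obtain ⟨u, hu⟩ := dvd_unitPowSum hp he2 (a := 2) (by norm_num) (by norm_num)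
  rw [hv, hu] at h
  set P := (p : ℤ_[p])
  set M := P ^ e
  refine ⟨4 * P ^ 2 * M ^ 4 * v ^ 3 - 12 * N * v * u + 8 * w3 + 2 * w1 - 6 * w2, ?_⟩
  linear_combination 4 * h + 8 * h3 + 2 * h1 - 6 * h2 - 12 * P ^ 3 * M ^ 2 * v * u * hN

end

section

variable {p : ℕ} [Fact p.Prime]

/-! ### The terms with a middle index divisible by `p` -/

theorem sum_mul_sum_range_swap {R : Type*} [CommRing R] (x g : ℕ → R) (q : ℕ) :
    ∑ m ∈ range q, x m * ∑ D ∈ range m, g D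
      = ∑ D ∈ range q, g D * (∑ m ∈ range q, x m - ∑ m ∈ range D, x m - x D) := by
  induction q with
  | zero => simp
  | succ q ih =>
    rw [sum_range_succ, sum_range_succ _ q, sum_range_succ _ q, ih]
    have : ∀ D, g D * (∑ m ∈ range q, x m + x q - ∑ m ∈ range D, x m - x D)
        = g D * (∑ m ∈ range q, x m - ∑ m ∈ range D, x m - x D) + x q * g D := fun D => by ring
    simp only [this, sum_add_distrib, ← mul_sum]
    ring

theorem two_mul_unitPowSum_one (n : ℕ) (hn : p ∣ n) :
    2 * unitPowSum p n 1 = n * PowerSeries.coeff n (unitLog p ^ 2) := by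
  rw [natCast_mul_coeff_unitLog_pow 1 n, unitPowSum]
  push_cast
  congr 1
  refine sum_congr rfl fun l hl => ?_
  rw [pow_one, pow_one, unitLog, PowerSeries.coeff_mk]
  by_cases h : p ∣ l
  · rw [unitInv_of_dvd h, mul_zero]
  · rw [dvdInd, if_neg fun hd => h ((Nat.dvd_sub_iff_right (mem_range.1 hl).le hn).1 hd)]
    ring

/-- Sum over D = pd last: the sum of 1/m over m > D is the total minus the part below D, and by
`two_mul_unitPowSum_one` that part is pd/2 times the coefficient of L² at pd. -/
theorem two_mul_sum_dvdInd_mul_coeff (M : ℕ) :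
    2 * ∑ m ∈ range (p * M), unitInv p m * ∑ D ∈ range m, dvdInd p D
        * PowerSeries.coeff D (unitLog p ^ 2)
      = 2 * unitPowSum p (p * M) 1 * ∑ d ∈ range M, PowerSeries.coeff (p * d) (unitLog p ^ 2)
        - p * ∑ d ∈ range M, (d : ℤ_[p]) * PowerSeries.coeff (p * d) (unitLog p ^ 2) ^ 2 := by
  rw [sum_mul_sum_range_swap, sum_range_mul_eq, mul_sum, mul_sum, mul_sum, ← sum_sub_distrib]
  refine sum_congr rfl fun d _ => ?_
  have h := two_mul_unitPowSum_one (p := p) (p * d) (dvd_mul_right p d)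
  rw [sum_eq_single 0]
  · rw [add_zero, unitInv_of_dvd (dvd_mul_right p d), dvdInd, if_pos (dvd_mul_right p d)]
    simp only [unitPowSum, pow_one] at h ⊢
    push_cast at h
    linear_combination - PowerSeries.coeff (p * d) (unitLog p ^ 2) * h
  · intro j hj hj0
    rw [dvdInd, if_neg, zero_mul, zero_mul]
    rw [Nat.dvd_add_right (dvd_mul_right p d)]
    exact Nat.not_dvd_of_pos_of_lt (Nat.pos_of_ne_zero hj0) (mem_range.1 hj)
  · intro h0
    exact absurd (mem_range.2 (Fact.out : p.Prime).pos) h0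

/-- Reflect the sum of 1/n over n < pd and divide by pd; d = 0 is separate because of this division.
-/
theorem pow_dvd_coeff_unitLog_sq_add (d J : ℕ) :
    (p : ℤ_[p]) ^ J ∣ PowerSeries.coeff (p * d) (unitLog p ^ 2)
      + ∑ j ∈ range J, ((p : ℤ_[p]) * d) ^ j * unitPowSum p (p * d) (2 + j) := by
  rcases Nat.eq_zero_or_pos d with rfl | hd
  · have h : PowerSeries.constantCoeff (unitLog p) = 0 := by
      rw [← PowerSeries.coeff_zero_eq_constantCoeff_apply, unitLog, PowerSeries.coeff_mk, unitInv_zero]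
    simp [unitPowSum, h]
  · obtain ⟨w, hw⟩ := unitPowSum_reflect (p := p) (dvd_mul_right p d) one_pos (J + 1)
    have h := two_mul_unitPowSum_one (p := p) (p * d) (dvd_mul_right p d)
    rw [sum_range_succ'] at hw
    have hn : ((p * d : ℕ) : ℤ_[p]) ≠ 0 := by
      exact_mod_cast (Nat.mul_pos (Fact.out : p.Prime).pos hd).ne'
    have e : ∑ j ∈ range J, ((1 - 1 + (j + 1)).choose (j + 1) : ℤ_[p]) * ((p * d : ℕ) : ℤ_[p]) ^ (j + 1)
        * unitPowSum p (p * d) (1 + (j + 1))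
        = ((p * d : ℕ) : ℤ_[p]) * ∑ j ∈ range J, ((p : ℤ_[p]) * d) ^ j * unitPowSum p (p * d) (2 + j) := by
      rw [mul_sum]
      refine sum_congr rfl fun j _ => ?_
      rw [Nat.sub_self, zero_add, Nat.choose_self, show 1 + (j + 1) = 2 + j by ring]
      push_cast
      ring
    rw [e] at hw
    simp only [Nat.choose_zero_right, Nat.cast_one, pow_zero, add_zero, one_mul] at hw
    refine ⟨(d : ℤ_[p]) ^ J * w, mul_left_cancel₀ hn ?_⟩
    push_cast at h hw ⊢
    linear_combination hw - h

theorem exists_pow_mul_mhsOne_eq (hp : 100 < p) {n : ℕ} (hn : 3 ≤ n) (hn2 : n < 30) :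
    ∃ c : ℤ_[p], (p : ℤ_[p]) ^ n * mhsOne p (n + 2) = (p : ℤ_[p]) ^ 5 * c := by
  rcases Nat.eq_or_lt_of_le hn with rfl | h
  · obtain ⟨z, hz⟩ := sq_dvd_mhsOne hp (a := 5) (by decide) (by norm_num)
    exact ⟨z, by rw [hz]; ring⟩
  · obtain ⟨z, hz⟩ := dvd_mhsOne hp (a := n + 2) (by omega) (by omega)
    obtain ⟨m, rfl⟩ := Nat.exists_eq_add_of_le h
    exact ⟨(p : ℤ_[p]) ^ m * z, by rw [hz]; ring⟩

/-- The coefficient at pd is a polynomial in d modulo p^6. The tail r is kept in `binSpan` so that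
its weighted sums over d < M remain divisible by M. -/
theorem exists_coeff_unitLog_sq (hp : 100 < p) :
    ∃ r ∈ binSpan p 12, ∀ d : ℕ, (p : ℤ_[p]) ^ 6 ∣ 2 * PowerSeries.coeff (p * d) (unitLog p ^ 2)
      + 2 * d * mhsOne p 2 + 2 * p * d * mhsOne p 3
      + (p : ℤ_[p]) ^ 2 * (d ^ 3 + d) * mhsOne p 4 - (p : ℤ_[p]) ^ 5 * r d := by
  have hc : ∀ n : ℕ, ∃ c : ℤ_[p], 3 ≤ n → n < 30 →
      (p : ℤ_[p]) ^ n * mhsOne p (n + 2) = (p : ℤ_[p]) ^ 5 * c := by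
    intro n
    by_cases h : 3 ≤ n ∧ n < 30
    · obtain ⟨c, hc⟩ := exists_pow_mul_mhsOne_eq hp h.1 h.2
      exact ⟨c, fun _ _ => hc⟩
    · exact ⟨0, fun h1 h2 => absurd ⟨h1, h2⟩ h⟩
  choose c hc using hc
  set b : ℕ → ℕ → ℤ_[p] := fun j s => ((1 + j + s).choose s : ℤ_[p]) * (-1) ^ s
  refine ⟨fun d => ∑ j ∈ range 6, ∑ s ∈ range 6, if j + s < 3 then 0 else
    -2 * b j s * c (j + s) * ((d : ℤ_[p]) ^ j * powSum p d s), ?_, fun d => ?_⟩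
  · have e : (fun d : ℕ => ∑ j ∈ range 6, ∑ s ∈ range 6, if j + s < 3 then (0 : ℤ_[p]) else
        -2 * b j s * c (j + s) * ((d : ℤ_[p]) ^ j * powSum p d s))
        = ∑ j ∈ range 6, ∑ s ∈ range 6, if j + s < 3 then (0 : ℕ → ℤ_[p]) else
          (-2 * b j s * c (j + s)) • fun d : ℕ => (d : ℤ_[p]) ^ j * powSum p d s := by
      funext d
      simp only [Finset.sum_apply]
      refine sum_congr rfl fun j _ => sum_congr rfl fun s _ => ?_
      split_ifs <;> rfl
    rw [e]
    refine Submodule.sum_mem _ fun j hj => Submodule.sum_mem _ fun s hs => ?_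
    split_ifs
    · exact Submodule.zero_mem _
    · rw [mem_range] at hj hs
      exact Submodule.smul_mem _ _ (binSpan_mono (by omega)
        (pow_mul_mem_binSpan (sum_range_mem_binSpan (pow_mem_binSpan s)) j))
  · obtain ⟨w, hw⟩ := pow_dvd_coeff_unitLog_sq_add (p := p) d 6
    have h1 : (p : ℤ_[p]) ^ 6 ∣ ∑ j ∈ range 6, ((p : ℤ_[p]) * d) ^ j * unitPowSum p (p * d) (2 + j)
        - ∑ j ∈ range 6, ((p : ℤ_[p]) * d) ^ j * ∑ s ∈ range 6,
          ((2 + j - 1 + s).choose s : ℤ_[p]) * (-(p : ℤ_[p])) ^ s * powSum p d s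
            * mhsOne p (2 + j + s) := by
      refine dvd_sum_sub_sum fun j _ => ?_
      rw [← mul_sub]
      exact (pow_dvd_unitPowSum_sub (by omega) 6 d).mul_left _
    obtain ⟨v, hv⟩ := h1
    have h2 : ∑ j ∈ range 6, ((p : ℤ_[p]) * d) ^ j * ∑ s ∈ range 6,
          ((2 + j - 1 + s).choose s : ℤ_[p]) * (-(p : ℤ_[p])) ^ s * powSum p d s
            * mhsOne p (2 + j + s)
        = ∑ j ∈ range 6, ∑ s ∈ range 6, (if j + s < 3 then b j s * ((d : ℤ_[p]) ^ j * powSum p d s)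
            * ((p : ℤ_[p]) ^ (j + s) * mhsOne p (j + s + 2)) else 0)
          + (p : ℤ_[p]) ^ 5 * ∑ j ∈ range 6, ∑ s ∈ range 6, if j + s < 3 then 0 else
            b j s * c (j + s) * ((d : ℤ_[p]) ^ j * powSum p d s) := by
      simp only [mul_sum, ← sum_add_distrib]
      refine sum_congr rfl fun j hj => sum_congr rfl fun s hs => ?_
      rw [mem_range] at hj hs
      have e : ((p : ℤ_[p]) * d) ^ j * (((2 + j - 1 + s).choose s : ℤ_[p]) * (-(p : ℤ_[p])) ^ s
          * powSum p d s * mhsOne p (2 + j + s)) = b j s * ((d : ℤ_[p]) ^ j * powSum p d s)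
            * ((p : ℤ_[p]) ^ (j + s) * mhsOne p (j + s + 2)) := by
        simp only [b]
        rw [show 2 + j - 1 + s = 1 + j + s by omega, show 2 + j + s = j + s + 2 by ring,
          neg_pow (p : ℤ_[p])]
        ring
      rw [e]
      split_ifs with h
      · ring
      · rw [hc _ (by omega) (by omega)]
        ring
    have h3 : ∑ j ∈ range 6, ∑ s ∈ range 6, (if j + s < 3 then 0 else
        -2 * b j s * c (j + s) * ((d : ℤ_[p]) ^ j * powSum p d s))
        = -2 * ∑ j ∈ range 6, ∑ s ∈ range 6, if j + s < 3 then 0 else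
            b j s * c (j + s) * ((d : ℤ_[p]) ^ j * powSum p d s) := by
      simp only [mul_sum, mul_ite, mul_zero]
      refine sum_congr rfl fun j hj => sum_congr rfl fun s hs => ?_
      split_ifs <;> ring
    rw [h2] at hv
    have s0 := powSum_zero (p := p) d
    have s1 := powSum_one (p := p) d
    have s2 := powSum_two (p := p) d
    beta_reduce
    rw [h3]
    set X := ∑ j ∈ range 6, ∑ s ∈ range 6, if j + s < 3 then 0 else
            b j s * c (j + s) * ((d : ℤ_[p]) ^ j * powSum p d s)
    set Y := ∑ j ∈ range 6, ((p : ℤ_[p]) * d) ^ j * unitPowSum p (p * d) (2 + j)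
    simp only [b, sum_range_succ, sum_range_zero, Nat.choose, Nat.reduceAdd, Nat.reduceLT, if_true,
      if_false, zero_add, add_zero, s0] at hv
    push_cast at hv
    refine ⟨2 * w - 2 * v, ?_⟩
    linear_combination 2 * hw - 2 * hv + 2 * (p : ℤ_[p]) * mhsOne p 3 * s1
      - (p : ℤ_[p]) ^ 2 * mhsOne p 4 * s2 + 3 * (p : ℤ_[p]) ^ 2 * d * mhsOne p 4 * s1

/-- The main term comes from approximating the coefficient of L² at pd by −dH(2): what remains is
−pH(2)²∑d³, where 4∑d³ = M²(M−1)². -/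
theorem quartic_divisible_part (hp : 100 < p) {e : ℕ} (he : 0 < e) (he2 : e ≤ 2) {q : ℕ}
    (hq : q = p * p ^ e) :
    (p : ℤ_[p]) ^ 4 * ((p : ℤ_[p]) ^ e) ^ 2 ∣
      72 * ∑ m ∈ range q, unitInv p m * ∑ D ∈ range m, dvdInd p D
          * PowerSeries.coeff D (unitLog p ^ 2)
        + 9 * p * ((p : ℤ_[p]) ^ e) ^ 2 * (mhsOne p 2 * mhsOne p 2) := by
  subst hq
  obtain ⟨N, hN⟩ := dvd_pow_self (p : ℤ_[p]) he.ne'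
  obtain ⟨K, hK⟩ := pow_dvd_pow (p : ℤ_[p]) (show e ≤ 3 by omega)
  obtain ⟨L, hL⟩ : (p : ℤ_[p]) ^ 3 * ((p : ℤ_[p]) ^ e) ^ 2 ∣ (p : ℤ_[p]) ^ 7 := by
    rw [← pow_mul, ← pow_add]; exact pow_dvd_pow _ (by omega)
  obtain ⟨r, hr, hB⟩ := exists_coeff_unitLog_sq hp
  obtain ⟨h2, g2⟩ := dvd_mhsOne hp (a := 2) (by norm_num) (by norm_num)
  obtain ⟨h3, g3⟩ := sq_dvd_mhsOne hp (a := 3) (by decide) (by norm_num)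
  obtain ⟨h4, g4⟩ := dvd_mhsOne hp (a := 4) (by norm_num) (by norm_num)
  obtain ⟨v, hv⟩ := sq_dvd_unitPowSum_one hp he2
  have hW := two_mul_sum_dvdInd_mul_coeff (p := p) (p ^ e)
  rw [hv] at hW
  set W := ∑ m ∈ range (p * p ^ e), unitInv p m * ∑ D ∈ range m, dvdInd p D
          * PowerSeries.coeff D (unitLog p ^ 2)
  set B : ℕ → ℤ_[p] := fun d => PowerSeries.coeff (p * d) (unitLog p ^ 2) with hBdef
  set P := (p : ℤ_[p]) with hP
  set M := P ^ e with hM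
  have hB1 : P ^ 2 ∣ ∑ d ∈ range (p ^ e), 2 * B d - ∑ d ∈ range (p ^ e), -2 * (P * h2) * (d : ℤ_[p]) ^ 1 := by
    refine dvd_sum_sub_sum fun d _ => ?_
    obtain ⟨w, hw⟩ := hB d
    rw [g2, g3, g4] at hw
    refine ⟨P ^ 4 * w - 2 * P * d * h3 - P * (d ^ 3 + d) * h4 + P ^ 3 * r d, ?_⟩
    simp only [hBdef]
    linear_combination hw
  obtain ⟨w1, hw1⟩ := hB1
  rw [← mul_sum, ← mul_sum, ← powSum] at hw1
  have hpow : ∀ s : ℕ, s < 50 → ∃ t, powSum p (p ^ e) s = M * t := fun s hs => by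
    have := dvd_powSum (p := p) (s := s) (by omega) e
    push_cast at this
    exact this
  obtain ⟨t1, ht1⟩ := hpow 1 (by norm_num)
  obtain ⟨t3, ht3⟩ := hpow 3 (by norm_num)
  obtain ⟨t5, ht5⟩ := hpow 5 (by norm_num)
  obtain ⟨t7, ht7⟩ := hpow 7 (by norm_num)
  obtain ⟨t, ht⟩ := pow_dvd_sum_of_mem_binSpan (pow_mul_mem_binSpan hr 2) (by omega) e
  have hB2 : P ^ 7 ∣ ∑ d ∈ range (p ^ e), 4 * ((d : ℤ_[p]) * B d ^ 2)
      - ∑ d ∈ range (p ^ e), ((4 * P ^ 2 * h2 ^ 2 + 8 * P ^ 4 * h2 * h3 + 4 * P ^ 4 * h2 * h4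
        + P ^ 6 * (2 * h3 + h4) ^ 2) * (d : ℤ_[p]) ^ 3
        + (4 * P ^ 4 * h2 * h4 + 2 * P ^ 6 * (2 * h3 + h4) * h4) * (d : ℤ_[p]) ^ 5
        + P ^ 6 * h4 ^ 2 * (d : ℤ_[p]) ^ 7 - 4 * P ^ 6 * h2 * ((d : ℤ_[p]) ^ 2 * r d)) := by
    refine dvd_sum_sub_sum fun d _ => ?_
    obtain ⟨w, hw⟩ := hB d
    rw [g2, g3, g4] at hw
    have e1 : 2 * B d = - (2 * P * h2 * d) - P ^ 3 * (2 * h3 * d + h4 * (d ^ 3 + d))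
        + P ^ 5 * (r d + P * w) := by
      simp only [hBdef]
      linear_combination hw
    have e2 : 4 * ((d : ℤ_[p]) * B d ^ 2) = d * (2 * B d) ^ 2 := by ring
    rw [e2, e1]
    refine ⟨-4 * h2 * d ^ 2 * w - 2 * P * d * (2 * h3 * d + h4 * (d ^ 3 + d)) * (r d + P * w)
      + P ^ 3 * d * (r d + P * w) ^ 2, ?_⟩
    ring
  obtain ⟨w2, hw2⟩ := hB2
  rw [sum_sub_distrib, sum_add_distrib, sum_add_distrib, ← mul_sum, ← mul_sum, ← mul_sum, ← mul_sum,
    ← mul_sum, ht, ← powSum, ← powSum, ← powSum, ht3, ht5, ht7, hL] at hw2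
  have s3 := powSum_three (p := p) (p ^ e)
  have s5 := powSum_five (p := p) (p ^ e)
  rw [ht3] at s3
  rw [ht5] at s5
  push_cast at s3 s5 hW hw2
  rw [← hM] at s3 s5
  rw [← hP, ← hM] at hw2
  rw [ht1] at hw1
  change 2 * W = 2 * ((P * M) ^ 2 * v) * ∑ d ∈ range (p ^ e), B d
    - P * ∑ d ∈ range (p ^ e), (d : ℤ_[p]) * B d ^ 2 at hW
  rw [g2]
  refine ⟨36 * v * (w1 - 2 * h2 * N * t1) - 9 * L * w2 + 9 * h2 ^ 2 * N * (2 - M)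
    - 9 * P * (2 * h2 * h3 + h2 * h4) * (M - 1) ^ 2
    - 3 * P * h2 * h4 * (M - 1) ^ 2 * (2 * M ^ 2 - 2 * M - 1)
    - 9 * K * ((2 * h3 + h4) ^ 2 * t3 + 2 * (2 * h3 + h4) * h4 * t5 + h4 ^ 2 * t7 - 4 * h2 * t), ?_⟩
  linear_combination 36 * hW + 36 * P ^ 2 * M ^ 2 * v * hw1 - 9 * P * hw2
    - (9 * P ^ 3 * h2 ^ 2 + 9 * P ^ 5 * (2 * h2 * h3 + h2 * h4)) * s3 - 3 * P ^ 5 * h2 * h4 * s5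
    - 9 * P ^ 4 * M * ((2 * h3 + h4) ^ 2 * t3 + 2 * (2 * h3 + h4) * h4 * t5 + h4 ^ 2 * t7
      - 4 * h2 * t) * hK + (9 * P ^ 3 * M ^ 2 * h2 ^ 2 * (2 - M) - 72 * P ^ 3 * M ^ 2 * v * h2 * t1) * hN

end

section

variable {p : ℕ} [Fact p.Prime]

/-! ### The quartic sum -/

/-- All contributions to qC are known modulo p⁴M², and division by q = pM leaves p³M. In the
bracket, 144 and 108 come from the symmetric part, 72 from the weight-five pair sums, 9 from the
divisible part. -/
theorem pow_mul_dvd_six_mul_coeff_unitLog_four (hp : 100 < p) {e : ℕ} (he : 0 < e) (he2 : e ≤ 2)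
    {M : ℤ_[p]} (hM : M = (p : ℤ_[p]) ^ e) :
    (p : ℤ_[p]) ^ 3 * M ∣ 6 * PowerSeries.coeff (p * p ^ e) (unitLog p ^ 4)
      - M * (6 * (4 * ((M - 1) * (M - 2)) * (mhsOne p 2 * mhsOne p 2)
      + 1 * (12 * (M - 1)) * mhsTwo p 2 2
      + (-2) * (p : ℤ_[p]) * (4 * ((M - 1) * (M - 2))) * mhsTwo p 2 3
      + 3 * (p : ℤ_[p]) ^ 2 * (2 * ((M - 1) ^ 2 * (M - 2))) * mhsTwo p 2 4
      + 2 * (12 * (M - 1)) * mhsTwo p 3 1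
      + (-1) * (p : ℤ_[p]) * (4 * ((M - 1) * (2 * M - 1))) * mhsTwo p 3 2
      + (-3) * (p : ℤ_[p]) * (4 * ((M - 1) * (M - 2))) * mhsTwo p 3 2
      + 2 * (p : ℤ_[p]) ^ 2 * ((M - 1) * (M - 2) * (3 * M - 1)) * mhsTwo p 3 3
      + 4 * (p : ℤ_[p]) ^ 2 * (2 * ((M - 1) ^ 2 * (M - 2))) * mhsTwo p 3 3
      + (-3) * (p : ℤ_[p]) * (4 * ((M - 1) * (2 * M - 1))) * mhsTwo p 4 1
      + (-3) * (p : ℤ_[p]) * (4 * ((M - 1) * (M - 2))) * mhsTwo p 4 1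
      + 1 * (p : ℤ_[p]) ^ 2 * (6 * (M * (M - 1) ^ 2)) * mhsTwo p 4 2
      + 4 * (p : ℤ_[p]) ^ 2 * ((M - 1) * (M - 2) * (3 * M - 1)) * mhsTwo p 4 2
      + 4 * (p : ℤ_[p]) ^ 2 * (2 * ((M - 1) ^ 2 * (M - 2))) * mhsTwo p 4 2
      + 4 * (p : ℤ_[p]) ^ 2 * (6 * (M * (M - 1) ^ 2)) * mhsTwo p 5 1
      + 4 * (p : ℤ_[p]) ^ 2 * ((M - 1) * (M - 2) * (3 * M - 1)) * mhsTwo p 5 1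
      + 4 * (p : ℤ_[p]) ^ 2 * (2 * ((M - 1) ^ 2 * (M - 2))) * mhsTwo p 5 1) - 144 * mhsOne p 4 + 108 * M * mhsOne p 4
        - 72 * p * M * (mhsTwo p 2 3 + 2 * mhsTwo p 3 2 + 3 * mhsTwo p 4 1)
        - 9 * (mhsOne p 2 * mhsOne p 2)) := by
  obtain ⟨N, hN⟩ := dvd_pow_self (p : ℤ_[p]) he.ne'
  have ha := natCast_mul_coeff_unitLog_four (p := p) (dvd_mul_right p (p ^ e))
  obtain ⟨wb, hb⟩ := quartic_symmetric_part hp he he2 rfl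
  obtain ⟨wc, hc⟩ := pow_three_dvd_pairSum_reflect (p := p) (dvd_mul_right p (p ^ e))
  obtain ⟨wd, hd⟩ := pairSum_four hp he2 hM
  obtain ⟨we, hf⟩ := pairSum_five hp he
  obtain ⟨wf, hg⟩ := quartic_divisible_part hp he he2 rfl
  have hP0 : (p : ℤ_[p]) ≠ 0 := by exact_mod_cast (Fact.out : p.Prime).ne_zero
  have hM0 : M ≠ 0 := hM ▸ pow_ne_zero e hP0
  push_cast at ha hc
  rw [← hM] at hN ha hb hc hf hg
  set Z : ℤ_[p] := 4 * ((M - 1) * (M - 2)) * (mhsOne p 2 * mhsOne p 2)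
      + 1 * (12 * (M - 1)) * mhsTwo p 2 2
      + (-2) * (p : ℤ_[p]) * (4 * ((M - 1) * (M - 2))) * mhsTwo p 2 3
      + 3 * (p : ℤ_[p]) ^ 2 * (2 * ((M - 1) ^ 2 * (M - 2))) * mhsTwo p 2 4
      + 2 * (12 * (M - 1)) * mhsTwo p 3 1
      + (-1) * (p : ℤ_[p]) * (4 * ((M - 1) * (2 * M - 1))) * mhsTwo p 3 2
      + (-3) * (p : ℤ_[p]) * (4 * ((M - 1) * (M - 2))) * mhsTwo p 3 2
      + 2 * (p : ℤ_[p]) ^ 2 * ((M - 1) * (M - 2) * (3 * M - 1)) * mhsTwo p 3 3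
      + 4 * (p : ℤ_[p]) ^ 2 * (2 * ((M - 1) ^ 2 * (M - 2))) * mhsTwo p 3 3
      + (-3) * (p : ℤ_[p]) * (4 * ((M - 1) * (2 * M - 1))) * mhsTwo p 4 1
      + (-3) * (p : ℤ_[p]) * (4 * ((M - 1) * (M - 2))) * mhsTwo p 4 1
      + 1 * (p : ℤ_[p]) ^ 2 * (6 * (M * (M - 1) ^ 2)) * mhsTwo p 4 2
      + 4 * (p : ℤ_[p]) ^ 2 * ((M - 1) * (M - 2) * (3 * M - 1)) * mhsTwo p 4 2
      + 4 * (p : ℤ_[p]) ^ 2 * (2 * ((M - 1) ^ 2 * (M - 2))) * mhsTwo p 4 2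
      + 4 * (p : ℤ_[p]) ^ 2 * (6 * (M * (M - 1) ^ 2)) * mhsTwo p 5 1
      + 4 * (p : ℤ_[p]) ^ 2 * ((M - 1) * (M - 2) * (3 * M - 1)) * mhsTwo p 5 1
      + 4 * (p : ℤ_[p]) ^ 2 * (2 * ((M - 1) ^ 2 * (M - 2))) * mhsTwo p 5 1
  generalize PowerSeries.coeff (p * p ^ e) (unitLog p ^ 4) = C at *
  set P := (p : ℤ_[p])
  refine ⟨6 * wb - 144 * N * wc + 6 * wd + 72 * we + wf, mul_left_cancel₀ (mul_ne_zero hP0 hM0) ?_⟩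
  linear_combination 6 * ha + 6 * hb - 144 * hc + 6 * P * M * hd + 72 * P ^ 2 * M ^ 2 * hf + hg
    - 144 * P ^ 3 * M ^ 2 * wc * hN

theorem curious_four_sq (hp : 100 < p) :
    (p : ℤ_[p]) ^ 4 ∣ 15 * PowerSeries.coeff (p ^ 2) (unitLog p ^ 4)
      - (-72 * (p : ℤ_[p]) ^ 2 * mhsTwo p 4 1 + 28 * (p : ℤ_[p]) ^ 3 * mhsThree p 4 1 1) := by
  obtain ⟨w, hw⟩ := pow_mul_dvd_six_mul_coeff_unitLog_four hp one_pos one_le_two rfl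
  obtain ⟨v, hv⟩ := quartic_relation_sq hp
  obtain ⟨u, hu⟩ := mhsThree_relation hp
  obtain ⟨z, hz⟩ := dvd_mhsOne hp (a := 2) (by norm_num) (by norm_num)
  rw [pow_one, ← sq] at hw
  rw [hz] at hw hv hu
  set P := (p : ℤ_[p])
  -- Ten times 6C is 4·15C, and 14·8 = 4·28 matches the triple sum; the explicit terms carry p⁴
  -- after substituting H(2) = pz.
  refine pow_dvd_of_pow_dvd_natCast_mul hp (D := 4) (k := 1) (by norm_num) ⟨10 * w + 6 * v - 14 * u
    + (
      (-720) * z ^ 2 + 240 * P * z ^ 2 + (-480) * mhsTwo p 2 3 + 1800 * mhsTwo p 2 4 +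
      (-1200) * mhsTwo p 3 2 + 3480 * mhsTwo p 3 3 + (-2160) * mhsTwo p 4 1 + 4920 *
      mhsTwo p 4 2 + 6000 * mhsTwo p 5 1 + (-1440) * P * mhsTwo p 2 4 + (-3120) * P *
      mhsTwo p 3 3 + (-5040) * P * mhsTwo p 4 2 + (-7200) * P * mhsTwo p 5 1 + 360 * P ^
      2 * mhsTwo p 2 4 + 840 * P ^ 2 * mhsTwo p 3 3 + 1560 * P ^ 2 * mhsTwo p 4 2 + 2640
      * P ^ 2 * mhsTwo p 5 1), ?_⟩
  push_cast
  linear_combination 10 * hw + 6 * P * hv - 14 * P * hu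

theorem curious_four_cube (hp : 100 < p) :
    (p : ℤ_[p]) ^ 5 ∣ 15 * PowerSeries.coeff (p ^ 3) (unitLog p ^ 4)
      - (-72 * (p : ℤ_[p]) ^ 3 * mhsTwo p 4 1 + 28 * (p : ℤ_[p]) ^ 4 * mhsThree p 4 1 1) := by
  obtain ⟨w, hw⟩ := pow_mul_dvd_six_mul_coeff_unitLog_four hp two_pos le_rfl rfl
  obtain ⟨v, hv⟩ := quartic_relation_cube hp
  obtain ⟨u, hu⟩ := mhsThree_relation hp
  obtain ⟨z, hz⟩ := dvd_mhsOne hp (a := 2) (by norm_num) (by norm_num)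
  rw [← pow_succ'] at hw
  rw [hz] at hw hv hu
  set P := (p : ℤ_[p])
  refine pow_dvd_of_pow_dvd_natCast_mul hp (D := 4) (k := 1) (by norm_num) ⟨10 * w + 6 * v - 14 * u
    + (
      (-720) * P * z ^ 2 + 720 * mhsTwo p 2 3 + 1440 * mhsTwo p 3 2 + 2160 * mhsTwo p 4
      1 + 240 * P ^ 3 * z ^ 2 + 1800 * P * mhsTwo p 2 4 + 3480 * P * mhsTwo p 3 3 + 4920
      * P * mhsTwo p 4 2 + 6000 * P * mhsTwo p 5 1 + (-480) * P ^ 2 * mhsTwo p 2 3 +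
      (-1200) * P ^ 2 * mhsTwo p 3 2 + (-2160) * P ^ 2 * mhsTwo p 4 1 + (-1440) * P ^ 3
      * mhsTwo p 2 4 + (-3120) * P ^ 3 * mhsTwo p 3 3 + (-5040) * P ^ 3 * mhsTwo p 4 2 +
      (-7200) * P ^ 3 * mhsTwo p 5 1 + 360 * P ^ 5 * mhsTwo p 2 4 + 840 * P ^ 5 * mhsTwo
      p 3 3 + 1560 * P ^ 5 * mhsTwo p 4 2 + 2640 * P ^ 5 * mhsTwo p 5 1), ?_⟩
  push_cast
  linear_combination 10 * hw + 6 * P ^ 2 * hv - 14 * P ^ 2 * hu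

end

/-! ### Clearing the denominators 35 and 15 and the finite exceptional set -/

section

variable {p : ℕ} [Fact p.Prime]

theorem ratModEq_of_pow_dvd_natCast_mul {n D : ℕ} (hD : ¬ p ∣ D) {x y : ℚ} {u v : ℤ_[p]}
    (hx : (x : ℚ_[p]) = u) (hy : (D : ℚ_[p]) * y = v) (h : (p : ℤ_[p]) ^ n ∣ (D : ℤ_[p]) * u - v) :
    RatModEq (p ^ n) x y := by
  have h1 := mul_unitInv hD
  refine ratModEq_of_pow_dvd (v := unitInv p D * v) hx ?_ ?_
  · have h2 := congrArg (fun z : ℤ_[p] => (z : ℚ_[p])) h1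
    simp only [PadicInt.coe_mul, PadicInt.coe_natCast, PadicInt.coe_one] at h2
    rw [PadicInt.coe_mul, ← hy]
    linear_combination -(y : ℚ_[p]) * h2
  · have h2 : u - unitInv p D * v = unitInv p D * ((D : ℤ_[p]) * u - v) := by
      linear_combination -u * h1
    rw [h2]
    exact h.mul_left _

end

theorem supercongruence_of_forall {n : ℕ} {a b : ℕ → ℚ}
    (h : ∀ (p : ℕ) [Fact p.Prime], 100 < p → RatModEq (p ^ n) (a p) (b p)) :
    Supercongruence n a b := by
  refine (Set.finite_Iic 100).subset fun p hp => ?_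
  by_contra hlt
  rw [Set.mem_Iic, not_le] at hlt
  have := Fact.mk hp.1
  exact hp.2 (h p hlt)

end

theorem mainTheorem8 :
    Supercongruence 6 (fun p => curiousSum 2 3 p)
      (fun p => -2 * (p : ℚ) * multipleHarmonicSum (p - 1) [2, 1]
        + (2 * (p : ℚ) ^ 3 - 11 / 5 * (p : ℚ) ^ 5) * multipleHarmonicSum (p - 1) [4, 1]
        - 69 / 35 * (p : ℚ) ^ 5 * multipleHarmonicSum (p - 1) [6, 1]) ∧
    Supercongruence 4 (fun p => curiousSum 2 4 p)
      (fun p => -(24 / 5) * (p : ℚ) ^ 2 * multipleHarmonicSum (p - 1) [4, 1]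
        + 28 / 15 * (p : ℚ) ^ 3 * multipleHarmonicSum (p - 1) [4, 1, 1]) ∧
    Supercongruence 6 (fun p => curiousSum 3 3 p)
      (fun p => -2 * (p : ℚ) ^ 2 * multipleHarmonicSum (p - 1) [2, 1]
        + 2 * (p : ℚ) ^ 4 * multipleHarmonicSum (p - 1) [4, 1]) ∧
    Supercongruence 5 (fun p => curiousSum 3 4 p)
      (fun p => -(24 / 5) * (p : ℚ) ^ 3 * multipleHarmonicSum (p - 1) [4, 1]
        + 28 / 15 * (p : ℚ) ^ 4 * multipleHarmonicSum (p - 1) [4, 1, 1]) := by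
  refine ⟨supercongruence_of_forall fun p _ hp => ?_, supercongruence_of_forall fun p _ hp => ?_,
    supercongruence_of_forall fun p _ hp => ?_, supercongruence_of_forall fun p _ hp => ?_⟩
  · refine ratModEq_of_pow_dvd_natCast_mul (D := 35) (Nat.not_dvd_of_pos_of_lt (by norm_num)
      (by omega)) (cast_curiousSum 2 3) ?_ (curious_cube_sq hp)
    have h70 : ((70 : ℤ_[p]) : ℚ_[p]) = 70 := map_ofNat PadicInt.Coe.ringHom 70
    have h77 : ((77 : ℤ_[p]) : ℚ_[p]) = 77 := map_ofNat PadicInt.Coe.ringHom 77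
    have h69 : ((69 : ℤ_[p]) : ℚ_[p]) = 69 := map_ofNat PadicInt.Coe.ringHom 69
    simp only [PadicInt.coe_add, PadicInt.coe_sub, PadicInt.coe_neg, PadicInt.coe_mul,
      PadicInt.coe_pow, PadicInt.coe_natCast, h70, h77, h69, ← cast_multipleHarmonicSum_two]
    push_cast
    ring
  · refine ratModEq_of_pow_dvd_natCast_mul (D := 15) (Nat.not_dvd_of_pos_of_lt (by norm_num)
      (by omega)) (cast_curiousSum 2 4) ?_ (curious_four_sq hp)
    have h72 : ((72 : ℤ_[p]) : ℚ_[p]) = 72 := map_ofNat PadicInt.Coe.ringHom 72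
    have h28 : ((28 : ℤ_[p]) : ℚ_[p]) = 28 := map_ofNat PadicInt.Coe.ringHom 28
    simp only [PadicInt.coe_add, PadicInt.coe_neg, PadicInt.coe_mul,
      PadicInt.coe_pow, PadicInt.coe_natCast, h72, h28, ← cast_multipleHarmonicSum_two,
      ← cast_multipleHarmonicSum_three]
    push_cast
    ring
  · refine ratModEq_of_pow_dvd (cast_curiousSum 3 3) ?_ (curious_cube_cube hp)
    have h2 : ((2 : ℤ_[p]) : ℚ_[p]) = 2 := map_ofNat PadicInt.Coe.ringHom 2
    simp only [PadicInt.coe_add, PadicInt.coe_neg, PadicInt.coe_mul,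
      PadicInt.coe_pow, PadicInt.coe_natCast, h2, ← cast_multipleHarmonicSum_two]
    push_cast
    ring
  · refine ratModEq_of_pow_dvd_natCast_mul (D := 15) (Nat.not_dvd_of_pos_of_lt (by norm_num)
      (by omega)) (cast_curiousSum 3 4) ?_ (curious_four_cube hp)
    have h72 : ((72 : ℤ_[p]) : ℚ_[p]) = 72 := map_ofNat PadicInt.Coe.ringHom 72
    have h28 : ((28 : ℤ_[p]) : ℚ_[p]) = 28 := map_ofNat PadicInt.Coe.ringHom 28
    simp only [PadicInt.coe_add, PadicInt.coe_neg, PadicInt.coe_mul,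
      PadicInt.coe_pow, PadicInt.coe_natCast, h72, h28, ← cast_multipleHarmonicSum_two,
      ← cast_multipleHarmonicSum_three]
    push_cast
    ring
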